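/- Throughout, $\log$ is the logarithm to base $2$, and for $p=\infty$ the expression $(p+1)^{1/p}$ (and its powers $(p+1)^{d/p}$, $(p+1)^{-1/(p\alpha)}$) is read as its limit $1$. **Function spaces.** For $u\subset\{1,\dots,d\}$ and $h\in\mathbb R^d$ with $h_i>0$ for $i\in u$ let $\Delta^{2,u}_h=\prod_{i\in u}\Delta^2_{h_i}$, where $\Delta^2_{h_i}$ is the second difference $g(x+2h_i)-2g(x+h_i)+g(x)$ in the $i$-th variable. Let $\mathring U^\alpha_\infty$ be the set of continuous $f$ on $[0,1]^d$ that vanish on the boundary of the cube and satisfy $$\max_{u\subset\{1,\dots,d\}}\ \sup_h\ \prod_{i\in u}h_i^{-\alpha}\ \sup\{|\Delta^{2,u}_hf(x)|:\ x\in[0,1]^d,\ x_i+2h_i\in[0,1]\ (i\in u)\}\le 1 .$$ Let $\mathring W^1_p$ be the space of $g\in L_p([0,1]^d)$ with weak partial derivatives in $L_p$ and zero trace on the boundary, with norm $\|g\|_{\mathring W^1_p}=\big(\sum_{i=1}^d\int_{[0,1]^d}|\partial_ig|^p\,dx\big)^{1/p}$ for $p<\infty$ and $\max_i\operatorname{ess\,sup}|\partial_ig|$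 for $p=\infty$. **Networks.** A network $\Phi=((W^1,b^1),\dots,(W^L,b^L))$ of depth $L(\Phi)=L\ge2$ with input dimension $d$ consists of real $N_\ell\times N_{\ell-1}$ matrices $W^\ell$ and vectors $b^\ell\in\mathbb R^{N_\ell}$ with $N_0=d$, $N_L=1$, $N_1,\dots,N_{L-1}\ge1$. Its size $W(\Phi)$ is the number of nonzero entries of all $W^\ell$ and $b^\ell$. Its ReLU output is $\mathcal N(\Phi,x)=z^L$, where $z^0=x$, $z^\ell=\sigma(W^\ell z^{\ell-1}+b^\ell)$ for $\ell<L$, $z^L=W^Lz^{L-1}+b^L$ and $\sigma(t)=\max\{t,0\}$ acts componentwise. An architecture is a network with all entries in $\{0,1\}$; $\Phi$ has architecture $\mathbb A$ if both have the same depth and dimensions $(N_\ell)$ and every entry of $\Phi$ is zero wherever the corresponding entry of $\mathbb A$ is. **Theorem.** Let $d\ge2$, $1<\alpha\le2$, $\beta>\alpha$ and $1\le p\le\infty$. Let $K_1=2(p+1)^{1/p}\max\big\{\frac{2\beta}{\beta-1},\frac1{2^{\alpha-1}-1}\big\}$ and $$\varepsilon_0=\min\Big\{1,\ \frac{d}{2^{\alpha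 d}(1-2^{1-\alpha})},\ \frac{K_1d^2}{(p+1)^{d/p}\,2^{(\alpha+1)d}\,\big(1-2^{-\frac{\beta-\alpha}{\beta-1}}\big)^d}\Big\},$$ $$B=B(d,\alpha,\beta,p)=\big(1-2^{-\frac1{\beta-1}}\big)\Big(\frac{(p+1)^{1/p}\,2^{\alpha+1}\big(1-2^{-\frac{\beta-\alpha}{\beta-1}}\big)}{d^{2\alpha/d}}\Big)^{\frac1{\alpha-1}} .$$ There are positive constants $K_2=K_2(\alpha)$ and $K_3=K_3(\alpha,\beta,p)$ such that for every $\varepsilon\in(0,\varepsilon_0)$ there is an architecture $\mathbb A_\varepsilon$ (independent of $f$) with the following property: for every $f\in\mathring U^\alpha_\infty$ there is a network $\Phi_f$ with architecture $\mathbb A_\varepsilon$ such that $f-\mathcal N(\Phi_f,\cdot)\in\mathring W^1_p$ and $$\|f-\mathcal N(\Phi_f,\cdot)\|_{\mathring W^1_p}\le\varepsilon ,$$ and moreover $$L(\mathbb A_\varepsilon)\le K_2\,\log d\,\max\{1,\log(\varepsilon^{-1})\},\qquad W(\mathbb A_\varepsilon)\le K_3\,B^{-d}\,(\varepsilon^{-1})^{\frac1{\alpha-1}}\max\{1,\log(\varepsilon^{-1})\}$$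 (where $\max\{1,\log(\varepsilon^{-1})\}=\log(\varepsilon^{-1})$ for $\varepsilon\le1/2$). Moreover, put $\lambda=\log\big(1-(p+1)^{-\frac1{p\alpha}}2^{-1-\frac1\alpha}\big)$. If $$2^{\frac1\alpha}-\tfrac12(p+1)^{-\frac1{p\alpha}}>1\qquad\text{and}\qquad\frac{\alpha+\lambda}{1+\lambda}<\beta<1-\frac1\lambda ,$$ then there are $d_0=d_0(\alpha,\beta,p)\in\mathbb N$ and $B_0=B_0(\alpha,\beta,p)>1$ such that $B(d,\alpha,\beta,p)\ge B_0$ for all $d\ge d_0$. The first of these two conditions holds for all $\alpha\in(1,2]$ if $1\le p\le2$. -/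

import Mathlib

open MeasureTheory Set
open scoped ENNReal ContDiff

noncomputable section

namespace ReLUApprox

/-! ### Deep neural networks -/

/-- Depth `L ≥ 2` and dimension `(N_0, …, N_L)` of a network with input dimension `d` and scalar
output. Only the values `width ℓ` with `ℓ ≤ depth` are ever used. -/
structure NetShape (d : ℕ) where
  depth : ℕ
  two_le_depth : 2 ≤ depth
  width : ℕ → ℕ
  width_zero : width 0 = d
  width_depth : width depth = 1
  width_pos : ∀ ℓ, 0 < ℓ → ℓ < depth → 0 < width ℓ

/-- A deep neural network of a given depth and dimension: `weight ℓ` and `bias ℓ` are the matrix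
and the vector that lead from layer `ℓ` to layer `ℓ + 1`, `0 ≤ ℓ < L`. -/
structure NeuralNet {d : ℕ} (S : NetShape d) where
  weight : (ℓ : Fin S.depth) → Matrix (Fin (S.width (ℓ + 1))) (Fin (S.width ℓ)) ℝ
  bias : (ℓ : Fin S.depth) → Fin (S.width (ℓ + 1)) → ℝ

namespace NeuralNet

variable {d : ℕ} {S : NetShape d}

/-- The depth (number of layers). -/
def depth (_Φ : NeuralNet S) : ℕ := S.depth

/-- The size: the number of nonzero edge and node weights. -/
def size (Φ : NeuralNet S) : ℕ :=
  (∑ ℓ : Fin S.depth, (Finset.univ.filter fun q : Fin (S.width (ℓ + 1)) × Fin (S.width ℓ) =>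
      Φ.weight ℓ q.1 q.2 ≠ 0).card) +
    ∑ ℓ : Fin S.depth, (Finset.univ.filter fun i : Fin (S.width (ℓ + 1)) => Φ.bias ℓ i ≠ 0).card

/-- The vector `z^ℓ` of the ReLU computation scheme; the activation is applied in every layer
except the last one. -/
def layer (Φ : NeuralNet S) (x : Fin d → ℝ) : (ℓ : ℕ) → ℓ ≤ S.depth → Fin (S.width ℓ) → ℝ
  | 0, _ => fun i => x (Fin.cast S.width_zero i)
  | ℓ + 1, h => fun i =>
      let a := ((Φ.weight ⟨ℓ, h⟩).mulVec (Φ.layer x ℓ (Nat.le_of_succ_le h)) + Φ.bias ⟨ℓ, h⟩) i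
      if ℓ + 1 = S.depth then a else max a 0

/-- The output of the deep ReLU network. -/
def output (Φ : NeuralNet S) (x : Fin d → ℝ) : ℝ :=
  Φ.layer x S.depth le_rfl (Fin.cast S.width_depth.symm 0)

/-- An architecture is a network whose weights all lie in `{0, 1}`. -/
def IsArchitecture (A : NeuralNet S) : Prop :=
  (∀ ℓ i j, A.weight ℓ i j = 0 ∨ A.weight ℓ i j = 1) ∧ ∀ ℓ i, A.bias ℓ i = 0 ∨ A.bias ℓ i = 1

/-- `Φ` has the architecture `A` (equality of the dimensions is part of the typing). -/
def HasArchitecture (Φ A : NeuralNet S) : Prop :=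
  (∀ ℓ i j, A.weight ℓ i j = 0 → Φ.weight ℓ i j = 0) ∧ ∀ ℓ i, A.bias ℓ i = 0 → Φ.bias ℓ i = 0

end NeuralNet

/-! ### Hölder–Zygmund spaces of mixed smoothness -/

/-- The closed unit cube `[0,1]^d`. -/
def unitCube (d : ℕ) : Set (Fin d → ℝ) := Icc 0 1

/-- The open unit cube `(0,1)^d`. -/
def openCube (d : ℕ) : Set (Fin d → ℝ) := {x | ∀ i, 0 < x i ∧ x i < 1}

/-- The second difference with step `h` in the `i`-th variable, as a linear operator. -/
def secondDiff {d : ℕ} (i : Fin d) (h : ℝ) : Module.End ℝ ((Fin d → ℝ) → ℝ) where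
  toFun f x := f (Function.update x i (x i + 2 * h)) - 2 * f (Function.update x i (x i + h)) + f x
  map_add' f g := by
    funext x
    simp only [Pi.add_apply]
    ring
  map_smul' c f := by
    funext x
    simp only [Pi.smul_apply, smul_eq_mul, RingHom.id_apply]
    ring

theorem secondDiff_commute {d : ℕ} {i j : Fin d} (hij : i ≠ j) (s t : ℝ) :
    Commute (secondDiff i s) (secondDiff j t) := by
  refine LinearMap.ext fun f => funext fun x => ?_
  simp only [Module.End.mul_apply, secondDiff, LinearMap.coe_mk, AddHom.coe_mk,
    Function.update_of_ne hij, Function.update_of_ne hij.symm, Function.update_comm hij]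
  ring

/-- The mixed difference operator `∏_{i ∈ u} Δ²_{h_i}`, the `i`-th factor acting on the `i`-th
variable. -/
def mixedDiff {d : ℕ} (u : Finset (Fin d)) (h : Fin d → ℝ) :
    Module.End ℝ ((Fin d → ℝ) → ℝ) :=
  u.noncommProd (fun i => secondDiff i (h i)) fun _ _ _ _ hij => secondDiff_commute hij _ _

/-- The set of `x ∈ [0,1]^d` with `x_i + 2 h_i ∈ [0,1]` for `i ∈ u`. -/
def diffDomain {d : ℕ} (u : Finset (Fin d)) (h : Fin d → ℝ) : Set (Fin d → ℝ) :=
  {x | x ∈ unitCube d ∧ ∀ i ∈ u, x i + 2 * h i ∈ Icc (0 : ℝ) 1}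

/-- The Hölder–Zygmund norm of mixed smoothness `α`, with value `∞` outside of the space. -/
def holderNorm {d : ℕ} (α : ℝ) (f : (Fin d → ℝ) → ℝ) : ℝ≥0∞ :=
  ⨆ (u : Finset (Fin d)) (h : Fin d → ℝ) (_ : ∀ i ∈ u, 0 < h i) (x ∈ diffDomain u h),
    ENNReal.ofReal ((∏ i ∈ u, h i ^ (-α)) * |mixedDiff u h f x|)

/-- The unit ball of the space of functions on `[0,1]^d` of mixed Hölder–Zygmund smoothness `α`
that vanish on the boundary of the cube. -/
def holderBall (d : ℕ) (α : ℝ) : Set ((Fin d → ℝ) → ℝ) :=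
  {f | ContinuousOn f (unitCube d) ∧
    (∀ x ∈ unitCube d, (∃ j, x j = 0 ∨ x j = 1) → f x = 0) ∧ holderNorm α f ≤ 1}

/-! ### The Sobolev space `W̊¹_p` on the unit cube -/

/-- The partial derivative `∂φ/∂x_i` of a smooth function. -/
def partialDeriv {d : ℕ} (i : Fin d) (φ : (Fin d → ℝ) → ℝ) (x : Fin d → ℝ) : ℝ :=
  fderiv ℝ φ x (Pi.single i 1)

/-- `G = (G_1, …, G_d)` is the weak gradient of `g` in `(0,1)^d`. -/
def IsWeakGradient {d : ℕ} (g : (Fin d → ℝ) → ℝ) (G : Fin d → (Fin d → ℝ) → ℝ) : Prop :=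
  LocallyIntegrableOn g (openCube d) ∧
    ∀ i, LocallyIntegrableOn (G i) (openCube d) ∧
      ∀ φ : (Fin d → ℝ) → ℝ, ContDiff ℝ ∞ φ → HasCompactSupport φ → tsupport φ ⊆ openCube d →
        ∫ x in openCube d, g x * partialDeriv i φ x = -∫ x in openCube d, G i x * φ x

/-- Vanishing trace on the boundary of the cube, for an integrable `g` with integrable weak
gradient `G`: in Green's formula
`∫_Ω g ∂_i φ + ∫_Ω G_i φ = ∫_{∂Ω} (tr g) φ ν_i`
the boundary term is zero for all `i` and all `φ` that are smooth up to the boundary. -/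
def HasZeroTrace {d : ℕ} (g : (Fin d → ℝ) → ℝ) (G : Fin d → (Fin d → ℝ) → ℝ) : Prop :=
  ∀ (i : Fin d) (φ : (Fin d → ℝ) → ℝ), ContDiff ℝ ∞ φ → HasCompactSupport φ →
    (∫ x in openCube d, g x * partialDeriv i φ x) + ∫ x in openCube d, G i x * φ x = 0

/-- Membership in `W̊¹_p` on the unit cube. -/
def MemSobolevZero {d : ℕ} (p : ℝ≥0∞) (g : (Fin d → ℝ) → ℝ) : Prop :=
  MemLp g p (volume.restrict (unitCube d)) ∧
    ∃ G : Fin d → (Fin d → ℝ) → ℝ, IsWeakGradient g G ∧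
      (∀ i, MemLp (G i) p (volume.restrict (unitCube d))) ∧ HasZeroTrace g G

/-- `(∑_i ∫ |G_i|^p)^{1/p}` for `p < ∞` and `max_i ess sup |G_i|` for `p = ∞`. -/
def gradNorm {d : ℕ} (p : ℝ≥0∞) (G : Fin d → (Fin d → ℝ) → ℝ) : ℝ≥0∞ :=
  if p = ⊤ then ⨆ i, essSup (fun x => ‖G i x‖ₑ) (volume.restrict (unitCube d))
  else (∑ i, ∫⁻ x in unitCube d, ‖G i x‖ₑ ^ p.toReal) ^ (1 / p.toReal)

/-- The norm of `W̊¹_p`. Weak gradients are unique almost everywhere, so that the infimum is over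
one value if there is a weak gradient, and it is `∞` if there is none. -/
def sobolevNorm {d : ℕ} (p : ℝ≥0∞) (g : (Fin d → ℝ) → ℝ) : ℝ≥0∞ :=
  ⨅ (G : Fin d → (Fin d → ℝ) → ℝ) (_ : IsWeakGradient g G), gradNorm p G

/-! ### The explicit quantities -/

/-- `(p + 1)^{1/p}`, which at `p = ∞` is understood as the limit `1`. -/
def cP (p : ℝ≥0∞) : ℝ := if p = ⊤ then 1 else (p.toReal + 1) ^ (1 / p.toReal)

/-- `1 - 2^{-(β-α)/(β-1)}`. -/
def qAB (α β : ℝ) : ℝ := 1 - 2 ^ (-((β - α) / (β - 1)))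

/-- `K_1 = 2 (p+1)^{1/p} max {2β/(β-1), 1/(2^{α-1}-1)}`. -/
def K1 (α β : ℝ) (p : ℝ≥0∞) : ℝ :=
  2 * cP p * max (2 * β / (β - 1)) (1 / (2 ^ (α - 1) - 1))

/-- The threshold `ε_0`. -/
def eps0 (d : ℕ) (α β : ℝ) (p : ℝ≥0∞) : ℝ :=
  min 1 (min ((d : ℝ) / (2 ^ (α * d) * (1 - 2 ^ (1 - α))))
    (K1 α β p * (d : ℝ) ^ 2 / (cP p ^ d * 2 ^ ((α + 1) * d) * qAB α β ^ d)))

/-- The base `B = B(d, α, β, p)`. -/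
def baseB (d : ℕ) (α β : ℝ) (p : ℝ≥0∞) : ℝ :=
  (1 - 2 ^ (-(1 / (β - 1)))) *
    (cP p * 2 ^ (α + 1) * qAB α β / (d : ℝ) ^ (2 * α / d)) ^ (1 / (α - 1))

/-- The condition `2^{1/α} - (p+1)^{-1/(pα)}/2 > 1`. -/
def CondAlpha (α : ℝ) (p : ℝ≥0∞) : Prop :=
  1 < (2 : ℝ) ^ (1 / α) - cP p ^ (-(1 / α)) / 2

/-- `log₂ (1 - (p+1)^{-1/(pα)} 2^{-1-1/α})`. -/
def ellAP (α : ℝ) (p : ℝ≥0∞) : ℝ :=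
  Real.logb 2 (1 - cP p ^ (-(1 / α)) * 2 ^ (-1 - 1 / α))

/-- The two-sided condition on `β`. -/
def CondBeta (α β : ℝ) (p : ℝ≥0∞) : Prop :=
  (α + ellAP α p) / (1 + ellAP α p) < β ∧ β < 1 - 1 / ellAP α p

end ReLUApprox

end

noncomputable section

namespace ReLUApprox

/-!
A function in the unit ball is the sum of its Faber–Schauder series, whose coefficients are mixed
second differences and hence of order `2^{-α |k|₁}` on level `k`. The terms of one level have
disjoint supports, so the derivative of that level in the `i`-th variable is of order
`2^{k_i - α |k|₁}`. Discarding the levels outside `β |k|₁ - |k|_∞ ≤ (β - 1) m` therefore costs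
`O(2^{-(α - 1) m})`, while the levels that are kept, with `2^{|k|₁}` terms each, have `O(2^m)` terms
altogether.

A kept term is a product of `d` hat functions. Squares are approximated by sums of iterated tent
maps, products of two numbers by polarization, and products of `d` numbers along a binary tree of
depth `⌈log₂ d⌉`. The approximate product vanishes with each of its factors and is close to the true
product together with its derivatives, so that the zero boundary values survive and the errors of
the levels add up in the Sobolev norm.
-/

/-! ### Piecewise linear approximation of squares and products -/

/-- The tent map on `[0, 1]`, written with the ReLU function. -/
def tent (y : ℝ) : ℝ := 2 * y - 4 * max (y - 1 / 2) 0

/-- The piecewise linear interpolant of `x ↦ x ^ 2` on the dyadic grid of level `s`, obtained by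
summing iterated tent maps. -/
def sqApprox : ℕ → ℝ → ℝ
  | 0, x => x
  | s + 1, x => sqApprox s x - tent^[s + 1] x / 4 ^ (s + 1)

theorem tent_of_le {y : ℝ} (h : y ≤ 1 / 2) : tent y = 2 * y := by
  rw [tent, max_eq_right (by linarith)]; ring

theorem tent_of_ge {y : ℝ} (h : 1 / 2 ≤ y) : tent y = 2 - 2 * y := by
  rw [tent, max_eq_left (by linarith)]; ring


theorem mapsTo_tent : MapsTo tent (Icc 0 1) (Icc 0 1) := by
  rintro y ⟨h0, h1⟩
  rcases le_total y (1 / 2) with h | h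
  · rw [tent_of_le h]; constructor <;> linarith
  · rw [tent_of_ge h]; constructor <;> linarith

theorem tent_iterate_mem {y : ℝ} (h : y ∈ Icc (0 : ℝ) 1) (s : ℕ) : tent^[s] y ∈ Icc (0 : ℝ) 1 :=
  mapsTo_tent.iterate s h

theorem lipschitzWith_tent : LipschitzWith 2 tent := by
  refine LipschitzWith.of_dist_le_mul fun x y => ?_
  rw [Real.dist_eq, Real.dist_eq, NNReal.coe_ofNat]
  rcases le_total x (1 / 2) with hx | hx <;> rcases le_total y (1 / 2) with hy | hy <;>
    simp only [tent_of_le, tent_of_ge, hx, hy] <;> rw [abs_le] <;>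
    constructor <;> cases abs_cases (x - y) <;> linarith

theorem abs_tent_iterate_sub_le (x y : ℝ) (s : ℕ) :
    |tent^[s] x - tent^[s] y| ≤ 2 ^ s * |x - y| := by
  simpa [Real.dist_eq] using (lipschitzWith_tent.iterate s).dist_le_mul x y

theorem sub_sq_eq_tent_div_four (y : ℝ) : y - y ^ 2 = tent y / 4 + (tent y - tent y ^ 2) / 4 := by
  rcases le_total y (1 / 2) with h | h
  · rw [tent_of_le h]; ring
  · rw [tent_of_ge h]; ring

theorem sqApprox_eq (s : ℕ) (x : ℝ) :
    sqApprox s x = x ^ 2 + (tent^[s] x - (tent^[s] x) ^ 2) / 4 ^ s := by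
  induction s with
  | zero => simp [sqApprox]
  | succ s ih =>
    rw [sqApprox, ih, Function.iterate_succ_apply', sub_sq_eq_tent_div_four (tent^[s] x), pow_succ]
    field_simp
    ring

theorem sq_le_sqApprox (s : ℕ) {x : ℝ} (hx : x ∈ Icc (0 : ℝ) 1) : x ^ 2 ≤ sqApprox s x := by
  obtain ⟨h0, h1⟩ := tent_iterate_mem hx s
  rw [sqApprox_eq, le_add_iff_nonneg_right]
  exact div_nonneg (sub_nonneg.2 (pow_le_of_le_one h0 h1 two_ne_zero)) (by positivity)

theorem sqApprox_zero (s : ℕ) : sqApprox s 0 = 0 := by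
  have h : tent^[s] 0 = 0 := Function.iterate_fixed (by norm_num [tent]) s
  simp [sqApprox_eq, h]

theorem sqApprox_one (s : ℕ) : sqApprox s 1 = 1 := by
  have h : tent^[s] 1 - (tent^[s] 1) ^ 2 = 0 := by
    cases s with
    | zero => simp
    | succ s =>
      have h0 : tent^[s] 0 = 0 := Function.iterate_fixed (by norm_num [tent]) s
      have h1 : tent 1 = 0 := by norm_num [tent]
      rw [Function.iterate_succ_apply, h1, h0, sq, mul_zero, sub_zero]
  rw [sqApprox_eq, h, zero_div, add_zero, one_pow]

theorem abs_sqApprox_error_sub_le (s : ℕ) {x y : ℝ} (hx : x ∈ Icc (0 : ℝ) 1)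
    (hy : y ∈ Icc (0 : ℝ) 1) :
    |(sqApprox s x - x ^ 2) - (sqApprox s y - y ^ 2)| ≤ (2 ^ s)⁻¹ * |x - y| := by
  have h := abs_tent_iterate_sub_le x y s
  obtain ⟨a0, a1⟩ := tent_iterate_mem hx s
  obtain ⟨b0, b1⟩ := tent_iterate_mem hy s
  rw [sqApprox_eq, sqApprox_eq, add_sub_cancel_left, add_sub_cancel_left, ← sub_div]
  generalize tent^[s] x = a at *
  generalize tent^[s] y = b at *
  have factor : a - a ^ 2 - (b - b ^ 2) = (a - b) * (1 - a - b) := by ring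
  have h1 : |1 - a - b| ≤ 1 := abs_le.2 ⟨by linarith, by linarith⟩
  have h4 : (4 : ℝ) ^ s = 2 ^ s * 2 ^ s := by rw [← mul_pow]; norm_num
  rw [factor, abs_div, abs_mul, abs_of_pos (by positivity : (0 : ℝ) < 4 ^ s),
    div_le_iff₀ (by positivity)]
  calc |a - b| * |1 - a - b| ≤ |a - b| * 1 := by gcongr
    _ ≤ 2 ^ s * |x - y| := by rwa [mul_one]
    _ = (2 ^ s)⁻¹ * |x - y| * 4 ^ s := by rw [h4]; field_simp

/-- The line through the points of the parabola over `n / 2 ^ s` and `(n + 1) / 2 ^ s`. -/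
def dyadicChord (s : ℕ) (n : ℤ) (x : ℝ) : ℝ :=
  ((2 * n + 1) * (2 ^ s * x) - n * (n + 1)) / 4 ^ s

theorem exists_tent_iterate_eq (s : ℕ) (x : ℝ) :
    ∃ n : ℤ, tent^[s] x = 2 ^ s * x - n ∨ tent^[s] x = n + 1 - 2 ^ s * x := by
  induction s with
  | zero => exact ⟨0, Or.inl (by simp)⟩
  | succ s ih =>
    obtain ⟨n, hn⟩ := ih
    rw [Function.iterate_succ_apply']
    rcases le_total (tent^[s] x) (1 / 2) with h | h
    · rw [tent_of_le h]
      rcases hn with hn | hn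
      · exact ⟨2 * n, Or.inl (by rw [hn]; push_cast; ring)⟩
      · exact ⟨2 * n + 1, Or.inr (by rw [hn]; push_cast; ring)⟩
    · rw [tent_of_ge h]
      rcases hn with hn | hn
      · exact ⟨2 * n + 1, Or.inr (by rw [hn]; push_cast; ring)⟩
      · exact ⟨2 * n, Or.inl (by rw [hn]; push_cast; ring)⟩


theorem exists_sqApprox_eq_dyadicChord (s : ℕ) {x : ℝ} (hx : x ∈ Icc (0 : ℝ) 1) :
    ∃ n : ℤ, sqApprox s x = dyadicChord s n x ∧ (n : ℝ) ≤ 2 ^ s * x ∧ 2 ^ s * x ≤ n + 1 := by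
  obtain ⟨n, hn⟩ := exists_tent_iterate_eq s x
  obtain ⟨h0, h1⟩ := tent_iterate_mem hx s
  have h4 : (4 : ℝ) ^ s = 2 ^ s * 2 ^ s := by rw [← mul_pow]; norm_num
  refine ⟨n, ?_, ?_⟩
  · rw [sqApprox_eq, dyadicChord]
    rcases hn with hn | hn <;> rw [hn, h4] <;> field_simp <;> ring
  · rcases hn with hn | hn <;> rw [hn] at h0 h1 <;> constructor <;> linarith

theorem dyadicChord_le_dyadicChord {s : ℕ} {n : ℤ} {x : ℝ} (h0 : (n : ℝ) ≤ 2 ^ s * x)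
    (h1 : 2 ^ s * x ≤ n + 1) (m : ℤ) : dyadicChord s m x ≤ dyadicChord s n x := by
  rw [dyadicChord, dyadicChord]
  gcongr ?_ / _
  generalize 2 ^ s * x = t at *
  rcases lt_trichotomy m n with h | h | h
  · have h' : (m : ℝ) + 1 ≤ n := by exact_mod_cast h
    nlinarith
  · rw [h]
  · have h' : (n : ℝ) + 1 ≤ m := by exact_mod_cast h
    nlinarith

theorem dyadicChord_le_sqApprox (s : ℕ) (m : ℤ) {x : ℝ} (hx : x ∈ Icc (0 : ℝ) 1) :
    dyadicChord s m x ≤ sqApprox s x := by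
  obtain ⟨n, hn, h0, h1⟩ := exists_sqApprox_eq_dyadicChord s hx
  exact hn ▸ dyadicChord_le_dyadicChord h0 h1 m

theorem convexOn_sqApprox (s : ℕ) : ConvexOn ℝ (Icc 0 1) (sqApprox s) := by
  refine ⟨convex_Icc 0 1, fun x hx y hy μ ν hμ hν hμν => ?_⟩
  obtain ⟨n, hn, -⟩ := exists_sqApprox_eq_dyadicChord s (convex_Icc 0 1 hx hy hμ hν hμν)
  obtain rfl : ν = 1 - μ := by linarith
  calc sqApprox s (μ • x + (1 - μ) • y) = dyadicChord s n (μ * x + (1 - μ) * y) := hn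
    _ = μ * dyadicChord s n x + (1 - μ) * dyadicChord s n y := by simp only [dyadicChord]; ring
    _ ≤ μ * sqApprox s x + (1 - μ) * sqApprox s y := by
      gcongr
      · exact dyadicChord_le_sqApprox s n hx
      · exact dyadicChord_le_sqApprox s n hy

theorem add_le_add_of_convexOn {f : ℝ → ℝ} {S : Set ℝ} (hf : ConvexOn ℝ S f) {a b c d : ℝ}
    (ha : a ∈ S) (hd : d ∈ S) (hab : a ≤ b) (hac : a ≤ c) (h : b + c = a + d) :
    f b + f c ≤ f a + f d := by
  obtain had | had : a = d ∨ a < d := (show a ≤ d by linarith).eq_or_lt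
  · obtain ⟨rfl, rfl⟩ : b = a ∧ c = a := ⟨by linarith, by linarith⟩
    rw [had]
  set t := (b - a) / (d - a) with ht
  have hda : d - a ≠ 0 := (sub_pos.2 had).ne'
  have t0 : 0 ≤ t := div_nonneg (sub_nonneg.2 hab) (sub_pos.2 had).le
  have t1 : 0 ≤ 1 - t := sub_nonneg.2 ((div_le_one (sub_pos.2 had)).2 (by linarith))
  have hb : (1 - t) * a + t * d = b := by rw [ht]; field_simp; ring
  have hc : t * a + (1 - t) * d = c := by linarith
  have fb := hf.2 ha hd t1 t0 (sub_add_cancel 1 t)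
  have fc := hf.2 ha hd t0 t1 (add_sub_cancel t 1)
  simp only [smul_eq_mul, hb, hc] at fb fc
  linarith

/-- The approximate product of `x, y ∈ [0, 1]`, by polarization of `sqApprox`. -/
def mulApprox (R : ℕ) (x y : ℝ) : ℝ :=
  2 * (sqApprox R ((x + y) / 2) - sqApprox R (x / 2) - sqApprox R (y / 2))

theorem mulApprox_zero_left (R : ℕ) (y : ℝ) : mulApprox R 0 y = 0 := by
  simp [mulApprox, sqApprox_zero]

theorem mulApprox_zero_right (R : ℕ) (x : ℝ) : mulApprox R x 0 = 0 := by
  simp [mulApprox, sqApprox_zero]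


theorem mulApprox_comm (R : ℕ) (x y : ℝ) : mulApprox R x y = mulApprox R y x := by
  simp only [mulApprox, add_comm x y]; ring

theorem mulApprox_mem (R : ℕ) {x y : ℝ} (hx : x ∈ Icc (0 : ℝ) 1) (hy : y ∈ Icc (0 : ℝ) 1) :
    mulApprox R x y ∈ Icc (0 : ℝ) 1 := by
  obtain ⟨x0, x1⟩ := hx
  obtain ⟨y0, y1⟩ := hy
  have hconv := convexOn_sqApprox R
  have h1 := add_le_add_of_convexOn hconv (a := 0) (b := x / 2) (c := y / 2) (d := (x + y) / 2)
    ⟨le_rfl, zero_le_one⟩ ⟨by linarith, by linarith⟩ (by linarith) (by linarith) (by ring)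
  have h2 := add_le_add_of_convexOn hconv (a := x / 2) (b := (x + y) / 2) (c := 1 / 2)
    (d := 1 / 2 + y / 2) ⟨by linarith, by linarith⟩ ⟨by linarith, by linarith⟩
    (by linarith) (by linarith) (by ring)
  have h3 := add_le_add_of_convexOn hconv (a := y / 2) (b := 1 / 2 + y / 2) (c := 1 / 2) (d := 1)
    ⟨by linarith, by linarith⟩ ⟨zero_le_one, le_rfl⟩ (by linarith) (by linarith) (by ring)
  have h4 := sq_le_sqApprox R (x := 1 / 2) ⟨by norm_num, by norm_num⟩
  rw [sqApprox_zero] at h1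
  rw [sqApprox_one] at h3
  rw [mulApprox]
  constructor <;> linarith

theorem abs_mulApprox_error_sub_le (R : ℕ) {x x' y : ℝ} (hx : x ∈ Icc (0 : ℝ) 1)
    (hx' : x' ∈ Icc (0 : ℝ) 1) (hy : y ∈ Icc (0 : ℝ) 1) :
    |(mulApprox R x' y - x' * y) - (mulApprox R x y - x * y)| ≤ 2 * (2 ^ R)⁻¹ * |x' - x| := by
  obtain ⟨x0, x1⟩ := hx
  obtain ⟨x0', x1'⟩ := hx'
  obtain ⟨y0, y1⟩ := hy
  have halves : |x' / 2 - x / 2| = |x' - x| / 2 := by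
    rw [← sub_div, abs_div, abs_two]
  have h1 := abs_sqApprox_error_sub_le R (x := (x' + y) / 2) (y := (x + y) / 2)
    ⟨by linarith, by linarith⟩ ⟨by linarith, by linarith⟩
  have h2 := abs_sqApprox_error_sub_le R (x := x' / 2) (y := x / 2)
    ⟨by linarith, by linarith⟩ ⟨by linarith, by linarith⟩
  rw [show (x' + y) / 2 - (x + y) / 2 = x' / 2 - x / 2 by ring, halves] at h1
  rw [halves] at h2
  have polar : (mulApprox R x' y - x' * y) - (mulApprox R x y - x * y) =
      2 * ((sqApprox R ((x' + y) / 2) - ((x' + y) / 2) ^ 2) -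
        (sqApprox R ((x + y) / 2) - ((x + y) / 2) ^ 2)) -
      2 * ((sqApprox R (x' / 2) - (x' / 2) ^ 2) - (sqApprox R (x / 2) - (x / 2) ^ 2)) := by
    simp only [mulApprox]; ring
  rw [polar]
  refine (abs_sub _ _).trans ?_
  rw [abs_mul, abs_mul, abs_two]
  linarith

theorem abs_mulApprox_sub_mul_le (R : ℕ) {x y : ℝ} (hx : x ∈ Icc (0 : ℝ) 1)
    (hy : y ∈ Icc (0 : ℝ) 1) : |mulApprox R x y - x * y| ≤ 2 * (2 ^ R)⁻¹ := by
  have h := abs_mulApprox_error_sub_le R ⟨le_rfl, zero_le_one⟩ hx hy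
  rw [mulApprox_zero_left, zero_mul, sub_self, sub_zero, sub_zero, abs_of_nonneg hx.1] at h
  exact h.trans (mul_le_of_le_one_right (by positivity) hx.2)

theorem abs_mulApprox_comp_error_sub_le {R : ℕ} {u u' U U' w W e τ : ℝ}
    (hu : u ∈ Icc (0 : ℝ) 1) (hu' : u' ∈ Icc (0 : ℝ) 1) (hw : w ∈ Icc (0 : ℝ) 1)
    (hδ : 2 * ((2 : ℝ) ^ R)⁻¹ ≤ 1) (he : 2 * ((2 : ℝ) ^ R)⁻¹ ≤ e)
    (hsub : |(u' - U') - (u - U)| ≤ e * τ) (hU : |U' - U| ≤ τ) (hW : |w - W| ≤ e) :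
    |(mulApprox R u' w - U' * W) - (mulApprox R u w - U * W)| ≤ 4 * e * τ := by
  have split : (mulApprox R u' w - U' * W) - (mulApprox R u w - U * W) =
      ((mulApprox R u' w - u' * w) - (mulApprox R u w - u * w)) +
        ((u' - U') - (u - U)) * w + (U' - U) * (w - W) := by ring
  have hτ : 0 ≤ τ := (abs_nonneg _).trans hU
  have hε : 0 ≤ e * τ := (abs_nonneg _).trans hsub
  have : 0 ≤ 2 * ((2 : ℝ) ^ R)⁻¹ := by positivity
  have hdiff : |u' - u| ≤ e * τ + τ := by
    rw [show u' - u = ((u' - U') - (u - U)) + (U' - U) by ring]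
    exact (abs_add_le _ _).trans (add_le_add hsub hU)
  have h1 : |(mulApprox R u' w - u' * w) - (mulApprox R u w - u * w)| ≤ e * τ + e * τ :=
    calc _ ≤ 2 * (2 ^ R)⁻¹ * |u' - u| := abs_mulApprox_error_sub_le R hu hu' hw
      _ ≤ 2 * (2 ^ R)⁻¹ * (e * τ + τ) := by gcongr
      _ = 2 * (2 ^ R)⁻¹ * (e * τ) + 2 * (2 ^ R)⁻¹ * τ := mul_add _ _ _
      _ ≤ 1 * (e * τ) + e * τ := by gcongr
      _ = e * τ + e * τ := by rw [one_mul]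
  have h2 : |((u' - U') - (u - U)) * w| ≤ e * τ := by
    rw [abs_mul, abs_of_nonneg hw.1]
    exact (mul_le_of_le_one_right (abs_nonneg _) hw.2).trans hsub
  have h3 : |(U' - U) * (w - W)| ≤ τ * e := by
    rw [abs_mul]; gcongr
  rw [split]
  linarith [abs_add_three ((mulApprox R u' w - u' * w) - (mulApprox R u w - u * w))
    (((u' - U') - (u - U)) * w) ((U' - U) * (w - W))]

/-! ### Products of many factors -/

/-- The binary tree of approximate products of the factors `v b` with `b ∈ [a 2^j, (a+1) 2^j)`. -/
def treeApprox (R : ℕ) (v : ℕ → ℝ) : ℕ → ℕ → ℝ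
  | 0, a => v a
  | j + 1, a => mulApprox R (treeApprox R v j (2 * a)) (treeApprox R v j (2 * a + 1))

/-- The exact product of the factors `v b` with `b ∈ [a 2^j, (a+1) 2^j)`. -/
def blockProd (v : ℕ → ℝ) (j a : ℕ) : ℝ := ∏ b ∈ Finset.Ico (a * 2 ^ j) ((a + 1) * 2 ^ j), v b

theorem blockProd_succ (v : ℕ → ℝ) (j a : ℕ) :
    blockProd v (j + 1) a = blockProd v j (2 * a) * blockProd v j (2 * a + 1) := by
  have e1 : a * 2 ^ (j + 1) = 2 * a * 2 ^ j := by ring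
  have e2 : (a + 1) * 2 ^ (j + 1) = (2 * a + 1 + 1) * 2 ^ j := by ring
  rw [blockProd, blockProd, blockProd, e1, e2, Finset.prod_Ico_consecutive]
  · gcongr; omega
  · gcongr; omega

theorem treeApprox_mem (R : ℕ) {v : ℕ → ℝ} (hv : ∀ b, v b ∈ Icc (0 : ℝ) 1) (j a : ℕ) :
    treeApprox R v j a ∈ Icc (0 : ℝ) 1 := by
  induction j generalizing a with
  | zero => exact hv a
  | succ j ih => exact mulApprox_mem R (ih _) (ih _)

theorem treeApprox_congr (R : ℕ) {v w : ℕ → ℝ} (j a : ℕ)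
    (h : ∀ b, a * 2 ^ j ≤ b → b < (a + 1) * 2 ^ j → v b = w b) :
    treeApprox R v j a = treeApprox R w j a := by
  induction j generalizing a with
  | zero => exact h a (by simp) (by simp)
  | succ j ih =>
    have e1 : a * 2 ^ (j + 1) = 2 * a * 2 ^ j := by ring
    have e2 : (a + 1) * 2 ^ (j + 1) = (2 * a + 1 + 1) * 2 ^ j := by ring
    have e3 : (2 * a + 1) * 2 ^ j = 2 * a * 2 ^ j + 2 ^ j := by ring
    have e4 : (2 * a + 1 + 1) * 2 ^ j = 2 * a * 2 ^ j + 2 ^ j + 2 ^ j := by ring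
    rw [treeApprox, treeApprox, ih (2 * a) fun b h1 h2 => h b (by omega) (by omega),
      ih (2 * a + 1) fun b h1 h2 => h b (by omega) (by omega)]

theorem treeApprox_eq_zero (R : ℕ) {v : ℕ → ℝ} (j a : ℕ) {b : ℕ} (h1 : a * 2 ^ j ≤ b)
    (h2 : b < (a + 1) * 2 ^ j) (hb : v b = 0) : treeApprox R v j a = 0 := by
  induction j generalizing a with
  | zero =>
    have : b = a := by simp at h1 h2; omega
    rw [treeApprox, ← this, hb]
  | succ j ih =>
    have e1 : a * 2 ^ (j + 1) = 2 * a * 2 ^ j := by ring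
    have e2 : (a + 1) * 2 ^ (j + 1) = (2 * a + 1 + 1) * 2 ^ j := by ring
    rw [treeApprox]
    rcases lt_or_ge b ((2 * a + 1) * 2 ^ j) with h | h
    · rw [ih (2 * a) (by omega) h, mulApprox_zero_left]
    · rw [ih (2 * a + 1) h (by omega), mulApprox_zero_right]

theorem abs_blockProd_update_sub_le {v : ℕ → ℝ} (hv : ∀ b, v b ∈ Icc (0 : ℝ) 1) (b : ℕ) (t : ℝ)
    (j a : ℕ) : |blockProd (Function.update v b t) j a - blockProd v j a| ≤ |t - v b| := by
  by_cases hb : b ∈ Finset.Ico (a * 2 ^ j) ((a + 1) * 2 ^ j)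
  · rw [blockProd, blockProd, Finset.prod_update_of_mem hb,
      ← Finset.mul_prod_erase _ v hb, Finset.sdiff_singleton_eq_erase, ← sub_mul, abs_mul]
    apply mul_le_of_le_one_right (abs_nonneg _)
    rw [abs_of_nonneg (Finset.prod_nonneg fun b _ => (hv b).1)]
    exact Finset.prod_le_one (fun b _ => (hv b).1) fun b _ => (hv b).2
  · rw [blockProd, blockProd, Finset.prod_update_of_notMem hb]
    simp

theorem blockProd_mem {v : ℕ → ℝ} (hv : ∀ b, v b ∈ Icc (0 : ℝ) 1) (j a : ℕ) :
    blockProd v j a ∈ Icc (0 : ℝ) 1 :=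
  ⟨Finset.prod_nonneg fun b _ => (hv b).1, Finset.prod_le_one (fun b _ => (hv b).1)
    fun b _ => (hv b).2⟩

theorem abs_treeApprox_sub_blockProd_le (R : ℕ) {v : ℕ → ℝ} (hv : ∀ b, v b ∈ Icc (0 : ℝ) 1)
    (j a : ℕ) : |treeApprox R v j a - blockProd v j a| ≤ 4 ^ j * (2 * (2 ^ R)⁻¹) := by
  induction j generalizing a with
  | zero => simp [treeApprox, blockProd]
  | succ j ih =>
    rw [treeApprox, blockProd_succ]
    have hu := treeApprox_mem R hv j (2 * a)
    have hw := treeApprox_mem R hv j (2 * a + 1)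
    have hU := blockProd_mem hv j (2 * a)
    have hδ := abs_mulApprox_sub_mul_le R hu hw
    have hδe : 2 * ((2 : ℝ) ^ R)⁻¹ ≤ 4 ^ j * (2 * (2 ^ R)⁻¹) :=
      le_mul_of_one_le_left (by positivity) (one_le_pow₀ (by norm_num))
    have ihu := ih (2 * a)
    have ihw := ih (2 * a + 1)
    rw [pow_succ]
    generalize treeApprox R v j (2 * a) = u at *
    generalize treeApprox R v j (2 * a + 1) = w at *
    generalize blockProd v j (2 * a) = U at *
    generalize blockProd v j (2 * a + 1) = W at *
    have h1 : |(u - U) * w| ≤ 4 ^ j * (2 * (2 ^ R)⁻¹) := by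
      rw [abs_mul, abs_of_nonneg hw.1]
      exact (mul_le_of_le_one_right (abs_nonneg _) hw.2).trans ihu
    have h2 : |U * (w - W)| ≤ 4 ^ j * (2 * (2 ^ R)⁻¹) := by
      rw [abs_mul, abs_of_nonneg hU.1]
      exact (mul_le_of_le_one_left (abs_nonneg _) hU.2).trans ihw
    rw [show mulApprox R u w - U * W =
      (mulApprox R u w - u * w) + (u - U) * w + U * (w - W) by ring]
    linarith [abs_add_three (mulApprox R u w - u * w) ((u - U) * w) (U * (w - W)),
      abs_nonneg (u - U)]

theorem update_treeApprox_eq (R : ℕ) (v : ℕ → ℝ) {b j a : ℕ} (t : ℝ)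
    (h : b < a * 2 ^ j ∨ (a + 1) * 2 ^ j ≤ b) :
    treeApprox R (Function.update v b t) j a = treeApprox R v j a :=
  treeApprox_congr R j a fun b' h1 h2 => Function.update_of_ne (by omega) _ _

theorem update_blockProd_eq (v : ℕ → ℝ) {b j a : ℕ} (t : ℝ)
    (h : b < a * 2 ^ j ∨ (a + 1) * 2 ^ j ≤ b) :
    blockProd (Function.update v b t) j a = blockProd v j a :=
  Finset.prod_update_of_notMem (by rw [Finset.mem_Ico]; omega) _ _

/-- Separately in each factor, the error is not only small but has a small Lipschitz constant; this
is what controls it in `W̊¹_p`. -/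
theorem abs_treeApprox_error_sub_le {R : ℕ} (hR : 1 ≤ R) {v : ℕ → ℝ} (b : ℕ) {t : ℝ}
    (hv : ∀ b, v b ∈ Icc (0 : ℝ) 1) (ht : t ∈ Icc (0 : ℝ) 1) (j a : ℕ) :
    |(treeApprox R (Function.update v b t) j a - blockProd (Function.update v b t) j a) -
      (treeApprox R v j a - blockProd v j a)| ≤ 4 ^ j * (2 * (2 ^ R)⁻¹) * |t - v b| := by
  have hδ : 2 * ((2 : ℝ) ^ R)⁻¹ ≤ 1 := by
    rw [← div_eq_mul_inv, div_le_one (by positivity)]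
    exact le_self_pow₀ one_le_two (by omega)
  have hv' : ∀ c, Function.update v b t c ∈ Icc (0 : ℝ) 1 := fun c => by
    rcases eq_or_ne c b with rfl | h
    · rwa [Function.update_self]
    · rw [Function.update_of_ne h]; exact hv c
  induction j generalizing a with
  | zero => simp [treeApprox, blockProd]
  | succ j ih =>
    have hδe : 2 * ((2 : ℝ) ^ R)⁻¹ ≤ 4 ^ j * (2 * (2 ^ R)⁻¹) :=
      le_mul_of_one_le_left (by positivity) (one_le_pow₀ (by norm_num))
    rw [pow_succ', mul_assoc 4, blockProd_succ, blockProd_succ, treeApprox, treeApprox]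
    rcases lt_or_ge b ((2 * a + 1) * 2 ^ j) with hb | hb
    · rw [update_treeApprox_eq R v t (Or.inl hb), update_blockProd_eq v t (Or.inl hb)]
      exact abs_mulApprox_comp_error_sub_le (treeApprox_mem R hv _ _) (treeApprox_mem R hv' _ _)
        (treeApprox_mem R hv _ _) hδ hδe (ih (2 * a)) (abs_blockProd_update_sub_le hv b t _ _)
        (abs_treeApprox_sub_blockProd_le R hv _ _)
    · rw [update_treeApprox_eq R v t (Or.inr hb), update_blockProd_eq v t (Or.inr hb)]
      simp only [mulApprox_comm R (treeApprox R v j (2 * a)), mul_comm (blockProd v j (2 * a))]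
      exact abs_mulApprox_comp_error_sub_le (treeApprox_mem R hv _ _) (treeApprox_mem R hv' _ _)
        (treeApprox_mem R hv _ _) hδ hδe (ih (2 * a + 1)) (abs_blockProd_update_sub_le hv b t _ _)
        (abs_treeApprox_sub_blockProd_le R hv _ _)

/-! ### Networks with a common index type for all hidden layers -/

/-- The number of nonzero values of `v`. -/
def numNonzero {ι : Type*} [Fintype ι] (v : ι → ℝ) : ℕ := (Finset.univ.filter fun i => v i ≠ 0).card

theorem numNonzero_le_of_injective {ι κ : Type*} [Fintype ι] [Fintype κ] {v : ι → ℝ} {w : κ → ℝ}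
    {φ : ι → κ} (hφ : Function.Injective φ) (h : ∀ i, v i = w (φ i)) :
    numNonzero v ≤ numNonzero w :=
  Finset.card_le_card_of_injOn φ (fun i hi => by simpa [h] using hi) hφ.injOn

theorem numNonzero_eq_zero {ι : Type*} [Fintype ι] {v : ι → ℝ} (h : ∀ i, v i = 0) :
    numNonzero v = 0 := by
  simp [numNonzero, h]

theorem numNonzero_le_card {ι : Type*} [Fintype ι] (v : ι → ℝ) : numNonzero v ≤ Fintype.card ι :=
  Finset.card_le_univ _

theorem NeuralNet.size_eq {d : ℕ} {S : NetShape d} (Φ : NeuralNet S) :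
    Φ.size = (∑ ℓ : Fin S.depth, numNonzero fun q : Fin (S.width (ℓ + 1)) × Fin (S.width ℓ) =>
      Φ.weight ℓ q.1 q.2) + ∑ ℓ, numNonzero (Φ.bias ℓ) := rfl

theorem NeuralNet.layer_succ {d : ℕ} {S : NetShape d} (Φ : NeuralNet S) (x : Fin d → ℝ) {ℓ : ℕ}
    (h : ℓ + 1 ≤ S.depth) (i : Fin (S.width (ℓ + 1))) :
    Φ.layer x (ℓ + 1) h i =
      if ℓ + 1 = S.depth then
        ∑ j, Φ.weight ⟨ℓ, h⟩ i j * Φ.layer x ℓ (Nat.le_of_succ_le h) j + Φ.bias ⟨ℓ, h⟩ i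
      else max (∑ j, Φ.weight ⟨ℓ, h⟩ i j * Φ.layer x ℓ (Nat.le_of_succ_le h) j +
        Φ.bias ⟨ℓ, h⟩ i) 0 := rfl

/-- The affine maps of a network all of whose hidden layers are indexed by `H`, without the
output layer. -/
structure HiddenNet (d : ℕ) (H : Type*) where
  inWeight : H → Fin d → ℝ
  inBias : H → ℝ
  weight : ℕ → H → H → ℝ
  bias : ℕ → H → ℝ

namespace HiddenNet

variable {d : ℕ} {H : Type*} [Fintype H]

/-- The values of the neurons in the hidden layer `t`. -/
def state (N : HiddenNet d H) (x : Fin d → ℝ) : ℕ → H → ℝ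
  | 0, h => max (∑ i, N.inWeight h i * x i + N.inBias h) 0
  | t + 1, h => max (∑ h', N.weight t h h' * N.state x t h' + N.bias t h) 0

/-- The number of nonzero weights of the hidden layers `0, …, T`, plus the number of all possible
weights of the output layer. -/
def cost (N : HiddenNet d H) (T : ℕ) : ℕ :=
  (numNonzero (fun q : H × Fin d => N.inWeight q.1 q.2) + numNonzero N.inBias) +
    (∑ t ∈ Finset.range T,
      (numNonzero (fun q : H × H => N.weight t q.1 q.2) + numNonzero (N.bias t))) + Fintype.card H

variable [Nonempty H]

variable (d H) in
/-- The shape with `T + 1` hidden layers indexed by `H`. -/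
abbrev shape (T : ℕ) : NetShape d where
  depth := T + 2
  two_le_depth := Nat.le_add_left 2 T
  width ℓ := if ℓ = 0 then d else if ℓ < T + 2 then Fintype.card H else 1
  width_zero := if_pos rfl
  width_depth := by simp
  width_pos ℓ h0 h1 := by rw [if_neg h0.ne', if_pos h1]; exact Fintype.card_pos

/-- The enumeration of the neurons in a hidden layer. -/
def neuron {T ℓ : ℕ} (h0 : ℓ ≠ 0) (h1 : ℓ < T + 2) : Fin ((shape d H T).width ℓ) ≃ H :=
  (finCongr ((if_neg h0).trans (if_pos h1))).trans (Fintype.equivFin H).symm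

/-- The network with `T + 1` hidden layers and a given output layer. -/
def toNet (N : HiddenNet d H) (T : ℕ) (out : H → ℝ) : NeuralNet (shape d H T) where
  weight ℓ i j :=
    if h0 : (ℓ : ℕ) = 0 then
      N.inWeight (neuron (Nat.succ_ne_zero ℓ) (by omega) i) (finCongr (by rw [h0]; rfl) j)
    else if hT : (ℓ : ℕ) < T + 1 then
      N.weight (ℓ - 1) (neuron (Nat.succ_ne_zero ℓ) (by omega) i) (neuron h0 (by omega) j)
    else out (neuron h0 ℓ.2 j)
  bias ℓ i :=
    if h0 : (ℓ : ℕ) = 0 then N.inBias (neuron (Nat.succ_ne_zero ℓ) (by omega) i)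
    else if hT : (ℓ : ℕ) < T + 1 then
      N.bias (ℓ - 1) (neuron (Nat.succ_ne_zero ℓ) (by omega) i)
    else 0

section toNet

variable (N : HiddenNet d H) {T : ℕ} (out : H → ℝ)

theorem weight_toNet_succ {t : ℕ} (ht : t < T) (i : Fin ((shape d H T).width (t + 1 + 1)))
    (j : Fin ((shape d H T).width (t + 1))) :
    (N.toNet T out).weight ⟨t + 1, Nat.lt_succ_of_lt (Nat.succ_lt_succ ht)⟩ i j =
      N.weight t (neuron (Nat.succ_ne_zero _) (by omega) i)
        (neuron (Nat.succ_ne_zero _) (by omega) j) := by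
  simp [toNet, ht]

theorem bias_toNet_succ {t : ℕ} (ht : t < T) (i : Fin ((shape d H T).width (t + 1 + 1))) :
    (N.toNet T out).bias ⟨t + 1, Nat.lt_succ_of_lt (Nat.succ_lt_succ ht)⟩ i =
      N.bias t (neuron (Nat.succ_ne_zero _) (by omega) i) := by
  simp [toNet, ht]

theorem weight_toNet_last (i : Fin ((shape d H T).width (T + 1 + 1)))
    (j : Fin ((shape d H T).width (T + 1))) :
    (N.toNet T out).weight ⟨T + 1, Nat.lt_succ_self _⟩ i j =
      out (neuron (Nat.succ_ne_zero _) (Nat.lt_succ_self _) j) := by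
  simp [toNet]

theorem bias_toNet_last (i : Fin ((shape d H T).width (T + 1 + 1))) :
    (N.toNet T out).bias ⟨T + 1, Nat.lt_succ_self _⟩ i = 0 := by
  simp [toNet]

theorem layer_toNet (x : Fin d → ℝ) {t : ℕ} (ht : t ≤ T) (i : Fin ((shape d H T).width (t + 1))) :
    (N.toNet T out).layer x (t + 1) (Nat.succ_le_succ (Nat.le_succ_of_le ht)) i =
      N.state x t (neuron (Nat.succ_ne_zero _) (by omega) i) := by
  induction t with
  | zero =>
    rw [NeuralNet.layer_succ, if_neg (show 0 + 1 ≠ T + 2 by omega), state,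
      ← (finCongr (shape d H T).width_zero).sum_comp]
    rfl
  | succ t ih =>
    rw [NeuralNet.layer_succ, if_neg (show t + 1 + 1 ≠ T + 2 by omega), state,
      ← (neuron (d := d) (H := H) (T := T) (Nat.succ_ne_zero t) (by omega)).sum_comp]
    simp only [ih (Nat.le_of_succ_le ht), weight_toNet_succ N out (Nat.lt_of_succ_le ht),
      bias_toNet_succ N out (Nat.lt_of_succ_le ht)]

theorem output_toNet (x : Fin d → ℝ) :
    (N.toNet T out).output x = ∑ h, out h * N.state x T h := by
  refine ((NeuralNet.layer_succ _ x (ℓ := T + 1) le_rfl _).trans (if_pos rfl)).trans ?_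
  simp only [weight_toNet_last, bias_toNet_last, add_zero, layer_toNet N out x le_rfl]
  exact (neuron (Nat.succ_ne_zero T) (Nat.lt_succ_self _)).sum_comp fun h => out h * N.state x T h

theorem sum_numNonzero_weight_toNet_le :
    (∑ ℓ : Fin (shape d H T).depth, numNonzero
        fun q : Fin ((shape d H T).width (ℓ + 1)) × Fin ((shape d H T).width ℓ) =>
          (N.toNet T out).weight ℓ q.1 q.2) ≤
      numNonzero (fun q : H × Fin d => N.inWeight q.1 q.2) +
        (∑ t ∈ Finset.range T, numNonzero fun q : H × H => N.weight t q.1 q.2) +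
        Fintype.card H := by
  change ∑ ℓ : Fin (T + 2), _ ≤ _
  rw [Fin.sum_univ_succ, Fin.sum_univ_castSucc, ← add_assoc, Finset.sum_range]
  refine add_le_add (add_le_add ?_ (Finset.sum_le_sum fun t _ => ?_)) ?_
  · exact numNonzero_le_of_injective ((neuron (Nat.succ_ne_zero 0) (by omega)).prodCongr
      (finCongr (shape d H T).width_zero)).injective fun _ => rfl
  · exact numNonzero_le_of_injective
      ((neuron (Nat.succ_ne_zero _) (Nat.add_lt_add_right t.2 2)).prodCongr
        (neuron (Nat.succ_ne_zero _) (Nat.lt_add_right 1 (Nat.succ_lt_succ t.2)))).injective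
      fun q =>
        weight_toNet_succ N out t.2 q.1 q.2
  · have hcard : Fintype.card (Fin ((shape d H T).width (T + 2)) ×
        Fin ((shape d H T).width (T + 1))) = Fintype.card H := by
      rw [Fintype.card_prod, (shape d H T).width_depth, Fintype.card_fin, one_mul,
        Fintype.card_congr (neuron (Nat.succ_ne_zero T) (Nat.lt_succ_self _))]
    exact (numNonzero_le_card _).trans hcard.le

theorem sum_numNonzero_bias_toNet_le :
    ∑ ℓ, numNonzero ((N.toNet T out).bias ℓ) ≤
      numNonzero N.inBias + ∑ t ∈ Finset.range T, numNonzero (N.bias t) := by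
  change ∑ ℓ : Fin (T + 2), _ ≤ _
  rw [Fin.sum_univ_succ, Fin.sum_univ_castSucc, ← add_assoc, Finset.sum_range]
  have hlast : numNonzero ((N.toNet T out).bias (Fin.last T).succ) = 0 :=
    numNonzero_eq_zero (bias_toNet_last N out)
  rw [hlast, add_zero]
  refine add_le_add ?_ (Finset.sum_le_sum fun t _ => ?_)
  · exact numNonzero_le_of_injective
      (neuron (Nat.succ_ne_zero 0) (by omega)).injective fun _ => rfl
  · exact numNonzero_le_of_injective
      (neuron (Nat.succ_ne_zero _) (Nat.add_lt_add_right t.2 2)).injective fun i =>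
        bias_toNet_succ N out t.2 i

theorem size_toNet_le : (N.toNet T out).size ≤ N.cost T := by
  have hw := sum_numNonzero_weight_toNet_le N (T := T) out
  have hb := sum_numNonzero_bias_toNet_le N (T := T) out
  rw [NeuralNet.size_eq, cost, Finset.sum_add_distrib]
  omega

end toNet

end HiddenNet

namespace NeuralNet

variable {d : ℕ} {S : NetShape d}

/-- The architecture of a network: all nonzero weights are replaced by `1`. -/
def pattern (Φ : NeuralNet S) : NeuralNet S where
  weight ℓ i j := if Φ.weight ℓ i j = 0 then 0 else 1
  bias ℓ i := if Φ.bias ℓ i = 0 then 0 else 1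

theorem isArchitecture_pattern (Φ : NeuralNet S) : Φ.pattern.IsArchitecture :=
  ⟨fun _ _ _ => ite_eq_or_eq _ _ _, fun _ _ => ite_eq_or_eq _ _ _⟩

theorem size_pattern (Φ : NeuralNet S) : Φ.pattern.size = Φ.size := by
  simp [size, pattern]

end NeuralNet

theorem HiddenNet.exists_architecture {d : ℕ} {H : Type*} [Fintype H] [Nonempty H]
    (N : HiddenNet d H) (T : ℕ) :
    ∃ (S : NetShape d) (A : NeuralNet S), A.IsArchitecture ∧ A.depth = T + 2 ∧ A.size ≤ N.cost T ∧
      ∀ out : H → ℝ, ∃ Φ : NeuralNet S, Φ.HasArchitecture A ∧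
        ∀ x, Φ.output x = ∑ h, out h * N.state x T h := by
  refine ⟨shape d H T, (N.toNet T fun _ => 1).pattern, NeuralNet.isArchitecture_pattern _, rfl,
    (NeuralNet.size_pattern _).trans_le (size_toNet_le N _),
    fun out => ⟨N.toNet T out, ⟨fun ℓ i j h => ?_, fun ℓ i h => ?_⟩, output_toNet N out⟩⟩
  · simp only [NeuralNet.pattern, toNet, ite_eq_left_iff, one_ne_zero, imp_false, not_not] at h ⊢
    split_ifs at h ⊢ <;> first | exact h | exact absurd h one_ne_zero
  · simpa [NeuralNet.pattern, toNet] using h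

theorem exists_architecture_size_eq_zero (d T : ℕ) :
    ∃ (S : NetShape d) (A : NeuralNet S), A.IsArchitecture ∧ A.depth = T + 2 ∧ A.size = 0 ∧
      A.HasArchitecture A ∧ ∀ x, A.output x = 0 := by
  let N : HiddenNet d Unit := ⟨0, 0, 0, 0⟩
  have hweight : ∀ ℓ i j, (N.toNet T 0).weight ℓ i j = 0 := fun ℓ i j => by
    simp [N, HiddenNet.toNet]
  have hbias : ∀ ℓ i, (N.toNet T 0).bias ℓ i = 0 := fun ℓ i => by simp [N, HiddenNet.toNet]
  refine ⟨HiddenNet.shape d Unit T, N.toNet T 0,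
    ⟨fun ℓ i j => Or.inl (hweight ℓ i j), fun ℓ i => Or.inl (hbias ℓ i)⟩, rfl, ?_,
    ⟨fun _ _ _ h => h, fun _ _ h => h⟩, fun x => ?_⟩
  · rw [NeuralNet.size_eq, Finset.sum_eq_zero fun ℓ _ => numNonzero_eq_zero fun q =>
      hweight ℓ q.1 q.2, Finset.sum_eq_zero fun ℓ _ => numNonzero_eq_zero (hbias ℓ), add_zero]
  · simp [HiddenNet.output_toNet]

/-! ### The network of approximate tensor products of hat functions -/

/-- The hat function with support `[0, 2]` and peak `1` at `1`. -/
def hat (t : ℝ) : ℝ := max t 0 - 2 * max (t - 1) 0 + max (t - 2) 0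

/-- The values of the `d` univariate hats of level `k` and position `s`, padded by ones. -/
def hatVec {d : ℕ} (k s : Fin d → ℕ) (x : Fin d → ℝ) (b : ℕ) : ℝ :=
  if h : b < d then hat (2 ^ (k ⟨b, h⟩ + 1) * x ⟨b, h⟩ - 2 * s ⟨b, h⟩) else 1

theorem hat_of_le_zero {t : ℝ} (h : t ≤ 0) : hat t = 0 := by
  rw [hat, max_eq_right h, max_eq_right (by linarith), max_eq_right (by linarith)]; ring

theorem hat_of_ge_two {t : ℝ} (h : 2 ≤ t) : hat t = 0 := by
  rw [hat, max_eq_left (by linarith), max_eq_left (by linarith), max_eq_left (by linarith)]; ring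

theorem hat_of_mem_left {t : ℝ} (h0 : 0 ≤ t) (h1 : t ≤ 1) : hat t = t := by
  rw [hat, max_eq_left h0, max_eq_right (by linarith), max_eq_right (by linarith)]; ring

theorem hat_of_mem_right {t : ℝ} (h0 : 1 ≤ t) (h1 : t ≤ 2) : hat t = 2 - t := by
  rw [hat, max_eq_left (by linarith), max_eq_left (by linarith), max_eq_right (by linarith)]; ring

theorem hat_mem (t : ℝ) : hat t ∈ Icc (0 : ℝ) 1 := by
  rcases le_total t 0 with h | h
  · rw [hat_of_le_zero h]; exact ⟨le_rfl, zero_le_one⟩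
  rcases le_total t 1 with h1 | h1
  · rw [hat_of_mem_left h h1]; exact ⟨h, h1⟩
  rcases le_total t 2 with h2 | h2
  · rw [hat_of_mem_right h1 h2]; constructor <;> linarith
  · rw [hat_of_ge_two h2]; exact ⟨le_rfl, zero_le_one⟩

theorem hatVec_mem {d : ℕ} (k s : Fin d → ℕ) (x : Fin d → ℝ) (b : ℕ) :
    hatVec k s x b ∈ Icc (0 : ℝ) 1 := by
  rw [hatVec]
  split_ifs
  · exact hat_mem _
  · exact ⟨zero_le_one, le_rfl⟩

/-- The neurons of the binary tree of one product. The neuron `(a, q, r)` belongs to the node `a` of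
the current level of the tree; `q` selects one of the three squares in the approximate product of
its children, and `r` one of three neurons that compute this square: the iterated tent map (`0` and
`1`) and an accumulator (`2`). -/
abbrev Gate (J : ℕ) : Type := Fin (2 ^ J) × Fin 3 × Fin 3

/-- The linear functional that recovers the value of a node from its accumulators. The layer
`t = 0` holds a hat function as a combination of three ReLUs, the later ones hold an approximate
product as a combination of three squares. -/
def readout (t : ℕ) (c : Fin 3 × Fin 3) : ℝ :=
  if c.2 = 2 then (if t = 0 then ![1, -2, 1] c.1 else ![2, -2, -2] c.1) else 0

theorem sum_readout_zero (v : Fin 3 × Fin 3 → ℝ) :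
    ∑ c, readout 0 c * v c = v (0, 2) - 2 * v (1, 2) + v (2, 2) := by
  simp [readout, Fintype.sum_prod_type, Fin.sum_univ_three]
  ring

theorem sum_readout_of_ne_zero {t : ℕ} (ht : t ≠ 0) (v : Fin 3 × Fin 3 → ℝ) :
    ∑ c, readout t c * v c = 2 * (v (0, 2) - v (1, 2) - v (2, 2)) := by
  simp [readout, ht, Fintype.sum_prod_type, Fin.sum_univ_three]
  ring

/-- The weights of step `τ` of the square approximation: with `w = tent^[τ - 1] u`, they lead from
`w`, `max (w - 1 / 2) 0`, `sqApprox (τ - 1) u` to `tent w`, `tent w`, `sqApprox τ u`. -/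
def iterWeight (τ : ℕ) : Matrix (Fin 3) (Fin 3) ℝ :=
  !![2, -4, 0; 2, -4, 0; -2 / 4 ^ τ, 4 / 4 ^ τ, 1]

/-- The weights between the neurons of one product. A level of the tree takes `R + 1` layers: the
first one reads the children `y`, `z` of a node and forms `(y + z) / 2`, `y / 2`, `z / 2`, and the
other ones square these numbers approximately. -/
def gateWeight (J R t : ℕ) (g g' : Gate J) : ℝ :=
  if t % (R + 1) = 0 then
    ((if (g'.1 : ℕ) = 2 * g.1 then ![1 / 2, 1 / 2, 0] g.2.1 else 0) +
      (if (g'.1 : ℕ) = 2 * g.1 + 1 then ![1 / 2, 0, 1 / 2] g.2.1 else 0)) * readout t g'.2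
  else if g'.1 = g.1 ∧ g'.2.1 = g.2.1 then iterWeight (t % (R + 1)) g.2.2 g'.2.2 else 0

/-- The bias of the neurons of one product. -/
def gateBias {J : ℕ} (g : Gate J) : ℝ := if g.2.2 = 1 then -(1 / 2) else 0

open Classical in
/-- The network that computes approximate tensor products of hats in parallel. The first layer holds
the ReLUs `max (t - q) 0`, `q = 0, 1, 2`, that compose the hat function of each variable, and the
constant `1` at the nodes beyond the dimension. -/
def productNet {d : ℕ} {K : Type*} (J R : ℕ) (k s : K → Fin d → ℕ) :
    HiddenNet d (K × Gate J) where
  inWeight h i := if h.2.2.2 = 2 ∧ (h.2.1 : ℕ) = i then 2 ^ (k h.1 i + 1) else 0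
  inBias h := if h.2.2.2 = 2 then
      (if hd : (h.2.1 : ℕ) < d then -(2 * s h.1 ⟨h.2.1, hd⟩) - (h.2.2.1 : ℕ)
        else if h.2.2.1 = 0 then 1 else 0)
    else 0
  weight t h h' := if h.1 = h'.1 then gateWeight J R t h.2 h'.2 else 0
  bias _ h := gateBias h.2

section State

variable {d : ℕ} {K : Type*} [Fintype K] (J R : ℕ) (k s : K → Fin d → ℕ) (x : Fin d → ℝ)

theorem state_productNet_zero (κ : K) (a : Fin (2 ^ J)) (q : Fin 3) :
    (productNet J R k s).state x 0 (κ, a, q, 2) =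
      max (if ha : (a : ℕ) < d then 2 ^ (k κ ⟨a, ha⟩ + 1) * x ⟨a, ha⟩ - 2 * s κ ⟨a, ha⟩ - (q : ℕ)
        else if q = 0 then 1 else 0) 0 := by
  rw [HiddenNet.state]
  congr 1
  simp only [productNet, true_and, if_true]
  by_cases ha : (a : ℕ) < d
  · rw [Finset.sum_eq_single ⟨a, ha⟩ (fun i _ hi => ?_) (by simp)]
    · simp only [if_true, ha, dite_true]
      ring
    · rw [if_neg fun h => hi (Fin.ext h.symm), zero_mul]
  · rw [Finset.sum_eq_zero fun i _ => ?_]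
    · simp [ha]
    · rw [if_neg (by omega), zero_mul]

theorem state_productNet_succ (t : ℕ) (κ : K) (g : Gate J) :
    (productNet J R k s).state x (t + 1) (κ, g) =
      max (∑ g', gateWeight J R t g g' * (productNet J R k s).state x t (κ, g') + gateBias g)
        0 := by
  classical
  rw [HiddenNet.state, Fintype.sum_prod_type]
  congr 2
  rw [Finset.sum_eq_single κ]
  · simp [productNet]
  · intro κ' _ h
    simp [productNet, h.symm]
  · simp

theorem readout_state_zero (κ : K) (a : Fin (2 ^ J)) :
    ∑ c, readout 0 c * (productNet J R k s).state x 0 (κ, a, c) = hatVec (k κ) (s κ) x a := by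
  rw [sum_readout_zero fun c => (productNet J R k s).state x 0 (κ, a, c)]
  simp only [state_productNet_zero, hatVec]
  by_cases ha : (a : ℕ) < d <;> simp [ha, hat]

theorem state_productNet_of_mod_eq_zero {t : ℕ} (ht : t % (R + 1) = 0) (κ : K) (a : Fin (2 ^ J))
    (h0 : 2 * (a : ℕ) + 1 < 2 ^ J) (q r : Fin 3) {y z : ℝ}
    (hy : ∑ c, readout t c * (productNet J R k s).state x t (κ, ⟨2 * a, by omega⟩, c) = y)
    (hz : ∑ c, readout t c * (productNet J R k s).state x t (κ, ⟨2 * a + 1, h0⟩, c) = z) :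
    (productNet J R k s).state x (t + 1) (κ, a, q, r) =
      max (![1 / 2, 1 / 2, 0] q * y + ![1 / 2, 0, 1 / 2] q * z +
        if r = 1 then -(1 / 2) else 0) 0 := by
  rw [state_productNet_succ]
  simp only [gateWeight, if_pos ht, gateBias]
  congr 2
  rw [Fintype.sum_prod_type]
  have hchildren : ∀ a' : Fin (2 ^ J), ∑ c : Fin 3 × Fin 3,
      ((if (a' : ℕ) = 2 * a then ![1 / 2, 1 / 2, 0] q else 0) +
        (if (a' : ℕ) = 2 * a + 1 then (![1 / 2, 0, 1 / 2] q : ℝ) else 0)) * readout t c *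
          (productNet J R k s).state x t (κ, a', c) =
      (if a' = ⟨2 * a, by omega⟩ then ![1 / 2, 1 / 2, 0] q * y else 0) +
      (if a' = ⟨2 * a + 1, h0⟩ then ![1 / 2, 0, 1 / 2] q * z else 0) := by
    intro a'
    simp only [mul_assoc, ← Finset.mul_sum, add_mul, Finset.sum_add_distrib, Fin.ext_iff]
    split_ifs with hl hr hr
    · omega
    · rw [show a' = ⟨2 * a, by omega⟩ from Fin.ext hl, hy, zero_mul]
    · rw [show a' = ⟨2 * a + 1, h0⟩ from Fin.ext hr, hz, zero_mul]
    · simp only [zero_mul]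
  simp only [hchildren, Finset.sum_add_distrib, Finset.sum_ite_eq', Finset.mem_univ, if_true]

theorem state_productNet_of_mod_ne_zero {t : ℕ} (ht : t % (R + 1) ≠ 0) (κ : K) (a : Fin (2 ^ J))
    (q r : Fin 3) :
    (productNet J R k s).state x (t + 1) (κ, a, q, r) =
      max (∑ r', iterWeight (t % (R + 1)) r r' * (productNet J R k s).state x t (κ, a, q, r') +
        if r = 1 then -(1 / 2) else 0) 0 := by
  rw [state_productNet_succ]
  simp only [gateWeight, if_neg ht, gateBias]
  congr 2
  rw [Fintype.sum_prod_type, Finset.sum_eq_single a]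
  · rw [Fintype.sum_prod_type, Finset.sum_eq_single q]
    · simp
    · intro q' _ h; simp [h]
    · simp
  · intro a' _ h; simp [h]
  · simp

theorem state_square {j : ℕ} (κ : K) (a : Fin (2 ^ J)) (q : Fin 3) {u : ℝ}
    (hu : u ∈ Icc (0 : ℝ) 1)
    (hinit : ∀ r : Fin 3, (productNet J R k s).state x (j * (R + 1) + 1) (κ, a, q, r) =
      max (u + if r = 1 then -(1 / 2) else 0) 0) {τ : ℕ} (hτ : τ ≤ R) :
    (productNet J R k s).state x (j * (R + 1) + τ + 1) (κ, a, q, 0) = tent^[τ] u ∧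
    (productNet J R k s).state x (j * (R + 1) + τ + 1) (κ, a, q, 1) = max (tent^[τ] u - 1 / 2) 0 ∧
    (productNet J R k s).state x (j * (R + 1) + τ + 1) (κ, a, q, 2) = sqApprox τ u := by
  induction τ with
  | zero =>
    simp only [add_zero, hinit, Function.iterate_zero, id, sqApprox]
    exact ⟨by simpa using hu.1, by simp [sub_eq_add_neg], by simpa using hu.1⟩
  | succ τ ih =>
    obtain ⟨h0, h1, h2⟩ := ih (by omega)
    have hmod : (j * (R + 1) + τ + 1) % (R + 1) = τ + 1 := by
      rw [add_assoc, add_comm, Nat.add_mul_mod_self_right, Nat.mod_eq_of_lt (by omega)]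
    have hstep := state_productNet_of_mod_ne_zero J R k s x (t := j * (R + 1) + τ + 1) (by omega) κ
      a q
    have htent : 0 ≤ tent (tent^[τ] u) :=
      Function.iterate_succ_apply' tent τ u ▸ (tent_iterate_mem hu (τ + 1)).1
    have hsq : 0 ≤ sqApprox τ u - tent (tent^[τ] u) / 4 ^ (τ + 1) := by
      have h := (sq_nonneg u).trans (sq_le_sqApprox (τ + 1) hu)
      rwa [sqApprox, Function.iterate_succ_apply'] at h
    rw [← add_assoc]
    simp only [hstep, hmod, Fin.sum_univ_three, h0, h1, h2, Function.iterate_succ_apply', sqApprox]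
    generalize tent^[τ] u = w at *
    have htent_eq : 2 * w + -(4 * max (w - 2⁻¹) 0) = tent w := by
      rw [tent, one_div]
      ring
    have hsq_eq : -2 / 4 ^ (τ + 1) * w + 4 / 4 ^ (τ + 1) * max (w - 2⁻¹) 0 + sqApprox τ u =
        sqApprox τ u - tent w / 4 ^ (τ + 1) := by
      rw [← htent_eq]
      ring
    refine ⟨?_, ?_, ?_⟩
    · simpa [iterWeight, htent_eq] using htent
    · simp [iterWeight, htent_eq, ← sub_eq_add_neg]
    · simpa [iterWeight, hsq_eq] using hsq

theorem readout_state_succ {j : ℕ} (κ : K) (a : Fin (2 ^ J)) (h0 : 2 * (a : ℕ) + 1 < 2 ^ J)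
    {y z : ℝ} (hy01 : y ∈ Icc (0 : ℝ) 1) (hz01 : z ∈ Icc (0 : ℝ) 1)
    (hy : ∑ c, readout (j * (R + 1)) c *
      (productNet J R k s).state x (j * (R + 1)) (κ, ⟨2 * a, by omega⟩, c) = y)
    (hz : ∑ c, readout (j * (R + 1)) c *
      (productNet J R k s).state x (j * (R + 1)) (κ, ⟨2 * a + 1, h0⟩, c) = z) :
    ∑ c, readout ((j + 1) * (R + 1)) c *
      (productNet J R k s).state x ((j + 1) * (R + 1)) (κ, a, c) = mulApprox R y z := by
  obtain ⟨y0, y1⟩ := hy01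
  obtain ⟨z0, z1⟩ := hz01
  have hargs : ∀ q : Fin 3, (![1 / 2, 1 / 2, 0] q * y + ![1 / 2, 0, 1 / 2] q * z : ℝ) ∈
      Icc (0 : ℝ) 1 := by
    intro q
    fin_cases q <;> simp <;> constructor <;> linarith
  have hsq : ∀ q : Fin 3, (productNet J R k s).state x ((j + 1) * (R + 1)) (κ, a, q, 2) =
      sqApprox R (![1 / 2, 1 / 2, 0] q * y + ![1 / 2, 0, 1 / 2] q * z) := by
    intro q
    rw [show (j + 1) * (R + 1) = j * (R + 1) + R + 1 by ring]
    exact (state_square J R k s x κ a q (hargs q) (fun r => state_productNet_of_mod_eq_zero J R k s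
      x (Nat.mul_mod_left _ _) κ a h0 q r hy hz) le_rfl).2.2
  rw [sum_readout_of_ne_zero (by positivity) fun c =>
    (productNet J R k s).state x ((j + 1) * (R + 1)) (κ, a, c)]
  simp only [hsq, mulApprox]
  congr <;> simp <;> ring

theorem readout_state {j : ℕ} (hj : j ≤ J) (κ : K) (a : Fin (2 ^ J)) (ha : (a : ℕ) < 2 ^ (J - j)) :
    ∑ c, readout (j * (R + 1)) c * (productNet J R k s).state x (j * (R + 1)) (κ, a, c) =
      treeApprox R (hatVec (k κ) (s κ) x) j a := by
  induction j generalizing a with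
  | zero => simpa [treeApprox] using readout_state_zero J R k s x κ a
  | succ j ih =>
    have : 2 ^ (J - j) = 2 * 2 ^ (J - (j + 1)) := by
      rw [← pow_succ', show J - (j + 1) + 1 = J - j by omega]
    have : 2 ^ (J - j) ≤ 2 ^ J := Nat.pow_le_pow_right two_pos (Nat.sub_le J j)
    have hv := treeApprox_mem R (hatVec_mem (k κ) (s κ) x) j
    exact readout_state_succ J R k s x κ a (by omega) (hv (2 * a)) (hv (2 * a + 1))
      (ih (by omega) ⟨2 * a, by omega⟩ (by simp only; omega))
      (ih (by omega) ⟨2 * a + 1, by omega⟩ (by simp only; omega))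

end State

theorem numNonzero_prod_le {ι κ : Type*} [Fintype ι] [Fintype κ] {v : ι → κ → ℝ} {n : ℕ}
    (h : ∀ i, numNonzero (v i) ≤ n) :
    numNonzero (fun q : ι × κ => v q.1 q.2) ≤ Fintype.card ι * n := by
  have hrows : numNonzero (fun q : ι × κ => v q.1 q.2) = ∑ i, numNonzero (v i) := by
    simp only [numNonzero, Finset.card_filter, Fintype.sum_prod_type]
  rw [hrows]
  exact (Finset.sum_le_card_nsmul _ _ n fun i _ => h i).trans (by simp)

section Cost

variable {d : ℕ} {K : Type*} (J R : ℕ) (k s : K → Fin d → ℕ)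

theorem numNonzero_inWeight_productNet_le (h : K × Gate J) :
    numNonzero ((productNet J R k s).inWeight h) ≤ 1 := by
  refine Finset.card_le_one.2 fun i hi j hj => ?_
  simp only [productNet, ne_eq, Finset.mem_filter, Finset.mem_univ, true_and, ite_eq_right_iff,
    Classical.not_imp] at hi hj
  exact Fin.ext (hi.1.2.symm.trans hj.1.2)

variable [Fintype K]

theorem numNonzero_weight_productNet_le (t : ℕ) (h : K × Gate J) :
    numNonzero ((productNet J R k s).weight t h) ≤ 18 := by
  have hcard : (Finset.univ : Finset (Bool × Fin 3 × Fin 3)).card = 18 := by simp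
  rw [← hcard]
  refine Finset.card_le_card_of_injOn (fun h' => (decide ((h'.2.1 : ℕ) = 2 * h.2.1), h'.2.2))
    (fun _ _ => by simp) ?_
  rintro ⟨κ, a, c⟩ hp ⟨κ', a', c'⟩ hq hpq
  simp only [Prod.mk.injEq, decide_eq_decide] at hpq
  replace hp := (Finset.mem_filter.1 hp).2
  replace hq := (Finset.mem_filter.1 hq).2
  simp only [productNet, ne_eq, ite_eq_right_iff, Classical.not_imp, gateWeight] at hp hq
  obtain ⟨rfl, hp⟩ := hp
  obtain ⟨rfl, hq⟩ := hq
  obtain rfl : a = a' := by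
    split_ifs at hp hq <;> first | (simp at hp; done) | (simp at hq; done) | (ext; omega)
  rw [hpq.2]

theorem cost_productNet_le (T : ℕ) :
    (productNet J R k s).cost T ≤ Fintype.card K * (2 ^ J * 9) * (3 + 19 * T) := by
  have hcard : Fintype.card (K × Gate J) = Fintype.card K * (2 ^ J * 9) := by
    simp [Fintype.card_prod]
  rw [← hcard, HiddenNet.cost]
  have hlayers : ∑ t ∈ Finset.range T, (numNonzero (fun q : (K × Gate J) × K × Gate J =>
      (productNet J R k s).weight t q.1 q.2) + numNonzero ((productNet J R k s).bias t)) ≤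
        T * (Fintype.card (K × Gate J) * 19) := by
    refine (Finset.sum_le_card_nsmul _ _ (Fintype.card (K × Gate J) * 19) fun t _ => ?_).trans
      (by simp)
    exact (add_le_add (numNonzero_prod_le (numNonzero_weight_productNet_le J R k s t))
      (numNonzero_le_card _)).trans (by omega)
  calc _ ≤ (Fintype.card (K × Gate J) * 1 + Fintype.card (K × Gate J)) +
        T * (Fintype.card (K × Gate J) * 19) + Fintype.card (K × Gate J) := by
        gcongr
        · exact numNonzero_prod_le (numNonzero_inWeight_productNet_le J R k s)
        · exact numNonzero_le_card _
    _ = Fintype.card (K × Gate J) * (3 + 19 * T) := by ring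

end Cost

theorem exists_architecture_hats {d : ℕ} {K : Type*} [Fintype K] (J R : ℕ) (k s : K → Fin d → ℕ) :
    ∃ (S : NetShape d) (A : NeuralNet S), A.IsArchitecture ∧ A.depth = J * (R + 1) + 2 ∧
      A.size ≤ Fintype.card K * (2 ^ J * 9) * (3 + 19 * (J * (R + 1))) ∧
      ∀ c : K → ℝ, ∃ Φ : NeuralNet S, Φ.HasArchitecture A ∧
        ∀ x, Φ.output x = ∑ κ, c κ * treeApprox R (hatVec (k κ) (s κ) x) J 0 := by
  rcases isEmpty_or_nonempty K with hK | hK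
  · obtain ⟨S, A, hA, hdepth, hsize, hAA, hout⟩ := exists_architecture_size_eq_zero d (J * (R + 1))
    exact ⟨S, A, hA, hdepth, hsize.le.trans (Nat.zero_le _), fun c =>
      ⟨A, hAA, fun x => (hout x).trans (Fintype.sum_empty _).symm⟩⟩
  obtain ⟨S, A, hA, hdepth, hsize, hout⟩ := (productNet J R k s).exists_architecture (J * (R + 1))
  refine ⟨S, A, hA, hdepth, hsize.trans (cost_productNet_le J R k s _), fun c => ?_⟩
  obtain ⟨Φ, hΦ, hΦout⟩ := hout fun h => if (h.2.1 : ℕ) = 0 then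
    c h.1 * readout (J * (R + 1)) h.2.2 else 0
  refine ⟨Φ, hΦ, fun x => ?_⟩
  rw [hΦout, Fintype.sum_prod_type]
  refine Finset.sum_congr rfl fun κ _ => ?_
  rw [← readout_state J R k s x le_rfl κ ⟨0, by positivity⟩ (by simp), Fintype.sum_prod_type,
    Finset.sum_eq_single ⟨0, by positivity⟩ (fun a _ ha => ?_) (by simp), Finset.mul_sum]
  · simp only [if_true, mul_assoc]
  · simp [show (a : ℕ) ≠ 0 from fun h => ha (Fin.ext h)]

/-! ### Mixed second differences as finite sums -/

/-- The coefficient of the point evaluation at `y` in a univariate second difference. -/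
def diffWeight (x h y : ℝ) : ℝ :=
  (if y = x + 2 * h then 1 else 0) - 2 * (if y = x + h then 1 else 0) + if y = x then 1 else 0

/-- The coefficient of the point evaluation at `y` in the mixed difference `mixedDiff u h` at
`x`. -/
def mixedDiffWeight {d : ℕ} (u : Finset (Fin d)) (h x y : Fin d → ℝ) : ℝ :=
  ∏ i, if i ∈ u then diffWeight (x i) (h i) (y i) else if y i = x i then 1 else 0

theorem mixedDiff_empty {d : ℕ} (h : Fin d → ℝ) : mixedDiff ∅ h = 1 :=
  Finset.noncommProd_empty _ _

theorem mixedDiff_insert_apply {d : ℕ} {u : Finset (Fin d)} {a : Fin d} (ha : a ∉ u)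
    (h : Fin d → ℝ) (f : (Fin d → ℝ) → ℝ) (x : Fin d → ℝ) :
    mixedDiff (insert a u) h f x = mixedDiff u h f (Function.update x a (x a + 2 * h a)) -
      2 * mixedDiff u h f (Function.update x a (x a + h a)) + mixedDiff u h f x := by
  have hinsert : mixedDiff (insert a u) h = secondDiff a (h a) * mixedDiff u h :=
    Finset.noncommProd_insert_of_notMem _ _ _ _ ha
  rw [hinsert]
  rfl

theorem mixedDiffWeight_update {d : ℕ} {u : Finset (Fin d)} {a : Fin d} (ha : a ∉ u)
    (h x y : Fin d → ℝ) (t : ℝ) :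
    mixedDiffWeight u h (Function.update x a t) y = (if y a = t then 1 else 0) *
      ∏ i ∈ Finset.univ.erase a,
        if i ∈ u then diffWeight (x i) (h i) (y i) else if y i = x i then 1 else 0 := by
  rw [mixedDiffWeight, ← Finset.mul_prod_erase _ _ (Finset.mem_univ a), if_neg ha,
    Function.update_self]
  congr 1
  refine Finset.prod_congr rfl fun i hi => ?_
  rw [Function.update_of_ne (Finset.ne_of_mem_erase hi)]

theorem mixedDiffWeight_insert {d : ℕ} {u : Finset (Fin d)} {a : Fin d} (ha : a ∉ u)
    (h x y : Fin d → ℝ) :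
    mixedDiffWeight (insert a u) h x y =
      mixedDiffWeight u h (Function.update x a (x a + 2 * h a)) y -
        2 * mixedDiffWeight u h (Function.update x a (x a + h a)) y + mixedDiffWeight u h x y := by
  have hself := mixedDiffWeight_update ha h x y (x a)
  rw [Function.update_eq_self] at hself
  have herase : ∏ i ∈ Finset.univ.erase a, (if i ∈ insert a u then diffWeight (x i) (h i) (y i) else
      if y i = x i then 1 else 0) = ∏ i ∈ Finset.univ.erase a,
      (if i ∈ u then diffWeight (x i) (h i) (y i) else if y i = x i then 1 else 0) := by
    refine Finset.prod_congr rfl fun i hi => ?_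
    simp only [Finset.mem_insert, Finset.ne_of_mem_erase hi, false_or]
  rw [hself, mixedDiffWeight_update ha, mixedDiffWeight_update ha, mixedDiffWeight,
    ← Finset.mul_prod_erase _ _ (Finset.mem_univ a), if_pos (Finset.mem_insert_self a u), herase,
    diffWeight]
  ring

theorem mixedDiff_eq_sum {d : ℕ} (u : Finset (Fin d)) (h : Fin d → ℝ) (f : (Fin d → ℝ) → ℝ)
    (x : Fin d → ℝ) (Y : Fin d → Finset ℝ) (hY : ∀ i, x i ∈ Y i)
    (hYu : ∀ i ∈ u, x i + h i ∈ Y i ∧ x i + 2 * h i ∈ Y i) :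
    mixedDiff u h f x = ∑ y ∈ Fintype.piFinset Y, mixedDiffWeight u h x y * f y := by
  classical
  induction u using Finset.induction_on generalizing x with
  | empty =>
    rw [Finset.sum_eq_single_of_mem x (Fintype.mem_piFinset.2 hY) fun y _ hy => ?_]
    · simp [mixedDiff_empty, mixedDiffWeight]
    · obtain ⟨i, hi⟩ := Function.ne_iff.1 hy
      rw [mixedDiffWeight, Finset.prod_eq_zero (Finset.mem_univ i) (by simp [hi]), zero_mul]
  | insert a u ha ih =>
    have hself := hYu a (Finset.mem_insert_self a u)
    have hYu' := fun i hi => hYu i (Finset.mem_insert_of_mem hi)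
    have hshift : ∀ t ∈ Y a, mixedDiff u h f (Function.update x a t) =
        ∑ y ∈ Fintype.piFinset Y, mixedDiffWeight u h (Function.update x a t) y * f y := by
      refine fun t ht => ih _ (fun i => ?_) fun i hi => ?_
      · rcases eq_or_ne i a with rfl | hia
        · rwa [Function.update_self]
        · rw [Function.update_of_ne hia]
          exact hY i
      · rw [Function.update_of_ne (ne_of_mem_of_not_mem hi ha)]
        exact hYu' i hi
    rw [mixedDiff_insert_apply ha, hshift _ hself.1, hshift _ hself.2, ih x hY hYu',
      Finset.mul_sum, ← Finset.sum_sub_distrib, ← Finset.sum_add_distrib]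
    refine Finset.sum_congr rfl fun y _ => ?_
    rw [mixedDiffWeight_insert ha]
    ring

/-! ### Dyadic interpolation -/

theorem dyadic_add_step (a : ℝ) (n : ℕ) : a / 2 ^ n + 2 * (2 ^ (n + 1))⁻¹ = (a + 1) / 2 ^ n := by
  rw [pow_succ]
  field_simp

theorem dyadic_add_half_step (a : ℝ) (n : ℕ) :
    a / 2 ^ n + (2 ^ (n + 1))⁻¹ = (2 * a + 1) / 2 ^ (n + 1) := by
  rw [pow_succ]
  field_simp

theorem dyadic_succ (a : ℝ) (n : ℕ) : 2 * a / 2 ^ (n + 1) = a / 2 ^ n := by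
  rw [pow_succ]
  field_simp

/-- The coefficient of the point evaluation at `y` in the piecewise linear interpolation on the
dyadic grid of level `n`, evaluated at `x`. -/
def interpWeight (n : ℕ) (x y : ℝ) : ℝ :=
  (1 - Int.fract (2 ^ n * x)) * (if y = ⌊2 ^ n * x⌋ / 2 ^ n then 1 else 0) +
    Int.fract (2 ^ n * x) * if y = (⌊2 ^ n * x⌋ + 1) / 2 ^ n then 1 else 0

theorem interpWeight_succ_sub (n : ℕ) (x y : ℝ) :
    interpWeight (n + 1) x y - interpWeight n x y =
      -1 / 2 * hat (2 * Int.fract (2 ^ n * x)) *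
        diffWeight (⌊2 ^ n * x⌋ / 2 ^ n) (2 ^ (n + 1))⁻¹ y := by
  rw [interpWeight, interpWeight, diffWeight, dyadic_add_step, dyadic_add_half_step,
    show (2 : ℝ) ^ (n + 1) * x = 2 * (2 ^ n * x) by ring]
  generalize (2 : ℝ) ^ n * x = t
  have := Int.fract_nonneg t
  have hf1 := Int.fract_lt_one t
  have hft := Int.floor_add_fract t
  rcases lt_or_ge (Int.fract t) (1 / 2) with hlt | hge
  · have hfloor : ⌊2 * t⌋ = 2 * ⌊t⌋ := by
      rw [Int.floor_eq_iff]
      push_cast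
      constructor <;> linarith
    have hfract : Int.fract (2 * t) = 2 * Int.fract t := by
      rw [Int.fract, Int.fract, hfloor]
      push_cast
      ring
    rw [hfloor, hfract, hat_of_mem_left (by linarith) (by linarith)]
    push_cast
    rw [dyadic_succ]
    ring
  · have hfloor : ⌊2 * t⌋ = 2 * ⌊t⌋ + 1 := by
      rw [Int.floor_eq_iff]
      push_cast
      constructor <;> linarith
    have hfract : Int.fract (2 * t) = 2 * Int.fract t - 1 := by
      rw [Int.fract, Int.fract, hfloor]
      push_cast
      ring
    rw [hfloor, hfract, hat_of_mem_right (by linarith) (by linarith)]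
    push_cast
    rw [show 2 * (⌊t⌋ : ℝ) + 1 + 1 = 2 * (⌊t⌋ + 1) by ring, dyadic_succ]
    ring

theorem interpWeight_nonneg (n : ℕ) (x y : ℝ) : 0 ≤ interpWeight n x y := by
  have := Int.fract_nonneg (2 ^ n * x)
  have := sub_nonneg.2 (Int.fract_lt_one (2 ^ n * x)).le
  rw [interpWeight]
  positivity

theorem abs_sub_le_of_interpWeight_ne_zero {n : ℕ} {x y : ℝ} (h : interpWeight n x y ≠ 0) :
    |y - x| ≤ (1 / 2) ^ n := by
  have hf0 := Int.fract_nonneg (2 ^ n * x)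
  have hf1 := Int.fract_lt_one (2 ^ n * x)
  have hft := Int.floor_add_fract (2 ^ n * x)
  have hpow : (0 : ℝ) < 2 ^ n := by positivity
  have hscaled : |2 ^ n * y - 2 ^ n * x| ≤ 1 := by
    by_cases hl : y = ⌊2 ^ n * x⌋ / 2 ^ n
    · rw [eq_div_iff hpow.ne', mul_comm] at hl
      rw [hl, abs_le]
      constructor <;> linarith
    by_cases hr : y = (⌊2 ^ n * x⌋ + 1) / 2 ^ n
    · rw [eq_div_iff hpow.ne', mul_comm] at hr
      rw [hr, abs_le]
      constructor <;> linarith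
    · simp [interpWeight, hl, hr] at h
  rw [← mul_sub, abs_mul, abs_of_pos hpow] at hscaled
  rwa [one_div_pow, le_div_iff₀' hpow]

/-- The dyadic points of level `n` in the unit interval. -/
def dyadicGrid (n : ℕ) : Finset ℝ := (Finset.range (2 ^ n + 1)).image fun j : ℕ => (j : ℝ) / 2 ^ n

theorem div_mem_dyadicGrid {k n : ℕ} (hk : k ≤ n) {j : ℤ} (h0 : 0 ≤ j) (hj : j ≤ 2 ^ k) :
    (j : ℝ) / 2 ^ k ∈ dyadicGrid n := by
  obtain ⟨m, rfl⟩ := Int.eq_ofNat_of_zero_le h0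
  have hm : m ≤ 2 ^ k := by exact_mod_cast hj
  rw [dyadicGrid, Finset.mem_image]
  refine ⟨m * 2 ^ (n - k), ?_, ?_⟩
  · rw [Finset.mem_range, Nat.lt_succ_iff]
    calc m * 2 ^ (n - k) ≤ 2 ^ k * 2 ^ (n - k) := by gcongr
      _ = 2 ^ n := pow_mul_pow_sub 2 hk
  · rw [← pow_mul_pow_sub (2 : ℝ) hk]
    push_cast
    field_simp

theorem mem_Icc_of_mem_dyadicGrid {n : ℕ} {y : ℝ} (h : y ∈ dyadicGrid n) : y ∈ Icc (0 : ℝ) 1 := by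
  rw [dyadicGrid, Finset.mem_image] at h
  obtain ⟨j, hj, rfl⟩ := h
  rw [Finset.mem_range, Nat.lt_succ_iff] at hj
  refine ⟨by positivity, ?_⟩
  rw [div_le_one (by positivity)]
  exact_mod_cast hj

theorem floor_two_pow_mul_bounds (k : ℕ) {x : ℝ} (h0 : 0 < x) (h1 : x < 1) :
    0 ≤ ⌊2 ^ k * x⌋ ∧ ⌊2 ^ k * x⌋ + 1 ≤ 2 ^ k := by
  refine ⟨Int.floor_nonneg.2 (by positivity), ?_⟩
  rw [Int.add_one_le_iff, Int.floor_lt]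
  push_cast
  exact mul_lt_of_lt_one_right (by positivity) h1

section FloorMem

variable {k n : ℕ} {x : ℝ} (h0 : 0 < x) (h1 : x < 1)

include h0 h1

theorem floor_div_mem_dyadicGrid (hk : k ≤ n) : (⌊2 ^ k * x⌋ : ℝ) / 2 ^ k ∈ dyadicGrid n := by
  obtain ⟨hl, hr⟩ := floor_two_pow_mul_bounds k h0 h1
  exact div_mem_dyadicGrid hk hl (by omega)

theorem floor_add_one_div_mem_dyadicGrid (hk : k ≤ n) :
    (⌊2 ^ k * x⌋ + 1 : ℝ) / 2 ^ k ∈ dyadicGrid n := by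
  obtain ⟨hl, hr⟩ := floor_two_pow_mul_bounds k h0 h1
  exact_mod_cast div_mem_dyadicGrid hk (j := ⌊2 ^ k * x⌋ + 1) (by omega) hr

theorem floor_midpoint_mem_dyadicGrid (hk : k < n) :
    (2 * ⌊2 ^ k * x⌋ + 1 : ℝ) / 2 ^ (k + 1) ∈ dyadicGrid n := by
  obtain ⟨hl, hr⟩ := floor_two_pow_mul_bounds k h0 h1
  exact_mod_cast div_mem_dyadicGrid hk (j := 2 * ⌊2 ^ k * x⌋ + 1) (by omega)
    (by rw [pow_succ]; omega)

theorem sum_interpWeight (n : ℕ) : ∑ y ∈ dyadicGrid n, interpWeight n x y = 1 := by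
  simp only [interpWeight, Finset.sum_add_distrib, ← Finset.mul_sum, Finset.sum_ite_eq',
    floor_div_mem_dyadicGrid h0 h1 le_rfl, floor_add_one_div_mem_dyadicGrid h0 h1 le_rfl, if_true]
  ring

end FloorMem

theorem sum_prod_interpWeight {d : ℕ} {x : Fin d → ℝ} (hx : x ∈ openCube d) (n : ℕ) :
    ∑ y ∈ Fintype.piFinset fun _ : Fin d => dyadicGrid n, ∏ i, interpWeight n (x i) (y i) = 1 := by
  rw [← Finset.prod_univ_sum (fun _ => dyadicGrid n) fun i y => interpWeight n (x i) y]
  exact Finset.prod_eq_one fun i _ => sum_interpWeight (hx i).1 (hx i).2 n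

theorem dist_le_of_prod_interpWeight_ne_zero {d n : ℕ} {x y : Fin d → ℝ}
    (h : ∏ i, interpWeight n (x i) (y i) ≠ 0) : dist y x ≤ (1 / 2) ^ n :=
  (dist_pi_le_iff (by positivity)).2 fun i =>
    abs_sub_le_of_interpWeight_ne_zero (Finset.prod_ne_zero_iff.1 h i (Finset.mem_univ i))

theorem tendsto_sum_interpWeight {d : ℕ} {f : (Fin d → ℝ) → ℝ} {x : Fin d → ℝ}
    (hx : x ∈ openCube d) (hf : ContinuousAt f x) :
    Filter.Tendsto (fun n => ∑ y ∈ Fintype.piFinset fun _ : Fin d => dyadicGrid n,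
      (∏ i, interpWeight n (x i) (y i)) * f y) Filter.atTop (nhds (f x)) := by
  rw [Metric.tendsto_atTop']
  intro ε hε
  obtain ⟨δ, hδ, hfδ⟩ := Metric.continuousAt_iff.1 hf (ε / 2) (by positivity)
  obtain ⟨N, hN⟩ := exists_pow_lt_of_lt_one hδ (by norm_num : (1 / 2 : ℝ) < 1)
  refine ⟨N, fun n hn => ?_⟩
  have hpow : (1 / 2 : ℝ) ^ n < δ :=
    (pow_le_pow_of_le_one (by norm_num) (by norm_num) hn.le).trans_lt hN
  have hterm : ∀ y, |(∏ i, interpWeight n (x i) (y i)) * (f y - f x)| ≤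
      (∏ i, interpWeight n (x i) (y i)) * (ε / 2) := by
    intro y
    have hnonneg : 0 ≤ ∏ i, interpWeight n (x i) (y i) :=
      Finset.prod_nonneg fun i _ => interpWeight_nonneg _ _ _
    rw [abs_mul, abs_of_nonneg hnonneg]
    rcases eq_or_ne (∏ i, interpWeight n (x i) (y i)) 0 with hzero | hne
    · rw [hzero, zero_mul, zero_mul]
    · exact mul_le_mul_of_nonneg_left
        (hfδ ((dist_le_of_prod_interpWeight_ne_zero hne).trans_lt hpow)).le hnonneg
  calc dist _ (f x) = |∑ y ∈ Fintype.piFinset fun _ : Fin d => dyadicGrid n,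
        (∏ i, interpWeight n (x i) (y i)) * (f y - f x)| := by
        simp only [Real.dist_eq, mul_sub, Finset.sum_sub_distrib, ← Finset.sum_mul,
          sum_prod_interpWeight hx, one_mul]
    _ ≤ ∑ y ∈ Fintype.piFinset fun _ : Fin d => dyadicGrid n,
        (∏ i, interpWeight n (x i) (y i)) * (ε / 2) :=
        (Finset.abs_sum_le_sum_abs _ _).trans (Finset.sum_le_sum fun y _ => hterm y)
    _ = ε / 2 := by rw [← Finset.sum_mul, sum_prod_interpWeight hx, one_mul]
    _ < ε := half_lt_self hε

/-! ### The Faber series -/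

theorem sum_prod_pow_le {d : ℕ} {r : ℝ} (h0 : 0 ≤ r) (h1 : r < 1) (S : Finset (Fin d → ℕ)) :
    ∑ k ∈ S, ∏ i, r ^ k i ≤ ((1 - r)⁻¹) ^ d := by
  set T : Fin d → Finset ℕ := fun i => S.image fun k => k i
  have hST : S ⊆ Fintype.piFinset T := fun k hk =>
    Fintype.mem_piFinset.2 fun i => Finset.mem_image_of_mem _ hk
  calc ∑ k ∈ S, ∏ i, r ^ k i ≤ ∑ k ∈ Fintype.piFinset T, ∏ i, r ^ k i :=
        Finset.sum_le_sum_of_subset_of_nonneg hST fun _ _ _ =>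
          Finset.prod_nonneg fun _ _ => pow_nonneg h0 _
    _ = ∏ i, ∑ j ∈ T i, r ^ j := (Finset.prod_univ_sum _ _).symm
    _ ≤ ∏ _i : Fin d, (1 - r)⁻¹ :=
        Finset.prod_le_prod (fun _ _ => Finset.sum_nonneg fun _ _ => pow_nonneg h0 _) fun _ _ =>
          sum_le_hasSum _ (fun _ _ => pow_nonneg h0 _) (hasSum_geometric_of_lt_one h0 h1)
    _ = _ := by rw [Finset.prod_const, Finset.card_univ, Fintype.card_fin]

theorem summable_prod_pow {d : ℕ} {r : ℝ} (h0 : 0 ≤ r) (h1 : r < 1) :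
    Summable fun k : Fin d → ℕ => ∏ i, r ^ k i :=
  summable_of_sum_le (fun _ => Finset.prod_nonneg fun _ _ => pow_nonneg h0 _)
    (sum_prod_pow_le h0 h1)

/-- The tensor product hat function of level `k` and position `s`. -/
def tensorHat {d : ℕ} (k s : Fin d → ℕ) (x : Fin d → ℝ) : ℝ :=
  ∏ i, hat (2 ^ (k i + 1) * x i - 2 * s i)

/-- The coefficients of the Faber series. -/
def faberCoeff {d : ℕ} (f : (Fin d → ℝ) → ℝ) (k s : Fin d → ℕ) : ℝ :=
  (-1 / 2) ^ d * mixedDiff Finset.univ (fun i => (2 ^ (k i + 1))⁻¹) f fun i => s i / 2 ^ k i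

/-- The positions of the hats of level `k`. -/
def positions {d : ℕ} (k : Fin d → ℕ) : Finset (Fin d → ℕ) :=
  Fintype.piFinset fun i => Finset.range (2 ^ k i)

/-- The part of level `k` of the Faber series. -/
def faberLevel {d : ℕ} (f : (Fin d → ℝ) → ℝ) (k : Fin d → ℕ) (x : Fin d → ℝ) : ℝ :=
  ∑ s ∈ positions k, faberCoeff f k s * tensorHat k s x

theorem hat_eq_zero_of_ne_floor {k s : ℕ} {x : ℝ} (h : s ≠ ⌊2 ^ k * x⌋₊) :
    hat (2 ^ (k + 1) * x - 2 * s) = 0 := by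
  rw [show (2 : ℝ) ^ (k + 1) * x - 2 * s = 2 * (2 ^ k * x - s) by ring]
  rcases lt_or_ge (2 ^ k * x) s with hlt | hge
  · exact hat_of_le_zero (by linarith)
  · have hsucc : s + 1 ≤ ⌊2 ^ k * x⌋₊ := (Nat.le_floor hge).lt_of_ne h
    have hle := (Nat.le_floor_iff' s.succ_ne_zero).1 hsucc
    push_cast at hle
    exact hat_of_ge_two (by linarith)

theorem tensorHat_eq_zero {d : ℕ} {k s : Fin d → ℕ} {x : Fin d → ℝ}
    (h : s ≠ fun i => ⌊2 ^ k i * x i⌋₊) : tensorHat k s x = 0 := by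
  obtain ⟨i, hi⟩ := Function.ne_iff.1 h
  exact Finset.prod_eq_zero (Finset.mem_univ i) (hat_eq_zero_of_ne_floor hi)

theorem floor_mem_positions {d : ℕ} (k : Fin d → ℕ) {x : Fin d → ℝ} (hx : x ∈ openCube d) :
    (fun i => ⌊2 ^ k i * x i⌋₊) ∈ positions k := by
  refine Fintype.mem_piFinset.2 fun i => ?_
  have hxi := (hx i).1
  rw [Finset.mem_range, Nat.floor_lt (by positivity)]
  push_cast
  exact mul_lt_of_lt_one_right (by positivity) (hx i).2

theorem faberLevel_eq {d : ℕ} (f : (Fin d → ℝ) → ℝ) (k : Fin d → ℕ) {x : Fin d → ℝ}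
    (hx : x ∈ openCube d) : faberLevel f k x =
      faberCoeff f k (fun i => ⌊2 ^ k i * x i⌋₊) * tensorHat k (fun i => ⌊2 ^ k i * x i⌋₊) x :=
  Finset.sum_eq_single_of_mem _ (floor_mem_positions k hx) fun s _ hs => by
    rw [tensorHat_eq_zero hs, mul_zero]

theorem faberLevel_eq_sum {d : ℕ} (f : (Fin d → ℝ) → ℝ) (k : Fin d → ℕ) {x : Fin d → ℝ}
    (hx : x ∈ openCube d) (n : ℕ) (hk : ∀ i, k i < n) :
    faberLevel f k x = ∑ y ∈ Fintype.piFinset fun _ : Fin d => dyadicGrid n,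
      (∏ i, (interpWeight (k i + 1) (x i) (y i) - interpWeight (k i) (x i) (y i))) * f y := by
  have hfloor : ∀ i, ((⌊2 ^ k i * x i⌋₊ : ℕ) : ℝ) = (⌊2 ^ k i * x i⌋ : ℝ) := fun i =>
    natCast_floor_eq_intCast_floor (mul_nonneg (by positivity) (hx i).1.le)
  rw [faberLevel_eq f k hx, faberCoeff, mixedDiff_eq_sum Finset.univ _ f _ (fun _ => dyadicGrid n),
    Finset.mul_sum, Finset.sum_mul]
  · refine Finset.sum_congr rfl fun y _ => ?_
    have hfract : ∀ i, (2 : ℝ) ^ (k i + 1) * x i - 2 * (⌊2 ^ k i * x i⌋ : ℝ) =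
        2 * Int.fract (2 ^ k i * x i) := by
      intro i
      rw [Int.fract]
      ring
    simp only [mixedDiffWeight, interpWeight_succ_sub, Finset.prod_mul_distrib, Finset.mem_univ,
      if_true, hfloor, hfract, tensorHat, Finset.prod_const, Finset.card_univ, Fintype.card_fin]
    ring
  · intro i
    rw [hfloor]
    exact floor_div_mem_dyadicGrid (hx i).1 (hx i).2 (hk i).le
  · intro i _
    rw [hfloor, dyadic_add_step, dyadic_add_half_step]
    exact ⟨floor_midpoint_mem_dyadicGrid (hx i).1 (hx i).2 (hk i),
      floor_add_one_div_mem_dyadicGrid (hx i).1 (hx i).2 (hk i).le⟩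

theorem sum_faberLevel_eq {d : ℕ} {f : (Fin d → ℝ) → ℝ}
    (hf : ∀ x ∈ unitCube d, (∃ j, x j = 0 ∨ x j = 1) → f x = 0) {x : Fin d → ℝ}
    (hx : x ∈ openCube d) (n : ℕ) :
    ∑ k ∈ Fintype.piFinset fun _ : Fin d => Finset.range n, faberLevel f k x =
      ∑ y ∈ Fintype.piFinset fun _ : Fin d => dyadicGrid n,
        (∏ i, interpWeight n (x i) (y i)) * f y := by
  rw [Finset.sum_congr rfl fun k hk => faberLevel_eq_sum f k hx n
    fun i => Finset.mem_range.1 (Fintype.mem_piFinset.1 hk i), Finset.sum_comm]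
  refine Finset.sum_congr rfl fun y hy => ?_
  have hy01 := fun i => mem_Icc_of_mem_dyadicGrid (Fintype.mem_piFinset.1 hy i)
  rw [← Finset.sum_mul, ← Finset.prod_univ_sum (fun _ => Finset.range n)
    fun i j => interpWeight (j + 1) (x i) (y i) - interpWeight j (x i) (y i)]
  by_cases hboundary : ∃ j, y j = 0 ∨ y j = 1
  · rw [hf y ⟨fun i => (hy01 i).1, fun i => (hy01 i).2⟩ hboundary, mul_zero, mul_zero]
  · push Not at hboundary
    congr 1
    refine Finset.prod_congr rfl fun i _ => ?_
    rw [Finset.sum_range_sub fun j => interpWeight j (x i) (y i)]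
    have hfloor : ⌊x i⌋ = 0 := Int.floor_eq_zero_iff.2 ⟨(hx i).1.le, (hx i).2⟩
    simp [interpWeight, hfloor, (hboundary i).1, (hboundary i).2]

theorem abs_mixedDiff_le {d : ℕ} {α : ℝ} {f : (Fin d → ℝ) → ℝ} (hf : holderNorm α f ≤ 1)
    {u : Finset (Fin d)} {h : Fin d → ℝ} (hpos : ∀ i ∈ u, 0 < h i) {x : Fin d → ℝ}
    (hx : x ∈ diffDomain u h) : |mixedDiff u h f x| ≤ ∏ i ∈ u, h i ^ α := by
  have hle : ENNReal.ofReal ((∏ i ∈ u, h i ^ (-α)) * |mixedDiff u h f x|) ≤ 1 := by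
    refine le_trans ?_ hf
    rw [holderNorm]
    exact le_iSup_of_le u (le_iSup_of_le h (le_iSup_of_le hpos
      (le_iSup_of_le x (le_iSup_of_le hx le_rfl))))
  rw [ENNReal.ofReal_le_one] at hle
  have hprod : 0 < ∏ i ∈ u, h i ^ α :=
    Finset.prod_pos fun i hi => Real.rpow_pos_of_pos (hpos i hi) _
  rwa [Finset.prod_congr rfl fun i hi => Real.rpow_neg (hpos i hi).le α, Finset.prod_inv_distrib,
    inv_mul_le_iff₀ hprod, mul_one] at hle

theorem dyadic_mem_diffDomain {d : ℕ} {k s : Fin d → ℕ} (hs : s ∈ positions k) :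
    (fun i => (s i : ℝ) / 2 ^ k i) ∈ diffDomain Finset.univ fun i => (2 ^ (k i + 1))⁻¹ := by
  have hend : ∀ i, (s i : ℝ) / 2 ^ k i + 2 * (2 ^ (k i + 1))⁻¹ ≤ 1 := by
    intro i
    rw [dyadic_add_step, div_le_one (by positivity)]
    exact_mod_cast Finset.mem_range.1 (Fintype.mem_piFinset.1 hs i)
  have hstep : ∀ i, (0 : ℝ) ≤ 2 * (2 ^ (k i + 1))⁻¹ := fun i => by positivity
  have hstart : ∀ i, (0 : ℝ) ≤ s i / 2 ^ k i := fun i => by positivity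
  exact ⟨⟨hstart, fun i => (le_add_of_nonneg_right (hstep i)).trans (hend i)⟩,
    fun i _ => ⟨add_nonneg (hstart i) (hstep i), hend i⟩⟩

theorem abs_faberCoeff_le {d : ℕ} {α : ℝ} {f : (Fin d → ℝ) → ℝ} (hf : holderNorm α f ≤ 1)
    {k s : Fin d → ℕ} (hs : s ∈ positions k) :
    |faberCoeff f k s| ≤ ((2 : ℝ) ^ (-(α + 1))) ^ d * ∏ i, ((2 : ℝ) ^ (-α)) ^ k i := by
  have hstep : ∀ m : ℕ, (((2 : ℝ) ^ (m + 1))⁻¹) ^ α = 2 ^ (-α) * ((2 : ℝ) ^ (-α)) ^ m := by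
    intro m
    rw [← pow_succ', Real.inv_rpow (by positivity), ← Real.rpow_natCast, ← Real.rpow_natCast,
      ← Real.rpow_mul zero_le_two, ← Real.rpow_mul zero_le_two, ← Real.rpow_neg zero_le_two]
    ring_nf
  have hhalf : (2 : ℝ) ^ (-(α + 1)) = 1 / 2 * 2 ^ (-α) := by
    rw [neg_add, Real.rpow_add two_pos, Real.rpow_neg_one]
    ring
  rw [faberCoeff, abs_mul, abs_pow, show |(-1 / 2 : ℝ)| = 1 / 2 by norm_num]
  calc _ ≤ (1 / 2) ^ d * ∏ i, (((2 : ℝ) ^ (k i + 1))⁻¹) ^ α := by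
        gcongr
        exact abs_mixedDiff_le hf (fun i _ => by positivity) (dyadic_mem_diffDomain hs)
    _ = _ := by
        simp only [hstep, hhalf, Finset.prod_mul_distrib, Finset.prod_const, Finset.card_univ,
          Fintype.card_fin, mul_pow]
        ring

theorem abs_tensorHat_le_one {d : ℕ} (k s : Fin d → ℕ) (x : Fin d → ℝ) : |tensorHat k s x| ≤ 1 := by
  rw [tensorHat, abs_of_nonneg (Finset.prod_nonneg fun i _ => (hat_mem _).1)]
  exact Finset.prod_le_one (fun i _ => (hat_mem _).1) fun i _ => (hat_mem _).2

theorem summable_faberLevel {d : ℕ} {α : ℝ} (hα : 0 < α) {f : (Fin d → ℝ) → ℝ}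
    (hf : holderNorm α f ≤ 1) {x : Fin d → ℝ} (hx : x ∈ openCube d) :
    Summable fun k => faberLevel f k x := by
  have hr : (2 : ℝ) ^ (-α) < 1 := Real.rpow_lt_one_of_one_lt_of_neg one_lt_two (neg_lt_zero.2 hα)
  refine Summable.of_norm_bounded (g := fun k : Fin d → ℕ => ((2 : ℝ) ^ (-(α + 1))) ^ d *
    ∏ i, ((2 : ℝ) ^ (-α)) ^ k i) ((summable_prod_pow (by positivity) hr).mul_left _) fun k => ?_
  rw [faberLevel_eq f k hx, Real.norm_eq_abs, abs_mul]
  exact (mul_le_of_le_one_right (abs_nonneg _) (abs_tensorHat_le_one _ _ _)).trans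
    (abs_faberCoeff_le hf (floor_mem_positions k hx))

theorem tendsto_piFinset_range (d : ℕ) :
    Filter.Tendsto (fun n => Fintype.piFinset fun _ : Fin d => Finset.range n)
      Filter.atTop Filter.atTop := by
  refine Filter.tendsto_atTop_finset_of_monotone
    (fun m n hmn => Fintype.piFinset_subset _ _ fun _ => Finset.range_mono hmn) fun k => ?_
  exact ⟨Finset.univ.sup k + 1, Fintype.mem_piFinset.2 fun i =>
    Finset.mem_range_succ_iff.2 (Finset.le_sup (Finset.mem_univ i))⟩

theorem openCube_eq_pi (d : ℕ) : openCube d = Set.pi Set.univ fun _ => Ioo (0 : ℝ) 1 := by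
  ext y
  simp [openCube, Set.mem_pi]

theorem isOpen_openCube (d : ℕ) : IsOpen (openCube d) := by
  rw [openCube_eq_pi]
  exact isOpen_set_pi Set.finite_univ fun _ _ => isOpen_Ioo

theorem openCube_subset_unitCube (d : ℕ) : openCube d ⊆ unitCube d := fun _ hx =>
  ⟨fun i => (hx i).1.le, fun i => (hx i).2.le⟩

theorem hasSum_faberLevel {d : ℕ} {α : ℝ} (hα : 0 < α) {f : (Fin d → ℝ) → ℝ}
    (hf : f ∈ holderBall d α) {x : Fin d → ℝ} (hx : x ∈ openCube d) :
    HasSum (fun k => faberLevel f k x) (f x) := by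
  obtain ⟨hcont, hboundary, hnorm⟩ := hf
  have hcontAt : ContinuousAt f x := hcont.continuousAt
    (Filter.mem_of_superset ((isOpen_openCube d).mem_nhds hx) (openCube_subset_unitCube d))
  have hsum := (summable_faberLevel hα hnorm hx).hasSum
  have hlim := tendsto_sum_interpWeight hx hcontAt
  simp only [← sum_faberLevel_eq hboundary hx] at hlim
  rwa [tendsto_nhds_unique (hsum.comp (tendsto_piFinset_range d)) hlim] at hsum

/-! ### Series of Lipschitz functions in the Sobolev space -/

theorem restrict_unitCube (d : ℕ) :
    (volume.restrict (unitCube d) : Measure (Fin d → ℝ)) = volume.restrict (openCube d) := by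
  rw [openCube_eq_pi, unitCube]
  exact (Measure.restrict_congr_set (Measure.univ_pi_Ioo_ae_eq_Icc (f := 0) (g := 1))).symm

instance isProbabilityMeasure_unitCube (d : ℕ) :
    IsProbabilityMeasure (volume.restrict (unitCube d)) where
  measure_univ := by simp [unitCube, Real.volume_Icc_pi]

instance isFiniteMeasure_openCube (d : ℕ) : IsFiniteMeasure (volume.restrict (openCube d)) := by
  rw [← restrict_unitCube]
  infer_instance

section BoundedSeries

variable {X ι : Type*} [MeasurableSpace X] {μ : Measure X} [Countable ι] {F : ι → X → ℝ}
  {C : ι → ℝ}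

theorem memLp_tsum_of_abs_le [IsFiniteMeasure μ] (hF : ∀ k, Measurable (F k))
    (hFC : ∀ k x, |F k x| ≤ C k) (hC : Summable C) (p : ℝ≥0∞) :
    MemLp (fun x => ∑' k, F k x) p μ :=
  MemLp.of_bound (Measurable.tsum hF).aestronglyMeasurable (∑' k, C k)
    (.of_forall fun x => tsum_of_norm_bounded hC.hasSum fun k => hFC k x)

theorem hasSum_integral_mul_of_abs_le (hF : ∀ k, Measurable (F k)) (hFC : ∀ k x, |F k x| ≤ C k)
    (hC : Summable C) {ψ : X → ℝ} (hψ : Integrable ψ μ) :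
    HasSum (fun k => ∫ x, F k x * ψ x ∂μ) (∫ x, (∑' k, F k x) * ψ x ∂μ) := by
  refine hasSum_integral_of_dominated_convergence (fun k x => C k * |ψ x|)
    (fun k => (hF k).aestronglyMeasurable.mul hψ.1) (fun k => .of_forall fun x => ?_)
    (.of_forall fun x => hC.mul_right _) ?_ (.of_forall fun x => ?_)
  · rw [norm_mul]
    exact mul_le_mul_of_nonneg_right (hFC k x) (norm_nonneg _)
  · simp only [tsum_mul_right]
    exact hψ.abs.const_mul _
  · have hFx : Summable fun k => F k x := Summable.of_norm_bounded hC fun k => hFC k x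
    exact hFx.hasSum.mul_right (ψ x)

theorem eLpNorm_tsum_le {p : ℝ≥0∞} (hp : 1 ≤ p) (hF : ∀ k, AEStronglyMeasurable (F k) μ)
    (hs : ∀ x, Summable fun k => F k x) :
    eLpNorm (fun x => ∑' k, F k x) p μ ≤ ∑' k, eLpNorm (F k) p μ := by
  refine Lp.eLpNorm_le_of_ae_tendsto (u := Filter.atTop) (f := fun (s : Finset ι) => ∑ k ∈ s, F k)
    (.of_forall fun s => (eLpNorm_sum_le (fun k _ => hF k) hp).trans (ENNReal.sum_le_tsum s))
    (fun s => Finset.aestronglyMeasurable_sum s fun k _ => hF k) (.of_forall fun x => ?_)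
  simp only [Finset.sum_apply]
  exact (hs x).hasSum

end BoundedSeries

section Coordinatewise

variable {d : ℕ} {c : (Fin d → ℝ) → ℝ}

theorem lipschitzWith_of_coordinatewise {C : Fin d → ℝ} (h0 : ∀ i, 0 ≤ C i)
    (hL : ∀ i x t, |c (Function.update x i t) - c x| ≤ C i * |t - x i|) :
    LipschitzWith (∑ i, C i).toNNReal c := by
  classical
  have abs_piecewise_sub_le (x y : Fin d → ℝ) (u : Finset (Fin d)) :
      |c (u.piecewise x y) - c y| ≤ ∑ i ∈ u, C i * |x i - y i| := by
    induction u using Finset.induction_on with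
    | empty => simp
    | insert a u ha ih =>
      rw [Finset.piecewise_insert, Finset.sum_insert ha]
      have hstep := hL a (u.piecewise x y) (x a)
      rw [Finset.piecewise_eq_of_notMem _ _ _ ha] at hstep
      exact (abs_sub_le _ (c (u.piecewise x y)) _).trans (add_le_add hstep ih)
  refine LipschitzWith.of_dist_le_mul fun x y => ?_
  rw [Real.coe_toNNReal _ (Finset.sum_nonneg fun i _ => h0 i), Real.dist_eq, Finset.sum_mul]
  have hxy := abs_piecewise_sub_le x y Finset.univ
  rw [Finset.piecewise_univ] at hxy
  refine hxy.trans (Finset.sum_le_sum fun i _ => mul_le_mul_of_nonneg_left ?_ (h0 i))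
  rw [← Real.dist_eq]
  exact dist_le_pi_dist x y i

theorem abs_le_of_coordinatewise (hz : ∀ x, x ∉ openCube d → c x = 0) {i : Fin d} {C : ℝ}
    (hC : 0 ≤ C) (hL : ∀ x t, |c (Function.update x i t) - c x| ≤ C * |t - x i|)
    (x : Fin d → ℝ) : |c x| ≤ C := by
  by_cases hx : x ∈ openCube d
  · have hface : c (Function.update x i 0) = 0 := hz _ fun hm => by simpa using (hm i).1
    have hle := hL x 0
    rw [hface, zero_sub, abs_neg, zero_sub, abs_neg, abs_of_pos (hx i).1] at hle
    exact hle.trans (mul_le_of_le_one_right hC (hx i).2.le)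
  · rwa [hz x hx, abs_zero]

theorem add_smul_single (x : Fin d → ℝ) (i : Fin d) (t : ℝ) :
    x + t • (Pi.single i 1 : Fin d → ℝ) = Function.update x i (x i + t) := by
  ext j
  rcases eq_or_ne j i with rfl | h
  · simp
  · simp [h]

theorem abs_lineDeriv_single_le {i : Fin d} {x : Fin d → ℝ} {C : ℝ} (hC : 0 ≤ C)
    (hL : ∀ t, |c (Function.update x i t) - c x| ≤ C * |t - x i|) :
    |lineDeriv ℝ c x (Pi.single i 1)| ≤ C := by
  rw [← Real.norm_eq_abs, lineDeriv]
  refine norm_deriv_le_of_lip' hC (Filter.Eventually.of_forall fun t => ?_)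
  simp only [add_smul_single, zero_smul, add_zero, sub_zero]
  simpa using hL (x i + t)

theorem deriv_eq_zero_of_eqOn_zero {g : ℝ → ℝ} {t : ℝ} {S : Set ℝ}
    (hS : UniqueDiffWithinAt ℝ S t) (ht : t ∈ S) (hg : ∀ s ∈ S, g s = 0) : deriv g t = 0 := by
  by_cases hd : DifferentiableAt ℝ g t
  · rw [← hd.derivWithin hS, derivWithin_congr (f := fun _ => (0 : ℝ)) hg (hg t ht)]
    simp
  · exact deriv_zero_of_not_differentiableAt hd

-- At a boundary point `c` vanishes on a half-line only, which still determines the derivative.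
theorem lineDeriv_eq_zero_of_notMem (hz : ∀ x, x ∉ openCube d → c x = 0) {x : Fin d → ℝ}
    (hx : x ∉ openCube d) (i : Fin d) : lineDeriv ℝ c x (Pi.single i 1) = 0 := by
  rw [lineDeriv]
  rcases le_or_gt (x i) 0 with hnonpos | hpos
  · refine deriv_eq_zero_of_eqOn_zero (uniqueDiffOn_Iic 0 0 self_mem_Iic) self_mem_Iic
      fun t (ht : t ≤ 0) => hz _ fun hm => ?_
    have hti := (hm i).1
    rw [add_smul_single, Function.update_self] at hti
    linarith
  rcases le_or_gt 1 (x i) with hone | hlt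
  · refine deriv_eq_zero_of_eqOn_zero (uniqueDiffOn_Ici 0 0 self_mem_Ici) self_mem_Ici
      fun t (ht : 0 ≤ t) => hz _ fun hm => ?_
    have hti := (hm i).2
    rw [add_smul_single, Function.update_self] at hti
    linarith
  · refine deriv_eq_zero_of_eqOn_zero uniqueDiffWithinAt_univ (mem_univ _)
      fun t _ => hz _ fun hm => hx fun j => ?_
    rcases eq_or_ne j i with rfl | hj
    · exact ⟨hpos, hlt⟩
    · have htj := hm j
      rwa [add_smul_single, Function.update_of_ne hj] at htj

theorem lineDeriv_neg_single {φ : (Fin d → ℝ) → ℝ} (hφ : Differentiable ℝ φ) (i : Fin d)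
    (x : Fin d → ℝ) : lineDeriv ℝ φ x (-Pi.single i 1) = -partialDeriv i φ x := by
  rw [(hφ x).lineDeriv_eq_fderiv, map_neg, partialDeriv]

theorem integral_mul_partialDeriv_add {K : NNReal} (hc : LipschitzWith K c)
    (hz : ∀ x, x ∉ openCube d → c x = 0) {φ : (Fin d → ℝ) → ℝ} (hφ : ContDiff ℝ 1 φ)
    (hcs : HasCompactSupport φ) (i : Fin d) :
    (∫ x in openCube d, c x * partialDeriv i φ x) +
      ∫ x in openCube d, lineDeriv ℝ c x (Pi.single i 1) * φ x = 0 := by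
  obtain ⟨D, hD⟩ := hφ.lipschitzWith_of_hasCompactSupport hcs (by simp)
  have hparts := hc.integral_lineDeriv_mul_eq hD hcs (Pi.single i 1) (μ := volume)
  rw [setIntegral_eq_integral_of_forall_compl_eq_zero fun x hx => by rw [hz x hx, zero_mul],
    setIntegral_eq_integral_of_forall_compl_eq_zero fun x hx => by
      rw [lineDeriv_eq_zero_of_notMem hz hx, zero_mul], hparts]
  simp only [lineDeriv_neg_single (hφ.differentiable (by simp)), neg_mul, integral_neg,
    mul_comm (c _)]
  ring

end Coordinatewise

theorem hasCompactSupport_partialDeriv {d : ℕ} {φ : (Fin d → ℝ) → ℝ} (hφ : HasCompactSupport φ)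
    (i : Fin d) : HasCompactSupport (partialDeriv i φ) :=
  (hφ.fderiv (𝕜 := ℝ)).mono' fun x hx => subset_tsupport _ fun h => hx (by simp [partialDeriv, h])

theorem continuous_partialDeriv {d : ℕ} {φ : (Fin d → ℝ) → ℝ} (hφ : ContDiff ℝ 1 φ) (i : Fin d) :
    Continuous (partialDeriv i φ) :=
  (hφ.continuous_fderiv (by simp)).clm_apply continuous_const

theorem gradNorm_le {d : ℕ} (hd : 1 ≤ d) {p : ℝ≥0∞} (hp : 1 ≤ p) {G : Fin d → (Fin d → ℝ) → ℝ}
    {E : ℝ≥0∞} (hG : ∀ i, eLpNorm (G i) p (volume.restrict (unitCube d)) ≤ E) :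
    gradNorm p G ≤ d * E := by
  have hd' : (1 : ℝ≥0∞) ≤ d := by exact_mod_cast hd
  rw [gradNorm]
  split_ifs with htop
  · subst htop
    refine iSup_le fun i => ?_
    have hGi := hG i
    rw [eLpNorm_exponent_top, eLpNormEssSup] at hGi
    exact hGi.trans (le_mul_of_one_le_left zero_le hd')
  · have hp0 : p ≠ 0 := (zero_lt_one.trans_le hp).ne'
    have hpr : 1 ≤ p.toReal := by
      rw [← ENNReal.toReal_one]
      exact ENNReal.toReal_mono htop hp
    have hpos : 0 < p.toReal := by linarith
    have hintegral (i) : ∫⁻ x in unitCube d, ‖G i x‖ₑ ^ p.toReal ≤ E ^ p.toReal := by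
      have hGi := hG i
      rwa [eLpNorm_eq_lintegral_rpow_enorm_toReal hp0 htop, one_div,
        ENNReal.rpow_inv_le_iff hpos] at hGi
    calc (∑ i, ∫⁻ x in unitCube d, ‖G i x‖ₑ ^ p.toReal) ^ (1 / p.toReal)
        ≤ ((d : ℝ≥0∞) * E ^ p.toReal) ^ (1 / p.toReal) := by
          gcongr
          refine (Finset.sum_le_sum fun i _ => hintegral i).trans ?_
          simp
      _ = (d : ℝ≥0∞) ^ (1 / p.toReal) * E := by
          rw [ENNReal.mul_rpow_of_nonneg _ _ (by positivity), ← ENNReal.rpow_mul,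
            mul_one_div_cancel hpos.ne', ENNReal.rpow_one]
      _ ≤ (d : ℝ≥0∞) ^ (1 : ℝ) * E := by
          gcongr
          rwa [div_le_one hpos]
      _ = d * E := by rw [ENNReal.rpow_one]

section Series

variable {d : ℕ} {ι : Type*} [Countable ι] {c : ι → (Fin d → ℝ) → ℝ} {C : ι → Fin d → ℝ}
  (h0 : ∀ k i, 0 ≤ C k i)
  (hL : ∀ k i x t, |c k (Function.update x i t) - c k x| ≤ C k i * |t - x i|)
  (hz : ∀ k x, x ∉ openCube d → c k x = 0) (hC : ∀ i, Summable fun k => C k i)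
  {g : (Fin d → ℝ) → ℝ} (hg : ∀ x ∈ openCube d, HasSum (fun k => c k x) (g x))

include h0 hL

theorem memLp_tsum_lineDeriv (hC : ∀ i, Summable fun k => C k i) (p : ℝ≥0∞) (i : Fin d) :
    MemLp (fun x => ∑' k, lineDeriv ℝ (c k) x (Pi.single i 1)) p
      (volume.restrict (openCube d)) :=
  memLp_tsum_of_abs_le
    (fun k => measurable_lineDeriv (lipschitzWith_of_coordinatewise (h0 k) (hL k)).continuous)
    (fun k x => abs_lineDeriv_single_le (h0 k i) (hL k i x)) (hC i) p

include hz hC hg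

theorem memLp_of_hasSum (hd : 1 ≤ d) (p : ℝ≥0∞) : MemLp g p (volume.restrict (openCube d)) := by
  refine MemLp.ae_eq ?_ (memLp_tsum_of_abs_le
    (fun k => (lipschitzWith_of_coordinatewise (h0 k) (hL k)).continuous.measurable)
    (fun k => abs_le_of_coordinatewise (hz k) (h0 k ⟨0, hd⟩) (hL k ⟨0, hd⟩)) (hC _) p)
  filter_upwards [ae_restrict_mem (isOpen_openCube d).measurableSet] with x hx
  exact (hg x hx).tsum_eq

theorem hasZeroTrace_of_hasSum :
    HasZeroTrace g fun i x => ∑' k, lineDeriv ℝ (c k) x (Pi.single i 1) := by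
  intro i φ hφ hφc
  have hlip := fun k => lipschitzWith_of_coordinatewise (h0 k) (hL k)
  have hφ1 : ContDiff ℝ 1 φ := hφ.of_le (by simp)
  have hpartial : Integrable (partialDeriv i φ) (volume.restrict (openCube d)) :=
    ((continuous_partialDeriv hφ1 i).integrable_of_hasCompactSupport
      (hasCompactSupport_partialDeriv hφc i)).integrableOn
  have hφint : Integrable φ (volume.restrict (openCube d)) :=
    (hφ.continuous.integrable_of_hasCompactSupport hφc).integrableOn
  have hsum := (hasSum_integral_mul_of_abs_le (fun k => (hlip k).continuous.measurable)
      (fun k => abs_le_of_coordinatewise (hz k) (h0 k i) (hL k i)) (hC i) hpartial).add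
    (hasSum_integral_mul_of_abs_le (fun k => measurable_lineDeriv (hlip k).continuous)
      (fun k x => abs_lineDeriv_single_le (h0 k i) (hL k i x)) (hC i) hφint)
  simp only [integral_mul_partialDeriv_add (hlip _) (hz _) hφ1 hφc i] at hsum
  rw [setIntegral_congr_fun (isOpen_openCube d).measurableSet
    fun x hx => congrArg (· * partialDeriv i φ x) (hg x hx).tsum_eq.symm]
  exact hsum.unique hasSum_zero

theorem isWeakGradient_of_hasSum (hd : 1 ≤ d) :
    IsWeakGradient g fun i x => ∑' k, lineDeriv ℝ (c k) x (Pi.single i 1) :=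
  ⟨IntegrableOn.locallyIntegrableOn
      (memLp_one_iff_integrable.1 (memLp_of_hasSum h0 hL hz hC hg hd 1)),
    fun i => ⟨IntegrableOn.locallyIntegrableOn
        (memLp_one_iff_integrable.1 (memLp_tsum_lineDeriv h0 hL hC 1 i)),
      fun φ hφ hφc _ =>
        eq_neg_of_add_eq_zero_left (hasZeroTrace_of_hasSum h0 hL hz hC hg i φ hφ hφc)⟩⟩

theorem memSobolevZero_of_hasSum (hd : 1 ≤ d) (p : ℝ≥0∞) : MemSobolevZero p g := by
  rw [MemSobolevZero, restrict_unitCube]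
  exact ⟨memLp_of_hasSum h0 hL hz hC hg hd p, _, isWeakGradient_of_hasSum h0 hL hz hC hg hd,
    memLp_tsum_lineDeriv h0 hL hC p, hasZeroTrace_of_hasSum h0 hL hz hC hg⟩

theorem sobolevNorm_le_of_hasSum (hd : 1 ≤ d) {p : ℝ≥0∞} (hp : 1 ≤ p) {E : ℝ≥0∞}
    (hE : ∀ i, ∑' k, eLpNorm (fun x => lineDeriv ℝ (c k) x (Pi.single i 1)) p
      (volume.restrict (unitCube d)) ≤ E) :
    sobolevNorm p g ≤ d * E := by
  refine (iInf₂_le _ (isWeakGradient_of_hasSum h0 hL hz hC hg hd)).trans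
    (gradNorm_le hd hp fun i => (eLpNorm_tsum_le hp (fun k => ?_) fun x => ?_).trans (hE i))
  · exact (measurable_lineDeriv
      (lipschitzWith_of_coordinatewise (h0 k) (hL k)).continuous).aestronglyMeasurable
  · exact Summable.of_norm_bounded (hC i) fun k => abs_lineDeriv_single_le (h0 k i) (hL k i x)

end Series

/-! ### Lipschitz estimates for the levels of the Faber series -/

theorem hat_eq_max_min (t : ℝ) : hat t = max 0 (min t (2 - t)) := by
  rcases le_total t 0 with hneg | hpos
  · rw [hat_of_le_zero hneg, max_eq_left ((min_le_left _ _).trans hneg)]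
  rcases le_total t 1 with hleft | hright
  · rw [hat_of_mem_left hpos hleft, min_eq_left (by linarith), max_eq_right hpos]
  rcases le_total t 2 with hle | hge
  · rw [hat_of_mem_right hright hle, min_eq_right (by linarith), max_eq_right (by linarith)]
  · rw [hat_of_ge_two hge, max_eq_left ((min_le_right _ _).trans (by linarith))]

theorem abs_hat_sub_le (a b : ℝ) : |hat a - hat b| ≤ |a - b| := by
  rw [hat_eq_max_min, hat_eq_max_min]
  calc |max 0 (min a (2 - a)) - max 0 (min b (2 - b))| ≤ |min a (2 - a) - min b (2 - b)| := by
        simpa using abs_max_sub_max_le_max (0 : ℝ) (min a (2 - a)) 0 (min b (2 - b))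
    _ ≤ max |a - b| |(2 - a) - (2 - b)| := abs_min_sub_min_le_max _ _ _ _
    _ = |a - b| := by rw [sub_sub_sub_cancel_left, abs_sub_comm b a, max_self]

theorem abs_hat_scaled_sub_le (k s : ℕ) (t y : ℝ) :
    |hat (2 ^ (k + 1) * t - 2 * s) - hat (2 ^ (k + 1) * y - 2 * s)| ≤ 2 ^ (k + 1) * |t - y| := by
  refine (abs_hat_sub_le _ _).trans (le_of_eq ?_)
  rw [sub_sub_sub_cancel_right, ← mul_sub, abs_mul, abs_of_pos (by positivity)]

theorem sum_abs_sub_le_two_mul {σ : Type*} (S : Finset σ) {F F' : σ → ℝ} (a b : σ)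
    (hF : ∀ s, s ≠ a → F s = 0) (hF' : ∀ s, s ≠ b → F' s = 0) {B : ℝ} (hB : 0 ≤ B)
    (h : ∀ s ∈ S, |F' s - F s| ≤ B) : ∑ s ∈ S, |F' s - F s| ≤ 2 * B := by
  classical
  set T := S.filter (· ∈ ({a, b} : Finset σ)) with hT
  have hrestrict : ∑ s ∈ T, |F' s - F s| = ∑ s ∈ S, |F' s - F s| := by
    refine Finset.sum_subset (Finset.filter_subset _ _) fun s hs hn => ?_
    simp only [hT, Finset.mem_filter, hs, true_and, Finset.mem_insert, Finset.mem_singleton,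
      not_or] at hn
    rw [hF s hn.1, hF' s hn.2, sub_zero, abs_zero]
  have hcard : T.card ≤ 2 :=
    (Finset.card_le_card fun s hs => (Finset.mem_filter.1 hs).2).trans Finset.card_le_two
  calc ∑ s ∈ S, |F' s - F s| = ∑ s ∈ T, |F' s - F s| := hrestrict.symm
    _ ≤ T.card • B := Finset.sum_le_card_nsmul _ _ _ fun s hs => h s (Finset.mem_filter.1 hs).1
    _ ≤ 2 • B := nsmul_le_nsmul_left hB hcard
    _ = 2 * B := two_nsmul B |>.trans (two_mul B).symm

theorem abs_sum_mul_le {σ : Type*} {S : Finset σ} {a : σ → ℝ} {Λ : ℝ} (ha : ∀ s ∈ S, |a s| ≤ Λ)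
    (F : σ → ℝ) : |∑ s ∈ S, a s * F s| ≤ Λ * ∑ s ∈ S, |F s| := by
  rw [Finset.mul_sum]
  refine (Finset.abs_sum_le_sum_abs _ _).trans (Finset.sum_le_sum fun s hs => ?_)
  rw [abs_mul]
  exact mul_le_mul_of_nonneg_right (ha s hs) (abs_nonneg _)

theorem prod_update_apply {ι κ M : Type*} [Fintype ι] [DecidableEq ι] [CommMonoid M]
    (F : ι → κ → M) (i : ι) (g : κ → M) (s : ι → κ) :
    ∏ j, Function.update F i g j (s j) = g (s i) * ∏ j ∈ Finset.univ.erase i, F j (s j) := by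
  rw [← Finset.mul_prod_erase _ _ (Finset.mem_univ i), Function.update_self]
  congr 1
  exact Finset.prod_congr rfl fun j hj => by rw [Function.update_of_ne (Finset.ne_of_mem_erase hj)]

theorem sum_piFinset_mul_prod_erase {ι κ R : Type*} [Fintype ι] [DecidableEq ι] [CommSemiring R]
    (T : ι → Finset κ) (F : ι → κ → R) (i : ι) (g : κ → R) :
    ∑ s ∈ Fintype.piFinset T, g (s i) * ∏ j ∈ Finset.univ.erase i, F j (s j) =
      (∑ n ∈ T i, g n) * ∏ j ∈ Finset.univ.erase i, ∑ n ∈ T j, F j n := by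
  simp only [← prod_update_apply]
  rw [← Finset.prod_univ_sum T (Function.update F i g),
    ← Finset.mul_prod_erase _ _ (Finset.mem_univ i), Function.update_self]
  congr 1
  exact Finset.prod_congr rfl fun j hj => by rw [Function.update_of_ne (Finset.ne_of_mem_erase hj)]

/-- The sum of the univariate hats of level `k`. -/
def hatSum (k : ℕ) (y : ℝ) : ℝ := ∑ s ∈ Finset.range (2 ^ k), hat (2 ^ (k + 1) * y - 2 * s)

theorem hatSum_nonneg (k : ℕ) (y : ℝ) : 0 ≤ hatSum k y :=
  Finset.sum_nonneg fun _ _ => (hat_mem _).1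

theorem hatSum_eq (k : ℕ) (y : ℝ) : hatSum k y =
    if ⌊2 ^ k * y⌋₊ ∈ Finset.range (2 ^ k) then
      hat (2 ^ (k + 1) * y - 2 * (⌊2 ^ k * y⌋₊ : ℕ)) else 0 := by
  rw [hatSum]
  split_ifs with hmem
  · exact Finset.sum_eq_single_of_mem _ hmem fun s _ hs => hat_eq_zero_of_ne_floor hs
  · exact Finset.sum_eq_zero fun s hs =>
      hat_eq_zero_of_ne_floor fun heq => hmem (heq ▸ hs)

theorem hatSum_le_one (k : ℕ) (y : ℝ) : hatSum k y ≤ 1 := by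
  rw [hatSum_eq]
  split_ifs
  · exact (hat_mem _).2
  · exact zero_le_one

/-- The product of the `hatSum (k j)` in the variables `j ≠ i`, which dominates the `i`-th partial
derivative of the level `k` of the Faber series. -/
def hatSumProd {d : ℕ} (k : Fin d → ℕ) (i : Fin d) (x : Fin d → ℝ) : ℝ :=
  ∏ j ∈ Finset.univ.erase i, hatSum (k j) (x j)

theorem hatSumProd_nonneg {d : ℕ} (k : Fin d → ℕ) (i : Fin d) (x : Fin d → ℝ) :
    0 ≤ hatSumProd k i x :=
  Finset.prod_nonneg fun _ _ => hatSum_nonneg _ _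

theorem hatSumProd_le_one {d : ℕ} (k : Fin d → ℕ) (i : Fin d) (x : Fin d → ℝ) :
    hatSumProd k i x ≤ 1 :=
  Finset.prod_le_one (fun _ _ => hatSum_nonneg _ _) fun _ _ => hatSum_le_one _ _

theorem sum_abs_hat_sub_le (k : ℕ) (t y : ℝ) :
    ∑ s ∈ Finset.range (2 ^ k), |hat (2 ^ (k + 1) * t - 2 * s) - hat (2 ^ (k + 1) * y - 2 * s)| ≤
      2 * (2 ^ (k + 1) * |t - y|) :=
  sum_abs_sub_le_two_mul _ ⌊2 ^ k * y⌋₊ ⌊2 ^ k * t⌋₊ (fun _ hs => hat_eq_zero_of_ne_floor hs)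
    (fun _ hs => hat_eq_zero_of_ne_floor hs) (by positivity)
    fun s _ => abs_hat_scaled_sub_le k s t y

theorem abs_tensorHat_update_sub {d : ℕ} (k s : Fin d → ℕ) (x : Fin d → ℝ) (i : Fin d) (t : ℝ) :
    |tensorHat k s (Function.update x i t) - tensorHat k s x| =
      |hat (2 ^ (k i + 1) * t - 2 * s i) - hat (2 ^ (k i + 1) * x i - 2 * s i)| *
        ∏ j ∈ Finset.univ.erase i, hat (2 ^ (k j + 1) * x j - 2 * s j) := by
  have hupdate : tensorHat k s (Function.update x i t) = hat (2 ^ (k i + 1) * t - 2 * s i) *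
      ∏ j ∈ Finset.univ.erase i, hat (2 ^ (k j + 1) * x j - 2 * s j) := by
    rw [tensorHat, ← Finset.mul_prod_erase _ _ (Finset.mem_univ i), Function.update_self]
    congr 1
    exact Finset.prod_congr rfl fun j hj => by
      rw [Function.update_of_ne (Finset.ne_of_mem_erase hj)]
  rw [hupdate, tensorHat, ← Finset.mul_prod_erase _ _ (Finset.mem_univ i), ← sub_mul, abs_mul,
    abs_of_nonneg (Finset.prod_nonneg fun j _ => (hat_mem _).1)]

theorem abs_faberLevel_update_sub_le {d : ℕ} {f : (Fin d → ℝ) → ℝ} {k : Fin d → ℕ} {Λ : ℝ}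
    (hΛ : ∀ s ∈ positions k, |faberCoeff f k s| ≤ Λ) (hΛ0 : 0 ≤ Λ) (i : Fin d) (x : Fin d → ℝ)
    (t : ℝ) :
    |faberLevel f k (Function.update x i t) - faberLevel f k x| ≤
      Λ * (4 * 2 ^ k i) * hatSumProd k i x * |t - x i| := by
  calc |faberLevel f k (Function.update x i t) - faberLevel f k x|
      ≤ Λ * ∑ s ∈ positions k, |tensorHat k s (Function.update x i t) - tensorHat k s x| := by
        rw [faberLevel, faberLevel, ← Finset.sum_sub_distrib]
        simp only [← mul_sub]
        exact abs_sum_mul_le hΛ _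
    _ = Λ * ((∑ s ∈ Finset.range (2 ^ k i),
          |hat (2 ^ (k i + 1) * t - 2 * s) - hat (2 ^ (k i + 1) * x i - 2 * s)|) *
            hatSumProd k i x) := by
        simp only [abs_tensorHat_update_sub, positions, hatSumProd, hatSum]
        rw [sum_piFinset_mul_prod_erase _
          (fun j (n : ℕ) => hat (2 ^ (k j + 1) * x j - 2 * n)) i
          fun n : ℕ => |hat (2 ^ (k i + 1) * t - 2 * n) - hat (2 ^ (k i + 1) * x i - 2 * n)|]
    _ ≤ Λ * ((2 * (2 ^ (k i + 1) * |t - x i|)) * hatSumProd k i x) :=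
        mul_le_mul_of_nonneg_left (mul_le_mul_of_nonneg_right (sum_abs_hat_sub_le _ _ _)
          (hatSumProd_nonneg k i x)) hΛ0
    _ = Λ * (4 * 2 ^ k i) * hatSumProd k i x * |t - x i| := by ring

theorem hat_scaled_eq_zero {k s : ℕ} (hs : s < 2 ^ k) {y : ℝ} (hy : ¬ (0 < y ∧ y < 1)) :
    hat (2 ^ (k + 1) * y - 2 * s) = 0 := by
  rcases le_or_gt y 0 with hnonpos | hpos
  · have : (2 : ℝ) ^ (k + 1) * y ≤ 0 := mul_nonpos_of_nonneg_of_nonpos (by positivity) hnonpos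
    exact hat_of_le_zero (by linarith [s.cast_nonneg (α := ℝ)])
  · have hone : 1 ≤ y := not_lt.1 fun hlt => hy ⟨hpos, hlt⟩
    have hs' : (s : ℝ) + 1 ≤ 2 ^ k := by exact_mod_cast hs
    have hscaled : (2 : ℝ) ^ (k + 1) * 1 ≤ 2 ^ (k + 1) * y := by gcongr
    rw [pow_succ] at hscaled ⊢
    exact hat_of_ge_two (by linarith)

/-! ### The levels of the approximate Faber series -/

/-- The part of level `k` of the Faber series, with approximate products. -/
def approxLevel {d : ℕ} (J R : ℕ) (f : (Fin d → ℝ) → ℝ) (k : Fin d → ℕ) (x : Fin d → ℝ) : ℝ :=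
  ∑ s ∈ positions k, faberCoeff f k s * treeApprox R (hatVec k s x) J 0

/-- The error of the approximate product of the univariate hats of level `k` and position `s`. -/
def tensorHatError {d : ℕ} (J R : ℕ) (k s : Fin d → ℕ) (x : Fin d → ℝ) : ℝ :=
  treeApprox R (hatVec k s x) J 0 - tensorHat k s x

theorem approxLevel_sub_faberLevel {d : ℕ} (J R : ℕ) (f : (Fin d → ℝ) → ℝ) (k : Fin d → ℕ)
    (x : Fin d → ℝ) :
    approxLevel J R f k x - faberLevel f k x =
      ∑ s ∈ positions k, faberCoeff f k s * tensorHatError J R k s x := by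
  simp only [approxLevel, faberLevel, tensorHatError, mul_sub, Finset.sum_sub_distrib]

theorem blockProd_hatVec {d J : ℕ} (hJ : d ≤ 2 ^ J) (k s : Fin d → ℕ) (x : Fin d → ℝ) :
    blockProd (hatVec k s x) J 0 = tensorHat k s x := by
  rw [blockProd, tensorHat, zero_mul, zero_add, one_mul, Nat.Ico_zero_eq_range,
    ← Finset.prod_subset (Finset.range_mono hJ), Finset.prod_range]
  · exact Finset.prod_congr rfl fun i _ => by simp [hatVec]
  · intro b _ hb
    rw [Finset.mem_range] at hb
    simp [hatVec, hb]

theorem hatVec_val {d : ℕ} (k s : Fin d → ℕ) (x : Fin d → ℝ) (i : Fin d) :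
    hatVec k s x i = hat (2 ^ (k i + 1) * x i - 2 * s i) := by
  simp [hatVec]

theorem hatVec_update {d : ℕ} (k s : Fin d → ℕ) (x : Fin d → ℝ) (i : Fin d) (t : ℝ) :
    hatVec k s (Function.update x i t) =
      Function.update (hatVec k s x) i (hat (2 ^ (k i + 1) * t - 2 * s i)) := by
  ext b
  rcases eq_or_ne b (i : ℕ) with rfl | h
  · simp [hatVec]
  · rw [Function.update_of_ne h, hatVec, hatVec]
    split_ifs with hb
    · rw [Function.update_of_ne fun e => h (congrArg Fin.val e)]
    · rfl

theorem treeApprox_hatVec_eq_zero {d J : ℕ} (hJ : d ≤ 2 ^ J) (R : ℕ) {k s : Fin d → ℕ}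
    {x : Fin d → ℝ} {i : Fin d} (h : hat (2 ^ (k i + 1) * x i - 2 * s i) = 0) :
    treeApprox R (hatVec k s x) J 0 = 0 :=
  treeApprox_eq_zero R J 0 (b := i) (by simp) (by have := i.2; omega) (by rwa [hatVec_val])

theorem tensorHatError_eq_zero {d J : ℕ} (hJ : d ≤ 2 ^ J) (R : ℕ) {k s : Fin d → ℕ}
    {x : Fin d → ℝ} (hs : s ≠ fun i => ⌊2 ^ k i * x i⌋₊) : tensorHatError J R k s x = 0 := by
  obtain ⟨j, hj⟩ := Function.ne_iff.1 hs
  rw [tensorHatError, tensorHat_eq_zero hs,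
    treeApprox_hatVec_eq_zero hJ R (hat_eq_zero_of_ne_floor hj), sub_zero]

theorem abs_tensorHatError_update_sub_le {d J R : ℕ} (hJ : d ≤ 2 ^ J) (hR : 1 ≤ R)
    (k s : Fin d → ℕ) (i : Fin d) (x : Fin d → ℝ) (t : ℝ) :
    |tensorHatError J R k s (Function.update x i t) - tensorHatError J R k s x| ≤
      4 ^ J * (2 * (2 ^ R)⁻¹) * (2 ^ (k i + 1) * |t - x i|) := by
  rw [tensorHatError, tensorHatError, ← blockProd_hatVec hJ, ← blockProd_hatVec hJ, hatVec_update]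
  refine (abs_treeApprox_error_sub_le hR i (hatVec_mem k s x) (hat_mem _) J 0).trans ?_
  rw [hatVec_val]
  gcongr
  exact abs_hat_scaled_sub_le _ _ _ _

theorem abs_levelError_update_sub_le {d J R : ℕ} (hJ : d ≤ 2 ^ J) (hR : 1 ≤ R)
    {f : (Fin d → ℝ) → ℝ} {k : Fin d → ℕ} {Λ : ℝ}
    (hΛ : ∀ s ∈ positions k, |faberCoeff f k s| ≤ Λ) (hΛ0 : 0 ≤ Λ) (i : Fin d) (x : Fin d → ℝ)
    (t : ℝ) :
    |(approxLevel J R f k (Function.update x i t) - faberLevel f k (Function.update x i t)) -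
      (approxLevel J R f k x - faberLevel f k x)| ≤
      Λ * (4 * 2 ^ k i) * (4 ^ J * (2 * (2 ^ R)⁻¹)) * |t - x i| := by
  rw [approxLevel_sub_faberLevel, approxLevel_sub_faberLevel, ← Finset.sum_sub_distrib]
  simp only [← mul_sub]
  calc |∑ s ∈ positions k, faberCoeff f k s *
        (tensorHatError J R k s (Function.update x i t) - tensorHatError J R k s x)|
      ≤ Λ * ∑ s ∈ positions k,
          |tensorHatError J R k s (Function.update x i t) - tensorHatError J R k s x| :=
        abs_sum_mul_le hΛ _
    _ ≤ Λ * (2 * (4 ^ J * (2 * (2 ^ R)⁻¹) * (2 ^ (k i + 1) * |t - x i|))) :=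
        mul_le_mul_of_nonneg_left (sum_abs_sub_le_two_mul _ _ _
          (fun _ => tensorHatError_eq_zero hJ R) (fun _ => tensorHatError_eq_zero hJ R)
          (by positivity) fun s _ => abs_tensorHatError_update_sub_le hJ hR k s i x t) hΛ0
    _ = Λ * (4 * 2 ^ k i) * (4 ^ J * (2 * (2 ^ R)⁻¹)) * |t - x i| := by ring

theorem exists_hat_eq_zero_of_notMem_openCube {d : ℕ} (k : Fin d → ℕ) {x : Fin d → ℝ}
    (hx : x ∉ openCube d) :
    ∃ i, ∀ s ∈ positions k, hat (2 ^ (k i + 1) * x i - 2 * s i) = 0 := by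
  simp only [openCube, mem_ofPred_eq, not_forall] at hx
  obtain ⟨i, hi⟩ := hx
  exact ⟨i, fun s hs => hat_scaled_eq_zero (Finset.mem_range.1 (Fintype.mem_piFinset.1 hs i)) hi⟩

theorem faberLevel_eq_zero {d : ℕ} (f : (Fin d → ℝ) → ℝ) (k : Fin d → ℕ) {x : Fin d → ℝ}
    (hx : x ∉ openCube d) : faberLevel f k x = 0 := by
  obtain ⟨i, hi⟩ := exists_hat_eq_zero_of_notMem_openCube k hx
  refine Finset.sum_eq_zero fun s hs => ?_
  rw [tensorHat, Finset.prod_eq_zero (Finset.mem_univ i) (hi s hs), mul_zero]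

theorem approxLevel_eq_zero {d J : ℕ} (hJ : d ≤ 2 ^ J) (R : ℕ) (f : (Fin d → ℝ) → ℝ)
    (k : Fin d → ℕ) {x : Fin d → ℝ} (hx : x ∉ openCube d) : approxLevel J R f k x = 0 := by
  obtain ⟨i, hi⟩ := exists_hat_eq_zero_of_notMem_openCube k hx
  refine Finset.sum_eq_zero fun s hs => ?_
  rw [treeApprox_hatVec_eq_zero hJ R (hi s hs), mul_zero]

/-! ### The `L_p` norm of a tensor product of hats -/

theorem continuous_hat : Continuous hat := by
  unfold hat
  fun_prop

theorem continuous_hatSum (k : ℕ) : Continuous (hatSum k) := by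
  unfold hatSum
  exact continuous_finsetSum _ fun s _ => continuous_hat.comp (by fun_prop)

theorem continuous_hatSumProd {d : ℕ} (k : Fin d → ℕ) (i : Fin d) :
    Continuous (hatSumProd k i) :=
  continuous_finsetProd _ fun j _ => (continuous_hatSum _).comp (continuous_apply j)

theorem support_hat_rpow_subset {p : ℝ} (hp : p ≠ 0) :
    (Function.support fun t => hat t ^ p) ⊆ Ioc 0 2 := by
  intro t ht
  refine ⟨lt_of_not_ge fun hle => ht ?_, le_of_not_gt fun hlt => ht ?_⟩
  · simp only [hat_of_le_zero hle, Real.zero_rpow hp]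
  · simp only [hat_of_ge_two hlt.le, Real.zero_rpow hp]

section RpowIntegral

variable {p : ℝ} (hp : 0 < p)

include hp

theorem continuous_hat_rpow : Continuous fun t => hat t ^ p :=
  continuous_hat.rpow_const fun _ => Or.inr hp.le

theorem integral_hat_rpow {a b : ℝ} (ha : a ≤ 0) (hb : 2 ≤ b) :
    ∫ t in a..b, hat t ^ p = 2 / (p + 1) := by
  have hleft : ∫ t in (0 : ℝ)..1, hat t ^ p = 1 / (p + 1) := by
    rw [intervalIntegral.integral_congr (g := fun t => t ^ p), integral_rpow (Or.inl (by linarith))]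
    · simp [Real.zero_rpow (by linarith : p + 1 ≠ 0)]
    · intro t ht
      rw [uIcc_of_le zero_le_one] at ht
      simp only [hat_of_mem_left ht.1 ht.2]
  have hright : ∫ t in (1 : ℝ)..2, hat t ^ p = 1 / (p + 1) := by
    rw [intervalIntegral.integral_congr (g := fun t => (2 - t) ^ p),
      intervalIntegral.integral_comp_sub_left (fun t => t ^ p),
      integral_rpow (Or.inl (by linarith))]
    · norm_num [Real.zero_rpow (by linarith : p + 1 ≠ 0)]
    · intro t ht
      rw [uIcc_of_le one_le_two] at ht
      simp only [hat_of_mem_right ht.1 ht.2]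
  have hsupp := support_hat_rpow_subset hp.ne'
  rw [intervalIntegral.integral_eq_integral_of_support_subset
      (hsupp.trans (Ioc_subset_Ioc ha hb)),
    ← intervalIntegral.integral_eq_integral_of_support_subset hsupp,
    ← intervalIntegral.integral_add_adjacent_intervals (b := 1)
      ((continuous_hat_rpow hp).intervalIntegrable _ _)
      ((continuous_hat_rpow hp).intervalIntegrable _ _), hleft, hright]
  ring

theorem integral_hat_scaled_rpow {k s : ℕ} (hs : s < 2 ^ k) :
    ∫ y in (0 : ℝ)..1, hat (2 ^ (k + 1) * y - 2 * s) ^ p = (2 ^ (k + 1))⁻¹ * (2 / (p + 1)) := by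
  have hs' : (s : ℝ) + 1 ≤ 2 ^ k := by exact_mod_cast hs
  rw [intervalIntegral.integral_comp_mul_sub (fun t => hat t ^ p) (by positivity), smul_eq_mul,
    integral_hat_rpow hp (by simp) (by rw [pow_succ]; linarith)]

theorem hatSum_rpow (k : ℕ) (y : ℝ) :
    hatSum k y ^ p = ∑ s ∈ Finset.range (2 ^ k), hat (2 ^ (k + 1) * y - 2 * s) ^ p := by
  have hzero {s : ℕ} (hs : s ≠ ⌊2 ^ k * y⌋₊) : hat (2 ^ (k + 1) * y - 2 * s) ^ p = 0 := by
    rw [hat_eq_zero_of_ne_floor hs, Real.zero_rpow hp.ne']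
  rw [hatSum_eq]
  split_ifs with hmem
  · exact (Finset.sum_eq_single_of_mem _ hmem fun s _ => hzero).symm
  · rw [Real.zero_rpow hp.ne']
    exact (Finset.sum_eq_zero fun s hs => hzero fun heq => hmem (heq ▸ hs)).symm

theorem integral_hatSum_rpow (k : ℕ) : ∫ y in Icc (0 : ℝ) 1, hatSum k y ^ p = 1 / (p + 1) := by
  have hint (s : ℕ) : IntervalIntegrable
      (fun y : ℝ => hat (2 ^ (k + 1) * y - 2 * s) ^ p) volume 0 1 :=
    ((continuous_hat_rpow hp).comp
      (by fun_prop : Continuous fun y : ℝ => 2 ^ (k + 1) * y - 2 * s)).intervalIntegrable _ _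
  rw [integral_Icc_eq_integral_Ioc, ← intervalIntegral.integral_of_le zero_le_one]
  simp only [hatSum_rpow hp]
  rw [intervalIntegral.integral_finsetSum fun s _ => hint s,
    Finset.sum_congr rfl fun s hs => integral_hat_scaled_rpow hp (Finset.mem_range.1 hs),
    Finset.sum_const, Finset.card_range, nsmul_eq_mul]
  push_cast
  rw [pow_succ]
  field_simp

theorem integral_hatSumProd_rpow {d : ℕ} (k : Fin d → ℕ) (i : Fin d) :
    ∫ x in unitCube d, hatSumProd k i x ^ p = (1 / (p + 1)) ^ (d - 1) := by
  have hcube : (volume.restrict (unitCube d) : Measure (Fin d → ℝ)) =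
      Measure.pi fun _ : Fin d => volume.restrict (Icc (0 : ℝ) 1) := by
    rw [unitCube, ← Set.pi_univ_Icc, volume_pi, Measure.restrict_pi_pi]
    rfl
  have hprod (x : Fin d → ℝ) : hatSumProd k i x ^ p =
      ∏ j, Function.update (fun j y => hatSum (k j) y ^ p) i (fun _ => 1) j (x j) := by
    rw [prod_update_apply, one_mul, hatSumProd,
      ← Real.finsetProd_rpow _ _ fun j _ => hatSum_nonneg _ _]
  simp only [hprod]
  rw [hcube, integral_fintype_prod_eq_prod (𝕜 := ℝ),
    ← Finset.mul_prod_erase _ _ (Finset.mem_univ i), Function.update_self,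
    Finset.prod_congr rfl fun j hj => by
      rw [Function.update_of_ne (Finset.ne_of_mem_erase hj), integral_hatSum_rpow hp (k j)],
    Finset.prod_const, Finset.card_erase_of_mem (Finset.mem_univ i)]
  simp

end RpowIntegral

theorem cP_pos {p : ℝ≥0∞} : 0 < cP p := by
  rw [cP]
  split_ifs
  · exact zero_lt_one
  · exact Real.rpow_pos_of_pos (by positivity) _

theorem eLpNorm_hatSumProd_le {d : ℕ} (k : Fin d → ℕ) (i : Fin d) {p : ℝ≥0∞} (hp : 1 ≤ p) :
    eLpNorm (hatSumProd k i) p (volume.restrict (unitCube d)) ≤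
      ENNReal.ofReal ((cP p)⁻¹ ^ (d - 1)) := by
  have hbound : ∀ᵐ x ∂volume.restrict (unitCube d), ‖hatSumProd k i x‖ ≤ 1 :=
    .of_forall fun x => by
      rw [Real.norm_of_nonneg (hatSumProd_nonneg k i x)]
      exact hatSumProd_le_one k i x
  by_cases htop : p = ⊤
  · subst htop
    simpa [cP] using eLpNorm_le_of_ae_bound (p := ⊤) hbound
  · have hp0 : p ≠ 0 := (zero_lt_one.trans_le hp).ne'
    have hmem : MemLp (hatSumProd k i) p (volume.restrict (unitCube d)) :=
      MemLp.of_bound (continuous_hatSumProd k i).aestronglyMeasurable 1 hbound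
    rw [hmem.eLpNorm_eq_integral_rpow_norm hp0 htop]
    simp only [Real.norm_of_nonneg (hatSumProd_nonneg k i _)]
    rw [integral_hatSumProd_rpow (ENNReal.toReal_pos hp0 htop), cP, if_neg htop,
      ← Real.rpow_natCast, ← Real.rpow_mul (by positivity), mul_comm,
      Real.rpow_mul (by positivity), Real.rpow_natCast, one_div, one_div,
      Real.inv_rpow (by positivity)]

theorem eLpNorm_lineDeriv_faberLevel_le {d : ℕ} {f : (Fin d → ℝ) → ℝ} {k : Fin d → ℕ} {Λ : ℝ}
    (hΛ : ∀ s ∈ positions k, |faberCoeff f k s| ≤ Λ) (hΛ0 : 0 ≤ Λ) (i : Fin d) {p : ℝ≥0∞}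
    (hp : 1 ≤ p) :
    eLpNorm (fun x => lineDeriv ℝ (faberLevel f k) x (Pi.single i 1)) p
      (volume.restrict (unitCube d)) ≤
      ENNReal.ofReal (Λ * (4 * 2 ^ k i) * (cP p)⁻¹ ^ (d - 1)) := by
  have hA : 0 ≤ Λ * (4 * 2 ^ k i) := by positivity
  calc eLpNorm (fun x => lineDeriv ℝ (faberLevel f k) x (Pi.single i 1)) p
        (volume.restrict (unitCube d))
      ≤ eLpNorm ((Λ * (4 * 2 ^ k i)) • hatSumProd k i) p (volume.restrict (unitCube d)) :=
        eLpNorm_mono_real fun x => abs_lineDeriv_single_le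
          (mul_nonneg hA (hatSumProd_nonneg k i x)) (abs_faberLevel_update_sub_le hΛ hΛ0 i x)
    _ ≤ ENNReal.ofReal (Λ * (4 * 2 ^ k i)) * ENNReal.ofReal ((cP p)⁻¹ ^ (d - 1)) := by
        rw [eLpNorm_const_smul, Real.enorm_of_nonneg hA]
        gcongr
        exact eLpNorm_hatSumProd_le k i hp
    _ = ENNReal.ofReal (Λ * (4 * 2 ^ k i) * (cP p)⁻¹ ^ (d - 1)) := by
        rw [← ENNReal.ofReal_mul hA]

/-! ### The sparse set of levels -/

open Classical in
/-- The levels of the sparse grid, `β |k|₁ - |k|_∞ ≤ (β - 1) m`. For `β > 1` these levels have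
`|k|₁ ≤ m`, so that the box restricts nothing. -/
def sparseLevels (d : ℕ) (β m : ℝ) : Finset (Fin d → ℕ) :=
  {k ∈ Fintype.piFinset fun _ : Fin d => Finset.range (⌊m⌋₊ + 1) |
    ∃ i, β * ∑ j, (k j : ℝ) - k i ≤ (β - 1) * m}

theorem mem_sparseLevels {d : ℕ} {β m : ℝ} (hβ : 1 < β) {k : Fin d → ℕ} :
    k ∈ sparseLevels d β m ↔ ∃ i, β * ∑ j, (k j : ℝ) - k i ≤ (β - 1) * m := by
  refine ⟨fun h => (Finset.mem_filter.1 h).2, fun h => Finset.mem_filter.2 ⟨?_, h⟩⟩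
  obtain ⟨i, hi⟩ := h
  have hle : ∀ j, (k j : ℝ) ≤ ∑ j, (k j : ℝ) := fun j =>
    Finset.single_le_sum (f := fun j => (k j : ℝ)) (fun _ _ => Nat.cast_nonneg _)
      (Finset.mem_univ j)
  have hsum : ∑ j, (k j : ℝ) ≤ m := by
    refine le_of_mul_le_mul_left ?_ (sub_pos.2 hβ)
    linarith [hle i]
  exact Fintype.mem_piFinset.2 fun j =>
    Finset.mem_range_succ_iff.2 (Nat.le_floor ((hle j).trans hsum))

theorem mul_sum_insertNth_sub_le_iff {n : ℕ} {β : ℝ} (hβ : 1 < β) (m : ℝ) (i : Fin (n + 1)) (a : ℕ)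
    (k : Fin n → ℕ) :
    β * ∑ j, (i.insertNth (α := fun _ => ℕ) a k j : ℝ) - i.insertNth (α := fun _ => ℕ) a k i ≤
        (β - 1) * m ↔
      (a : ℝ) ≤ m - β / (β - 1) * ∑ j, (k j : ℝ) := by
  have hβ1 : 0 < β - 1 := sub_pos.2 hβ
  rw [Fin.sum_univ_succAbove _ i]
  simp only [Fin.insertNth_apply_same, Fin.insertNth_apply_succAbove]
  rw [le_sub_iff_add_le, ← le_sub_iff_add_le', div_mul_eq_mul_div, div_le_iff₀ hβ1]
  constructor <;> intro h <;> linarith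

theorem prod_rpow_pow {n : ℕ} (θ : ℝ) (k : Fin n → ℕ) :
    ∏ j, ((2 : ℝ) ^ θ) ^ k j = 2 ^ (θ * ∑ j, (k j : ℝ)) := by
  rw [Finset.mul_sum, Real.rpow_sum_of_pos (by norm_num)]
  refine Finset.prod_congr rfl fun j _ => ?_
  rw [← Real.rpow_natCast, ← Real.rpow_mul (by norm_num)]

theorem sum_le_sum_image_removeNth {n : ℕ} {ι M : Type*} [DecidableEq ι] [AddCommMonoid M]
    [PartialOrder M] [IsOrderedAddMonoid M] (i : Fin (n + 1)) (S : Finset (Fin (n + 1) → ι))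
    {F : (Fin (n + 1) → ι) → M} {P : (Fin n → ι) → M}
    (h : ∀ (k : Fin n → ι) (A : Finset ι), (∀ a ∈ A, i.insertNth a k ∈ S) →
      ∑ a ∈ A, F (i.insertNth a k) ≤ P k) :
    ∑ k ∈ S, F k ≤ ∑ k ∈ S.image i.removeNth, P k := by
  rw [← Finset.sum_fiberwise_of_maps_to (g := i.removeNth) (t := S.image i.removeNth)
    fun k hk => Finset.mem_image_of_mem _ hk]
  refine Finset.sum_le_sum fun k' _ => ?_
  have hinsert : ∀ k ∈ S.filter fun k => i.removeNth k = k', i.insertNth (k i) k' = k := by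
    intro k hk
    rw [← (Finset.mem_filter.1 hk).2, Fin.insertNth_self_removeNth]
  have hinj : Set.InjOn (fun k : Fin (n + 1) → ι => k i)
      (S.filter fun k => i.removeNth k = k') := by
    intro k hk l hl (hkl : k i = l i)
    rw [← hinsert k hk, ← hinsert l hl, hkl]
  calc ∑ k ∈ S.filter fun k => i.removeNth k = k', F k
      = ∑ a ∈ (S.filter fun k => i.removeNth k = k').image fun k => k i, F (i.insertNth a k') := by
        rw [Finset.sum_image hinj]
        exact Finset.sum_congr rfl fun k hk => by rw [hinsert k hk]
    _ ≤ P k' := h k' _ fun a ha => by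
        obtain ⟨k, hk, rfl⟩ := Finset.mem_image.1 ha
        rw [hinsert k hk]
        exact (Finset.mem_filter.1 hk).1

theorem sum_pow_le_of_lt {r : ℝ} (h0 : 0 < r) (h1 : r < 1) {x : ℝ} (A : Finset ℕ)
    (hA : ∀ a ∈ A, x < a) : ∑ a ∈ A, r ^ a ≤ r ^ x / (1 - r) := by
  have : 0 < 1 - r := sub_pos.2 h1
  rcases A.eq_empty_or_nonempty with rfl | hne
  · rw [Finset.sum_empty]; positivity
  set a₀ := A.min' hne
  have hinj : Set.InjOn (fun a => a - a₀) (A : Set ℕ) := by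
    intro a ha b hb (hab : a - a₀ = b - a₀)
    have := A.min'_le a ha
    have := A.min'_le b hb
    lia
  calc ∑ a ∈ A, r ^ a = r ^ a₀ * ∑ a ∈ A, r ^ (a - a₀) := by
        rw [Finset.mul_sum]
        refine Finset.sum_congr rfl fun a ha => ?_
        rw [← pow_add, Nat.add_sub_cancel' (A.min'_le a ha)]
    _ = r ^ a₀ * ∑ b ∈ A.image fun a => a - a₀, r ^ b := by rw [Finset.sum_image hinj]
    _ ≤ r ^ a₀ * (1 - r)⁻¹ := by
        gcongr
        rw [← tsum_geometric_of_lt_one h0.le h1]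
        exact (summable_geometric_of_lt_one h0.le h1).sum_le_tsum _ fun _ _ => by positivity
    _ ≤ r ^ x * (1 - r)⁻¹ := by
        gcongr
        rw [← Real.rpow_natCast]
        exact Real.rpow_le_rpow_of_exponent_ge h0 h1.le (hA _ (A.min'_mem hne)).le
    _ = r ^ x / (1 - r) := (div_eq_mul_inv _ _).symm

theorem sum_two_pow_le {x : ℝ} (A : Finset ℕ) (hA : ∀ a ∈ A, (a : ℝ) ≤ x) :
    ∑ a ∈ A, (2 : ℝ) ^ a ≤ 2 * 2 ^ x := by
  rcases A.eq_empty_or_nonempty with rfl | hne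
  · rw [Finset.sum_empty]; positivity
  set a₀ := A.max' hne
  have hsub : A ⊆ Finset.range (a₀ + 1) := fun a ha =>
    Finset.mem_range_succ_iff.2 (A.le_max' a ha)
  calc ∑ a ∈ A, (2 : ℝ) ^ a ≤ ∑ a ∈ Finset.range (a₀ + 1), (2 : ℝ) ^ a :=
        Finset.sum_le_sum_of_subset_of_nonneg hsub fun _ _ _ => by positivity
    _ = 2 ^ (a₀ + 1) - 1 := by rw [geom_sum_eq (by norm_num)]; norm_num
    _ ≤ 2 * 2 ^ (a₀ : ℝ) := by rw [Real.rpow_natCast, pow_succ]; linarith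
    _ ≤ 2 * 2 ^ x := by gcongr; exacts [one_le_two, hA _ (A.max'_mem hne)]

theorem one_sub_two_rpow_one_sub_pos {α : ℝ} (hα : 1 < α) : (0 : ℝ) < 1 - 2 ^ (1 - α) :=
  sub_pos.2 (Real.rpow_lt_one_of_one_lt_of_neg one_lt_two (by linarith))

theorem qAB_pos {α β : ℝ} (hα : 1 < α) (hβ : α < β) : 0 < qAB α β := by
  have hθ : 0 < (β - α) / (β - 1) := div_pos (by linarith) (by linarith)
  rw [qAB, sub_pos]
  exact Real.rpow_lt_one_of_one_lt_of_neg (by norm_num) (by linarith)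

/-- The size of the `i`-th partial derivative of level `k` of the Faber series of a function of
smoothness `α`, up to a constant. -/
def levelWeight {d : ℕ} (α : ℝ) (k : Fin d → ℕ) (i : Fin d) : ℝ :=
  (∏ j, ((2 : ℝ) ^ (-α)) ^ k j) * 2 ^ k i

theorem levelWeight_nonneg {d : ℕ} (α : ℝ) (k : Fin d → ℕ) (i : Fin d) : 0 ≤ levelWeight α k i := by
  unfold levelWeight; positivity

theorem levelWeight_le_prod {d : ℕ} (α : ℝ) (k : Fin d → ℕ) (i : Fin d) :
    levelWeight α k i ≤ ∏ j, ((2 : ℝ) ^ (1 - α)) ^ k j := by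
  have hfactor : ∀ j, ((2 : ℝ) ^ (1 - α)) ^ k j = ((2 : ℝ) ^ (-α)) ^ k j * 2 ^ k j := by
    intro j
    rw [← mul_pow, sub_eq_neg_add, Real.rpow_add_one two_ne_zero]
  simp only [levelWeight, hfactor, Finset.prod_mul_distrib]
  gcongr
  exact_mod_cast Finset.single_le_prod' (f := fun j => 2 ^ k j)
    (fun _ _ => Nat.one_le_two_pow) (Finset.mem_univ i)

theorem sum_levelWeight_le {d : ℕ} {α : ℝ} (hα : 1 < α) (i : Fin d) (S : Finset (Fin d → ℕ)) :
    ∑ k ∈ S, levelWeight α k i ≤ ((1 - (2 : ℝ) ^ (1 - α))⁻¹) ^ d :=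
  (Finset.sum_le_sum fun k _ => levelWeight_le_prod α k i).trans
    (sum_prod_pow_le (by positivity) (sub_pos.1 (one_sub_two_rpow_one_sub_pos hα)) S)

theorem summable_levelWeight {d : ℕ} {α : ℝ} (hα : 1 < α) (i : Fin d) :
    Summable fun k => levelWeight α k i :=
  summable_of_sum_le (fun k => levelWeight_nonneg α k i) (sum_levelWeight_le hα i)

theorem levelWeight_insertNth {n : ℕ} (α : ℝ) (i : Fin (n + 1)) (a : ℕ) (k : Fin n → ℕ) :
    levelWeight α (i.insertNth (α := fun _ => ℕ) a k) i =
      ((2 : ℝ) ^ (1 - α)) ^ a * 2 ^ (-α * ∑ j, (k j : ℝ)) := by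
  rw [levelWeight, Fin.prod_univ_succAbove _ i, ← prod_rpow_pow, sub_eq_neg_add,
    Real.rpow_add_one two_ne_zero, mul_pow]
  simp only [Fin.insertNth_apply_same, Fin.insertNth_apply_succAbove]
  ring

theorem sum_levelWeight_insertNth_le {n : ℕ} {α β : ℝ} (hα : 1 < α) (hβ : α < β) (m : ℝ)
    (i : Fin (n + 1)) (k : Fin n → ℕ) (A : Finset ℕ)
    (hA : ∀ a ∈ A, m - β / (β - 1) * ∑ j, (k j : ℝ) < a) :
    ∑ a ∈ A, levelWeight α (i.insertNth (α := fun _ => ℕ) a k) i ≤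
      2 ^ (-((α - 1) * m)) / (1 - 2 ^ (1 - α)) *
        ∏ j, ((2 : ℝ) ^ (-((β - α) / (β - 1)))) ^ k j := by
  have hβ1 : β - 1 ≠ 0 := by linarith
  have hγ := one_sub_two_rpow_one_sub_pos hα
  simp only [levelWeight_insertNth]
  set s := ∑ j, (k j : ℝ)
  rw [← Finset.sum_mul, prod_rpow_pow]
  calc (∑ a ∈ A, ((2 : ℝ) ^ (1 - α)) ^ a) * 2 ^ (-α * s)
      ≤ ((2 : ℝ) ^ (1 - α)) ^ (m - β / (β - 1) * s) / (1 - 2 ^ (1 - α)) * 2 ^ (-α * s) := by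
        gcongr
        exact sum_pow_le_of_lt (by positivity) (sub_pos.1 hγ) A hA
    _ = (2 : ℝ) ^ ((1 - α) * (m - β / (β - 1) * s) + -α * s) / (1 - 2 ^ (1 - α)) := by
        rw [← Real.rpow_mul zero_le_two, Real.rpow_add two_pos]; ring
    _ = (2 : ℝ) ^ (-((α - 1) * m) + -((β - α) / (β - 1)) * s) / (1 - 2 ^ (1 - α)) := by
        congr 2
        field_simp
        ring
    _ = 2 ^ (-((α - 1) * m)) / (1 - 2 ^ (1 - α)) * 2 ^ (-((β - α) / (β - 1)) * s) := by
        rw [Real.rpow_add two_pos]; ring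

theorem sum_levelWeight_le_of_forall_notMem {n : ℕ} {α β : ℝ} (hα : 1 < α) (hβ : α < β) (m : ℝ)
    (i : Fin (n + 1)) (S : Finset (Fin (n + 1) → ℕ)) (hS : ∀ k ∈ S, k ∉ sparseLevels (n + 1) β m) :
    ∑ k ∈ S, levelWeight α k i ≤
      2 ^ (-((α - 1) * m)) / (1 - 2 ^ (1 - α)) * (qAB α β)⁻¹ ^ n := by
  have hγ := one_sub_two_rpow_one_sub_pos hα
  refine (sum_le_sum_image_removeNth i S fun k A hA =>
    sum_levelWeight_insertNth_le hα hβ m i k A fun a ha => ?_).trans ?_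
  · rw [← not_le, ← mul_sum_insertNth_sub_le_iff (hα.trans hβ)]
    exact fun h => hS _ (hA a ha) ((mem_sparseLevels (hα.trans hβ)).2 ⟨i, h⟩)
  · rw [← Finset.mul_sum]
    gcongr
    exact sum_prod_pow_le (by positivity) (sub_pos.1 (qAB_pos hα hβ)) _

theorem sum_prod_two_pow_insertNth_le {n : ℕ} {β : ℝ} (hβ : 1 < β) (m : ℝ) (i : Fin (n + 1))
    (k : Fin n → ℕ) (A : Finset ℕ) (hA : ∀ a ∈ A, (a : ℝ) ≤ m - β / (β - 1) * ∑ j, (k j : ℝ)) :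
    ∑ a ∈ A, ∏ j, (2 : ℝ) ^ i.insertNth (α := fun _ => ℕ) a k j ≤
      2 * 2 ^ m * ∏ j, ((2 : ℝ) ^ (-(1 / (β - 1)))) ^ k j := by
  have hβ1 : β - 1 ≠ 0 := by linarith
  have hfactor : ∀ a : ℕ, ∏ j, (2 : ℝ) ^ i.insertNth (α := fun _ => ℕ) a k j =
      2 ^ a * 2 ^ (∑ j, (k j : ℝ)) := by
    intro a
    have := prod_rpow_pow 1 k
    rw [Real.rpow_one, one_mul] at this
    rw [Fin.prod_univ_succAbove _ i, ← this]
    simp only [Fin.insertNth_apply_same, Fin.insertNth_apply_succAbove]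
  simp only [hfactor]
  set s := ∑ j, (k j : ℝ)
  rw [← Finset.sum_mul, prod_rpow_pow]
  calc (∑ a ∈ A, (2 : ℝ) ^ a) * 2 ^ s ≤ 2 * 2 ^ (m - β / (β - 1) * s) * 2 ^ s := by
        gcongr
        exact sum_two_pow_le A hA
    _ = 2 * (2 : ℝ) ^ (m - β / (β - 1) * s + s) := by rw [Real.rpow_add two_pos]; ring
    _ = 2 * (2 : ℝ) ^ (m + -(1 / (β - 1)) * s) := by
        congr 2
        field_simp
        ring
    _ = 2 * 2 ^ m * 2 ^ (-(1 / (β - 1)) * s) := by rw [Real.rpow_add two_pos]; ring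

theorem one_sub_two_rpow_pos {β : ℝ} (hβ : 1 < β) : (0 : ℝ) < 1 - 2 ^ (-(1 / (β - 1))) :=
  sub_pos.2 (Real.rpow_lt_one_of_one_lt_of_neg one_lt_two
    (neg_neg_of_pos (one_div_pos.2 (sub_pos.2 hβ))))

theorem sum_le_sum_sum_filter {ι κ : Type*} [Fintype ι] (S : Finset κ) (P : ι → κ → Prop)
    [∀ i, DecidablePred (P i)] {g : κ → ℝ} (hg : ∀ k ∈ S, 0 ≤ g k) (hP : ∀ k ∈ S, ∃ i, P i k) :
    ∑ k ∈ S, g k ≤ ∑ i, ∑ k ∈ S with P i k, g k := by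
  simp only [Finset.sum_filter]
  rw [Finset.sum_comm]
  refine Finset.sum_le_sum fun k hk => ?_
  obtain ⟨i, hi⟩ := hP k hk
  refine (if_pos hi).ge.trans (Finset.single_le_sum (f := fun i => if P i k then g k else 0)
    (fun i _ => ?_) (Finset.mem_univ i))
  split_ifs
  exacts [hg k hk, le_rfl]

theorem sum_prod_two_pow_sparseLevels_le {n : ℕ} {β : ℝ} (hβ : 1 < β) (m : ℝ) :
    ∑ k ∈ sparseLevels (n + 1) β m, ∏ j, (2 : ℝ) ^ k j ≤
      (n + 1) * (2 * 2 ^ m * ((1 - (2 : ℝ) ^ (-(1 / (β - 1))))⁻¹) ^ n) := by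
  classical
  set S := sparseLevels (n + 1) β m
  have hT : ∀ i, ∑ k ∈ S with β * ∑ j, (k j : ℝ) - k i ≤ (β - 1) * m,
      ∏ j, (2 : ℝ) ^ k j ≤
      2 * 2 ^ m * ((1 - (2 : ℝ) ^ (-(1 / (β - 1))))⁻¹) ^ n := by
    intro i
    refine (sum_le_sum_image_removeNth i _ fun k A hA =>
      sum_prod_two_pow_insertNth_le hβ m i k A fun a ha => ?_).trans ?_
    · exact (mul_sum_insertNth_sub_le_iff hβ m i a k).1 (Finset.mem_filter.1 (hA a ha)).2
    · rw [← Finset.mul_sum]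
      gcongr
      exact sum_prod_pow_le (by positivity) (sub_pos.1 (one_sub_two_rpow_pos hβ)) _
  calc ∑ k ∈ S, ∏ j, (2 : ℝ) ^ k j
      ≤ ∑ i, ∑ k ∈ S with β * ∑ j, (k j : ℝ) - k i ≤ (β - 1) * m, ∏ j, (2 : ℝ) ^ k j :=
        sum_le_sum_sum_filter S (fun i k => β * ∑ j, (k j : ℝ) - k i ≤ (β - 1) * m)
          (fun k _ => by positivity) fun k hk => (mem_sparseLevels hβ).1 hk
    _ ≤ ∑ _i : Fin (n + 1), 2 * 2 ^ m * ((1 - (2 : ℝ) ^ (-(1 / (β - 1))))⁻¹) ^ n :=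
        Finset.sum_le_sum fun i _ => hT i
    _ = _ := by simp

/-! ### Approximation by truncated and approximately multiplied Faber series -/

/-- The term of level `k` of the Faber series of the error that remains when the levels in `Δ` are
approximated by networks and all other levels are dropped. -/
def levelRemainder {d : ℕ} (J R : ℕ) (Δ : Finset (Fin d → ℕ)) (f : (Fin d → ℝ) → ℝ)
    (k : Fin d → ℕ) (x : Fin d → ℝ) : ℝ :=
  faberLevel f k x - if k ∈ Δ then approxLevel J R f k x else 0

section LevelRemainder

variable {d J R : ℕ} {α : ℝ} {Δ : Finset (Fin d → ℕ)} {f : (Fin d → ℝ) → ℝ} {k : Fin d → ℕ}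

theorem levelRemainder_of_mem (hk : k ∈ Δ) (x : Fin d → ℝ) :
    levelRemainder J R Δ f k x = faberLevel f k x - approxLevel J R f k x := by
  rw [levelRemainder, if_pos hk]

theorem levelRemainder_of_notMem (hk : k ∉ Δ) : levelRemainder J R Δ f k = faberLevel f k := by
  funext x
  rw [levelRemainder, if_neg hk, sub_zero]

theorem levelRemainder_eq_zero (hJ : d ≤ 2 ^ J) {x : Fin d → ℝ} (hx : x ∉ openCube d) :
    levelRemainder J R Δ f k x = 0 := by
  rw [levelRemainder, faberLevel_eq_zero f k hx, approxLevel_eq_zero hJ R f k hx, ite_self,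
    sub_zero]

theorem hasSum_levelRemainder (hα : 0 < α) (hf : f ∈ holderBall d α) {x : Fin d → ℝ}
    (hx : x ∈ openCube d) :
    HasSum (fun k => levelRemainder J R Δ f k x) (f x - ∑ k ∈ Δ, approxLevel J R f k x) := by
  have happrox : HasSum (fun k => if k ∈ Δ then approxLevel J R f k x else 0)
      (∑ k ∈ Δ, approxLevel J R f k x) := by
    rw [← Finset.sum_congr rfl fun k hk => if_pos (e := 0) hk]
    exact hasSum_sum_of_ne_finset_zero fun k hk => if_neg hk
  exact (hasSum_faberLevel hα hf hx).sub happrox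

theorem abs_levelRemainder_update_sub_le_of_mem (hJ : d ≤ 2 ^ J) (hR : 1 ≤ R)
    (hf : holderNorm α f ≤ 1) (hk : k ∈ Δ) (i : Fin d) (x : Fin d → ℝ) (t : ℝ) :
    |levelRemainder J R Δ f k (Function.update x i t) - levelRemainder J R Δ f k x| ≤
      4 * ((2 : ℝ) ^ (-(α + 1))) ^ d * (4 ^ J * (2 * (2 ^ R)⁻¹)) * levelWeight α k i *
        |t - x i| := by
  rw [levelRemainder_of_mem hk, levelRemainder_of_mem hk, ← abs_neg, neg_sub', neg_sub, neg_sub]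
  refine (abs_levelError_update_sub_le hJ hR (fun s hs => abs_faberCoeff_le hf hs)
    (by positivity) i x t).trans_eq ?_
  rw [levelWeight]
  ring

theorem abs_levelRemainder_update_sub_le_of_notMem (hf : holderNorm α f ≤ 1) (hk : k ∉ Δ)
    (i : Fin d) (x : Fin d → ℝ) (t : ℝ) :
    |levelRemainder J R Δ f k (Function.update x i t) - levelRemainder J R Δ f k x| ≤
      4 * ((2 : ℝ) ^ (-(α + 1))) ^ d * levelWeight α k i * |t - x i| := by
  rw [levelRemainder_of_notMem hk]
  set Λ := ((2 : ℝ) ^ (-(α + 1))) ^ d * ∏ j, ((2 : ℝ) ^ (-α)) ^ k j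
  have hΛ : 0 ≤ Λ := by positivity
  calc |faberLevel f k (Function.update x i t) - faberLevel f k x|
      ≤ Λ * (4 * 2 ^ k i) * hatSumProd k i x * |t - x i| :=
        abs_faberLevel_update_sub_le (fun s hs => abs_faberCoeff_le hf hs) hΛ i x t
    _ ≤ Λ * (4 * 2 ^ k i) * 1 * |t - x i| := by gcongr; exact hatSumProd_le_one k i x
    _ = _ := by rw [levelWeight]; ring

theorem abs_levelRemainder_update_sub_le (hJ : d ≤ 2 ^ J) (hR : 1 ≤ R) (hf : holderNorm α f ≤ 1)
    (k : Fin d → ℕ) (i : Fin d) (x : Fin d → ℝ) (t : ℝ) :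
    |levelRemainder J R Δ f k (Function.update x i t) - levelRemainder J R Δ f k x| ≤
      4 * ((2 : ℝ) ^ (-(α + 1))) ^ d * (1 + 4 ^ J * (2 * (2 ^ R)⁻¹)) * levelWeight α k i *
        |t - x i| := by
  have hw := levelWeight_nonneg α k i
  by_cases hk : k ∈ Δ
  · refine (abs_levelRemainder_update_sub_le_of_mem hJ hR hf hk i x t).trans ?_
    gcongr
    exact le_add_of_nonneg_left (zero_le_one' ℝ)
  · refine (abs_levelRemainder_update_sub_le_of_notMem hf hk i x t).trans ?_
    gcongr ?_ * levelWeight α k i * |t - x i|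
    exact le_mul_of_one_le_right (by positivity) (le_add_of_nonneg_right (by positivity))

theorem sum_eLpNorm_lineDeriv_levelRemainder_of_mem_le (hα : 1 < α) (hJ : d ≤ 2 ^ J) (hR : 1 ≤ R)
    (hf : holderNorm α f ≤ 1) (p : ℝ≥0∞) (i : Fin d) {T : Finset (Fin d → ℕ)} (hT : T ⊆ Δ) :
    ∑ k ∈ T, eLpNorm (fun x => lineDeriv ℝ (levelRemainder J R Δ f k) x (Pi.single i 1)) p
        (volume.restrict (unitCube d)) ≤
      ENNReal.ofReal (4 * ((2 : ℝ) ^ (-(α + 1))) ^ d * (4 ^ J * (2 * (2 ^ R)⁻¹)) *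
        ((1 - (2 : ℝ) ^ (1 - α))⁻¹) ^ d) := by
  set C := 4 * ((2 : ℝ) ^ (-(α + 1))) ^ d * (4 ^ J * (2 * (2 ^ R)⁻¹))
  have hC : 0 ≤ C := by positivity
  have hterm : ∀ k, 0 ≤ C * levelWeight α k i := fun k => mul_nonneg hC (levelWeight_nonneg α k i)
  have hderiv : ∀ k ∈ T,
      eLpNorm (fun x => lineDeriv ℝ (levelRemainder J R Δ f k) x (Pi.single i 1)) p
        (volume.restrict (unitCube d)) ≤ ENNReal.ofReal (C * levelWeight α k i) := by
    intro k hk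
    simpa using eLpNorm_le_of_ae_bound (p := p) (μ := volume.restrict (unitCube d))
      (.of_forall fun x => abs_lineDeriv_single_le (hterm k)
        (abs_levelRemainder_update_sub_le_of_mem hJ hR hf (hT hk) i x))
  calc _ ≤ ∑ k ∈ T, ENNReal.ofReal (C * levelWeight α k i) := Finset.sum_le_sum hderiv
    _ = ENNReal.ofReal (C * ∑ k ∈ T, levelWeight α k i) := by
        rw [← ENNReal.ofReal_sum_of_nonneg fun k _ => hterm k, Finset.mul_sum]
    _ ≤ _ := by gcongr; exact sum_levelWeight_le hα i T

theorem sum_eLpNorm_lineDeriv_levelRemainder_of_notMem_le {p : ℝ≥0∞} (hp : 1 ≤ p)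
    (hf : holderNorm α f ≤ 1) (i : Fin d) {T : Finset (Fin d → ℕ)} (hT : ∀ k ∈ T, k ∉ Δ) :
    ∑ k ∈ T, eLpNorm (fun x => lineDeriv ℝ (levelRemainder J R Δ f k) x (Pi.single i 1)) p
        (volume.restrict (unitCube d)) ≤
      ENNReal.ofReal (4 * ((2 : ℝ) ^ (-(α + 1))) ^ d * ((cP p)⁻¹ ^ (d - 1) *
        ∑ k ∈ T, levelWeight α k i)) := by
  have : 0 < cP p := cP_pos
  set C := 4 * ((2 : ℝ) ^ (-(α + 1))) ^ d * (cP p)⁻¹ ^ (d - 1)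
  have hC : 0 ≤ C := by positivity
  calc _ ≤ ∑ k ∈ T, ENNReal.ofReal (C * levelWeight α k i) := by
        refine Finset.sum_le_sum fun k hk => ?_
        rw [levelRemainder_of_notMem (hT k hk)]
        refine (eLpNorm_lineDeriv_faberLevel_le (fun s hs => abs_faberCoeff_le hf hs)
          (by positivity) i hp).trans_eq ?_
        congr 1
        simp only [C, levelWeight]
        ring
    _ = _ := by
        rw [← ENNReal.ofReal_sum_of_nonneg fun k _ => mul_nonneg hC (levelWeight_nonneg α k i),
          ← Finset.mul_sum, mul_assoc _ ((cP p)⁻¹ ^ (d - 1))]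

theorem memSobolevZero_sub_sum_approxLevel (hd : 1 ≤ d) (hα : 1 < α) (hJ : d ≤ 2 ^ J) (hR : 1 ≤ R)
    (hf : f ∈ holderBall d α) (Δ : Finset (Fin d → ℕ)) (p : ℝ≥0∞) :
    MemSobolevZero p fun x => f x - ∑ k ∈ Δ, approxLevel J R f k x :=
  memSobolevZero_of_hasSum (fun k i => mul_nonneg (by positivity) (levelWeight_nonneg α k i))
    (abs_levelRemainder_update_sub_le hJ hR hf.2.2) (fun _ _ => levelRemainder_eq_zero hJ)
    (fun i => (summable_levelWeight hα i).mul_left _)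
    (fun _ => hasSum_levelRemainder (by linarith) hf) hd p

end LevelRemainder

theorem tsum_eLpNorm_lineDeriv_levelRemainder_le {n J R : ℕ} {α β : ℝ} (hα : 1 < α) (hβ : α < β)
    {p : ℝ≥0∞} (hp : 1 ≤ p) (hJ : n + 1 ≤ 2 ^ J) (hR : 1 ≤ R) {f : (Fin (n + 1) → ℝ) → ℝ}
    (hf : holderNorm α f ≤ 1) (m : ℝ) (i : Fin (n + 1)) :
    ∑' k, eLpNorm (fun x => lineDeriv ℝ (levelRemainder J R (sparseLevels (n + 1) β m) f k) x
        (Pi.single i 1)) p (volume.restrict (unitCube (n + 1))) ≤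
      ENNReal.ofReal (4 * ((2 : ℝ) ^ (-(α + 1))) ^ (n + 1) * ((cP p)⁻¹ ^ n *
        (2 ^ (-((α - 1) * m)) / (1 - 2 ^ (1 - α)) * (qAB α β)⁻¹ ^ n) +
        4 ^ J * (2 * (2 ^ R)⁻¹) * ((1 - (2 : ℝ) ^ (1 - α))⁻¹) ^ (n + 1))) := by
  have hγ := one_sub_two_rpow_one_sub_pos hα
  have hq := qAB_pos hα hβ
  have hc : 0 < cP p := cP_pos
  rw [ENNReal.tsum_eq_iSup_sum]
  refine iSup_le fun T => ?_
  rw [← Finset.sum_filter_add_sum_filter_not T (· ∈ sparseLevels (n + 1) β m), mul_add, add_comm,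
    ENNReal.ofReal_add (by positivity) (by positivity)]
  refine add_le_add ?_ ?_
  · have hT : ∀ k ∈ T.filter (· ∉ sparseLevels (n + 1) β m), k ∉ sparseLevels (n + 1) β m :=
      fun k hk => (Finset.mem_filter.1 hk).2
    refine (sum_eLpNorm_lineDeriv_levelRemainder_of_notMem_le hp hf i hT).trans ?_
    rw [Nat.add_sub_cancel]
    gcongr
    exact sum_levelWeight_le_of_forall_notMem hα hβ m i _ hT
  · rw [← mul_assoc]
    exact sum_eLpNorm_lineDeriv_levelRemainder_of_mem_le hα hJ hR hf p i
      fun k hk => (Finset.mem_filter.1 hk).2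

theorem sobolevNorm_sub_sum_approxLevel_le {n J R : ℕ} {α β : ℝ} (hα : 1 < α) (hβ : α < β)
    {p : ℝ≥0∞} (hp : 1 ≤ p) (hJ : n + 1 ≤ 2 ^ J) (hR : 1 ≤ R) {f : (Fin (n + 1) → ℝ) → ℝ}
    (hf : f ∈ holderBall (n + 1) α) (m : ℝ) :
    sobolevNorm p (fun x => f x - ∑ k ∈ sparseLevels (n + 1) β m, approxLevel J R f k x) ≤
      ENNReal.ofReal ((n + 1) * (4 * ((2 : ℝ) ^ (-(α + 1))) ^ (n + 1) * ((cP p)⁻¹ ^ n *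
        (2 ^ (-((α - 1) * m)) / (1 - 2 ^ (1 - α)) * (qAB α β)⁻¹ ^ n) +
        4 ^ J * (2 * (2 ^ R)⁻¹) * ((1 - (2 : ℝ) ^ (1 - α))⁻¹) ^ (n + 1)))) := by
  rw [ENNReal.ofReal_mul (by positivity)]
  refine (sobolevNorm_le_of_hasSum
    (fun k i => mul_nonneg (by positivity) (levelWeight_nonneg α k i))
    (abs_levelRemainder_update_sub_le hJ hR hf.2.2) (fun _ _ => levelRemainder_eq_zero hJ)
    (fun i => (summable_levelWeight hα i).mul_left _)
    (fun _ => hasSum_levelRemainder (by linarith) hf) n.succ_pos hp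
    (tsum_eLpNorm_lineDeriv_levelRemainder_le hα hβ hp hJ hR hf.2.2 m)).trans_eq ?_
  norm_cast

theorem card_positions {d : ℕ} (k : Fin d → ℕ) : (positions k).card = ∏ j, 2 ^ k j := by
  simp [positions, Fintype.card_piFinset]

theorem exists_architecture_sum_approxLevel {d : ℕ} (J R : ℕ) (Δ : Finset (Fin d → ℕ)) :
    ∃ (S : NetShape d) (A : NeuralNet S), A.IsArchitecture ∧ A.depth = J * (R + 1) + 2 ∧
      A.size ≤ (∑ k ∈ Δ, ∏ j, 2 ^ k j) * (2 ^ J * 9) * (3 + 19 * (J * (R + 1))) ∧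
      ∀ f : (Fin d → ℝ) → ℝ, ∃ Φ : NeuralNet S, Φ.HasArchitecture A ∧
        ∀ x, Φ.output x = ∑ k ∈ Δ, approxLevel J R f k x := by
  set K := {κ // κ ∈ Δ.sigma fun k => positions k}
  have hcard : Fintype.card K = ∑ k ∈ Δ, ∏ j, 2 ^ k j := by
    simp only [K, Fintype.card_coe, Finset.card_sigma, card_positions]
  obtain ⟨S, A, hA, hdepth, hsize, hreal⟩ := exists_architecture_hats (K := K) J R
    (fun κ => κ.1.1) (fun κ => κ.1.2)
  refine ⟨S, A, hA, hdepth, hcard ▸ hsize, fun f => ?_⟩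
  obtain ⟨Φ, hΦ, hout⟩ := hreal fun κ => faberCoeff f κ.1.1 κ.1.2
  refine ⟨Φ, hΦ, fun x => ?_⟩
  rw [hout, Finset.sum_coe_sort (Δ.sigma fun k => positions k)
    (fun κ => faberCoeff f κ.1 κ.2 * treeApprox R (hatVec κ.1 κ.2 x) J 0), Finset.sum_sigma]
  rfl

/-! ### Choice of the parameters -/

theorem logb_two_natCast_le {d : ℕ} (hd : 1 ≤ d) : Real.logb 2 d ≤ d := by
  rw [Real.logb_le_iff_le_rpow one_lt_two (by exact_mod_cast hd), Real.rpow_natCast]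
  exact_mod_cast (Nat.lt_two_pow_self (n := d)).le

theorem one_le_logb_two_natCast {d : ℕ} (hd : 2 ≤ d) : 1 ≤ Real.logb 2 d := by
  rw [Real.le_logb_iff_rpow_le one_lt_two (by positivity), Real.rpow_one]
  exact_mod_cast hd

theorem mul_natCast_le_logb_add_logb {α γ ε : ℝ} {d : ℕ} (hγ : 0 < γ) (hε : 0 < ε)
    (h : ε < d / (2 ^ (α * d) * γ)) :
    (α - 1) * d ≤ Real.logb 2 ε⁻¹ + Real.logb 2 γ⁻¹ := by
  have hd : (d : ℝ) ≤ 2 ^ (d : ℝ) := by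
    rw [Real.rpow_natCast]
    exact_mod_cast (Nat.lt_two_pow_self (n := d)).le
  rw [← Real.logb_mul (by positivity) (by positivity),
    Real.le_logb_iff_rpow_le one_lt_two (by positivity), sub_mul, one_mul,
    Real.rpow_sub two_pos, ← mul_inv, div_le_iff₀ (by positivity), inv_mul_eq_div,
    le_div_iff₀ (by positivity)]
  rw [lt_div_iff₀ (by positivity)] at h
  linarith

theorem exists_two_pow_between {d : ℕ} (hd : 2 ≤ d) :
    ∃ J : ℕ, d ≤ 2 ^ J ∧ (2 : ℝ) ^ J ≤ 2 * d ∧ (J : ℝ) ≤ 2 * Real.logb 2 d := by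
  obtain ⟨j, hj⟩ : ∃ j, Nat.clog 2 d = j + 1 :=
    Nat.exists_eq_add_one.2 (Nat.clog_pos one_lt_two hd)
  have hjd : (2 : ℝ) ^ j ≤ d := by
    have h := Nat.pow_pred_clog_lt_self (b := 2) one_lt_two (x := d) hd
    rw [hj] at h
    exact_mod_cast h.le
  have hjlog : (j : ℝ) ≤ Real.logb 2 d := by
    rwa [Real.le_logb_iff_rpow_le one_lt_two (by positivity), Real.rpow_natCast]
  refine ⟨j + 1, hj ▸ Nat.le_pow_clog one_lt_two d, ?_, ?_⟩
  · rw [pow_succ]; linarith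
  · push_cast
    linarith [one_le_logb_two_natCast hd]

theorem one_le_inv_one_sub_two_rpow {α : ℝ} (hα : 1 < α) : 1 ≤ (1 - (2 : ℝ) ^ (1 - α))⁻¹ :=
  (one_le_inv₀ (one_sub_two_rpow_one_sub_pos hα)).2 (sub_le_self 1 (by positivity))

/-- A constant `C` depending only on `α` such that an accuracy `2^{-R}` with
`R ≤ C max {1, log₂ ε⁻¹}` suffices for the approximate multiplications. -/
def accuracyConst (α : ℝ) : ℝ :=
  9 + (3 + Real.logb 2 (1 - 2 ^ (1 - α))⁻¹) * ((1 + Real.logb 2 (1 - 2 ^ (1 - α))⁻¹) / (α - 1))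

theorem accuracyConst_pos {α : ℝ} (hα : 1 < α) : 0 < accuracyConst α := by
  have : 0 ≤ Real.logb 2 (1 - (2 : ℝ) ^ (1 - α))⁻¹ :=
    Real.logb_nonneg one_lt_two (one_le_inv_one_sub_two_rpow hα)
  have : 0 < α - 1 := sub_pos.2 hα
  rw [accuracyConst]
  positivity

theorem exists_accuracy_of_le_mul {c M ε γ : ℝ} {d : ℕ} (hd : 1 ≤ d) (hγ : 1 ≤ γ) (hM : 1 ≤ M)
    (hMε : Real.logb 2 ε⁻¹ ≤ M) (hε : 0 < ε) (hε1 : ε < 1) (hdM : d ≤ c * M) :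
    ∃ R : ℕ, 1 ≤ R ∧ (R : ℝ) + 1 ≤ (9 + (3 + Real.logb 2 γ) * c) * M ∧
      64 * (d : ℝ) ^ 3 * γ ^ d * (2 ^ R)⁻¹ ≤ ε := by
  have hd1 : (1 : ℝ) ≤ d := by exact_mod_cast hd
  have hlogγ : 0 ≤ Real.logb 2 γ := Real.logb_nonneg one_lt_two hγ
  have hlogd : 0 ≤ Real.logb 2 (d : ℝ) := Real.logb_nonneg one_lt_two hd1
  have hlogε : 0 ≤ Real.logb 2 ε⁻¹ := Real.logb_nonneg one_lt_two ((one_le_inv₀ hε).2 hε1.le)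
  have hlogγd : 0 ≤ d * Real.logb 2 γ := by positivity
  have hpos : 0 < 64 * (d : ℝ) ^ 3 * γ ^ d * ε⁻¹ := by positivity
  set ρ := Real.logb 2 (64 * (d : ℝ) ^ 3 * γ ^ d * ε⁻¹) with hρ
  have hlog : ρ = 6 + 3 * Real.logb 2 d + d * Real.logb 2 γ + Real.logb 2 ε⁻¹ := by
    rw [hρ, Real.logb_mul (by positivity) (by positivity), Real.logb_mul (by positivity)
      (by positivity), Real.logb_mul (by positivity) (by positivity), Real.logb_pow,
      Real.logb_pow, show (64 : ℝ) = 2 ^ (6 : ℝ) by norm_num, Real.logb_rpow two_pos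
      one_lt_two.ne']
    push_cast
    ring
  refine ⟨⌈ρ⌉₊, ?_, ?_, ?_⟩
  · exact Nat.one_le_ceil_iff.2 (by linarith)
  · have := Nat.ceil_lt_add_one (a := ρ) (by linarith)
    have := logb_two_natCast_le hd
    nlinarith
  · have hceil : 64 * (d : ℝ) ^ 3 * γ ^ d * ε⁻¹ ≤ 2 ^ ⌈ρ⌉₊ := by
      rw [← Real.rpow_natCast 2, ← Real.logb_le_iff_le_rpow one_lt_two hpos]
      exact Nat.le_ceil _
    rw [← div_eq_mul_inv, div_le_iff₀ hε] at hceil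
    rwa [← div_eq_mul_inv, div_le_iff₀ (by positivity), mul_comm ε]

theorem exists_accuracy {α β ε : ℝ} {p : ℝ≥0∞} {d : ℕ} (hα : 1 < α) (hd : 1 ≤ d) (hε : 0 < ε)
    (hε0 : ε < eps0 d α β p) :
    ∃ R : ℕ, 1 ≤ R ∧ (R : ℝ) + 1 ≤ accuracyConst α * max 1 (Real.logb 2 ε⁻¹) ∧
      64 * (d : ℝ) ^ 3 * (1 - (2 : ℝ) ^ (1 - α))⁻¹ ^ d * (2 ^ R)⁻¹ ≤ ε := by
  have hlogγ : 0 ≤ Real.logb 2 (1 - (2 : ℝ) ^ (1 - α))⁻¹ :=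
    Real.logb_nonneg one_lt_two (one_le_inv_one_sub_two_rpow hα)
  have hdim := mul_natCast_le_logb_add_logb (one_sub_two_rpow_one_sub_pos hα) hε
    (hε0.trans_le ((min_le_right _ _).trans (min_le_left _ _)))
  refine exists_accuracy_of_le_mul hd (one_le_inv_one_sub_two_rpow hα) (le_max_left _ _)
    (le_max_right _ _) hε (hε0.trans_le (min_le_left _ _)) ?_
  have hM1 : 1 ≤ max 1 (Real.logb 2 ε⁻¹) := le_max_left _ _
  have hMε : Real.logb 2 ε⁻¹ ≤ max 1 (Real.logb 2 ε⁻¹) := le_max_right _ _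
  rw [div_mul_eq_mul_div, le_div_iff₀ (sub_pos.2 hα)]
  nlinarith

/-- The value of `2^{(α-1) m}` for which the sparse grid with parameter `m` in dimension `n + 1` has
truncation error `ε / 2`. -/
def truncScale (n : ℕ) (α β : ℝ) (p : ℝ≥0∞) (ε : ℝ) : ℝ :=
  8 * (n + 1) * ((2 : ℝ) ^ (-(α + 1))) ^ (n + 1) * ((cP p)⁻¹ ^ n * (qAB α β)⁻¹ ^ n) /
    ((1 - 2 ^ (1 - α)) * ε)

/-- The parameter `m` of the sparse grid. -/
def truncLevel (n : ℕ) (α β : ℝ) (p : ℝ≥0∞) (ε : ℝ) : ℝ :=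
  Real.logb 2 (truncScale n α β p ε) / (α - 1)

section Truncation

variable {n : ℕ} {α β ε : ℝ} {p : ℝ≥0∞}

theorem truncScale_pos (hα : 1 < α) (hβ : α < β) (hε : 0 < ε) : 0 < truncScale n α β p ε := by
  have := qAB_pos hα hβ
  have : 0 < cP p := cP_pos
  have := one_sub_two_rpow_one_sub_pos hα
  unfold truncScale
  positivity

theorem two_rpow_truncLevel (hα : 1 < α) (hβ : α < β) (hε : 0 < ε) :
    (2 : ℝ) ^ truncLevel n α β p ε = truncScale n α β p ε ^ (1 / (α - 1)) := by
  rw [truncLevel, div_eq_mul_one_div, Real.rpow_mul zero_le_two,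
    Real.rpow_logb two_pos one_lt_two.ne' (truncScale_pos hα hβ hε)]

theorem two_rpow_neg_mul_truncLevel (hα : 1 < α) (hβ : α < β) (hε : 0 < ε) :
    (2 : ℝ) ^ (-((α - 1) * truncLevel n α β p ε)) = (truncScale n α β p ε)⁻¹ := by
  rw [Real.rpow_neg zero_le_two, truncLevel, mul_div_cancel₀ _ (sub_ne_zero.2 hα.ne'),
    Real.rpow_logb two_pos one_lt_two.ne' (truncScale_pos hα hβ hε)]

theorem truncScale_eq (hα : 1 < α) (hβ : α < β) (hε : 0 < ε) :
    truncScale n α β p ε = (8 * cP p * qAB α β / (1 - 2 ^ (1 - α))) * (n + 1) *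
      ((cP p * 2 ^ (α + 1) * qAB α β) ^ (n + 1))⁻¹ * ε⁻¹ := by
  have := qAB_pos hα hβ
  have : 0 < cP p := cP_pos
  have := one_sub_two_rpow_one_sub_pos hα
  rw [truncScale, Real.rpow_neg zero_le_two, mul_pow, mul_pow, pow_succ (cP p),
    pow_succ (qAB α β)]
  simp only [inv_pow]
  field_simp

theorem truncation_error_eq (hα : 1 < α) (hβ : α < β) (hε : 0 < ε) :
    ((n : ℝ) + 1) * (4 * ((2 : ℝ) ^ (-(α + 1))) ^ (n + 1) * ((cP p)⁻¹ ^ n *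
      ((truncScale n α β p ε)⁻¹ / (1 - 2 ^ (1 - α)) * (qAB α β)⁻¹ ^ n))) = ε / 2 := by
  have := qAB_pos hα hβ
  have : 0 < cP p := cP_pos
  have := one_sub_two_rpow_one_sub_pos hα
  rw [truncScale]
  field_simp
  norm_num

theorem multiplication_error_le {J R : ℕ} (hα : 1 < α) (hJ : (2 : ℝ) ^ J ≤ 2 * (n + 1))
    (hR : 64 * ((n : ℝ) + 1) ^ 3 * (1 - (2 : ℝ) ^ (1 - α))⁻¹ ^ (n + 1) * (2 ^ R)⁻¹ ≤ ε) :
    ((n : ℝ) + 1) * (4 * ((2 : ℝ) ^ (-(α + 1))) ^ (n + 1) *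
      (4 ^ J * (2 * (2 ^ R)⁻¹) * (1 - (2 : ℝ) ^ (1 - α))⁻¹ ^ (n + 1))) ≤ ε / 2 := by
  have := one_sub_two_rpow_one_sub_pos hα
  have hcoeff : ((2 : ℝ) ^ (-(α + 1))) ^ (n + 1) ≤ 1 := pow_le_one₀ (by positivity)
    (Real.rpow_le_one_of_one_le_of_nonpos one_le_two (by linarith))
  have hfour : (4 : ℝ) ^ J ≤ 4 * ((n : ℝ) + 1) ^ 2 := by
    calc (4 : ℝ) ^ J = (2 ^ J) ^ 2 := by rw [← pow_mul, mul_comm, pow_mul]; norm_num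
      _ ≤ (2 * (n + 1)) ^ 2 := by gcongr
      _ = 4 * (n + 1) ^ 2 := by ring
  calc ((n : ℝ) + 1) * (4 * ((2 : ℝ) ^ (-(α + 1))) ^ (n + 1) *
        (4 ^ J * (2 * (2 ^ R)⁻¹) * (1 - (2 : ℝ) ^ (1 - α))⁻¹ ^ (n + 1)))
      ≤ ((n : ℝ) + 1) * (4 * 1 * ((4 * ((n : ℝ) + 1) ^ 2) * (2 * (2 ^ R)⁻¹) *
          (1 - (2 : ℝ) ^ (1 - α))⁻¹ ^ (n + 1))) := by gcongr
    _ = (64 * ((n : ℝ) + 1) ^ 3 * (1 - (2 : ℝ) ^ (1 - α))⁻¹ ^ (n + 1) * (2 ^ R)⁻¹) / 2 := by ring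
    _ ≤ ε / 2 := by gcongr

theorem sobolevNorm_sub_sum_approxLevel_truncLevel_le {J R : ℕ} (hα : 1 < α) (hβ : α < β)
    (hp : 1 ≤ p) (hε : 0 < ε) (hJ : n + 1 ≤ 2 ^ J) (hJ2 : (2 : ℝ) ^ J ≤ 2 * (n + 1)) (hR : 1 ≤ R)
    (hRε : 64 * ((n : ℝ) + 1) ^ 3 * (1 - (2 : ℝ) ^ (1 - α))⁻¹ ^ (n + 1) * (2 ^ R)⁻¹ ≤ ε)
    {f : (Fin (n + 1) → ℝ) → ℝ} (hf : f ∈ holderBall (n + 1) α) :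
    sobolevNorm p (fun x => f x -
      ∑ k ∈ sparseLevels (n + 1) β (truncLevel n α β p ε), approxLevel J R f k x) ≤
      ENNReal.ofReal ε := by
  refine (sobolevNorm_sub_sum_approxLevel_le hα hβ hp hJ hR hf _).trans
    (ENNReal.ofReal_le_ofReal ?_)
  have htrunc := truncation_error_eq (n := n) (p := p) hα hβ hε
  have hmult := multiplication_error_le hα hJ2 hRε
  rw [two_rpow_neg_mul_truncLevel hα hβ hε, mul_add, mul_add]
  linarith

theorem baseB_zpow_neg (hα : 1 < α) (hβ : α < β) {d : ℕ} (hd : 1 ≤ d) :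
    baseB d α β p ^ (-(d : ℤ)) = ((1 - (2 : ℝ) ^ (-(1 / (β - 1)))) ^ d)⁻¹ *
      (((cP p * 2 ^ (α + 1) * qAB α β) ^ d)⁻¹) ^ (1 / (α - 1)) *
        (d : ℝ) ^ (2 * α * (1 / (α - 1))) := by
  have := qAB_pos hα hβ
  have : 0 < cP p := cP_pos
  have hd0 : (0 : ℝ) < d := by exact_mod_cast hd
  have hroot : ((d : ℝ) ^ (2 * α / d)) ^ d = (d : ℝ) ^ (2 * α) := by
    rw [← Real.rpow_mul_natCast hd0.le, div_mul_cancel₀ _ hd0.ne']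
  have hpow : ((cP p * 2 ^ (α + 1) * qAB α β / (d : ℝ) ^ (2 * α / d)) ^ (1 / (α - 1))) ^ d =
      ((cP p * 2 ^ (α + 1) * qAB α β) ^ d) ^ (1 / (α - 1)) /
        (d : ℝ) ^ (2 * α * (1 / (α - 1))) := by
    rw [Real.rpow_mul hd0.le, ← hroot, ← Real.div_rpow (by positivity) (by positivity), ← div_pow,
      Real.rpow_pow_comm (by positivity)]
  rw [zpow_neg, zpow_natCast, baseB, mul_pow, hpow, Real.inv_rpow (by positivity), mul_inv,
    inv_div, div_eq_mul_inv]
  ring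

/-- The exponent `2α / (α - 1)` of the dimension in `B^{-d}` is `2 + 2 / (α - 1)`. -/
theorem pow_three_mul_rpow_le {x : ℝ} (hα : 1 < α) (hα₂ : α ≤ 2) (hx : 1 ≤ x) :
    x ^ 3 * x ^ (1 / (α - 1)) ≤ x ^ (2 * α * (1 / (α - 1))) := by
  have hα1 : 0 < α - 1 := sub_pos.2 hα
  have hexp : 2 * α * (1 / (α - 1)) = 2 + 2 * (1 / (α - 1)) := by field_simp; ring
  have hone : 1 ≤ 1 / (α - 1) := (one_le_div hα1).2 (by linarith)
  rw [← Real.rpow_natCast, ← Real.rpow_add (by linarith), hexp]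
  refine Real.rpow_le_rpow_of_exponent_le hx ?_
  push_cast
  linarith

theorem pow_three_mul_truncScale_rpow_le (hα : 1 < α) (hα₂ : α ≤ 2) (hβ : α < β) (hε : 0 < ε) :
    ((n : ℝ) + 1) ^ 3 * truncScale n α β p ε ^ (1 / (α - 1)) *
        ((1 - (2 : ℝ) ^ (-(1 / (β - 1))))⁻¹) ^ n ≤
      (8 * cP p * qAB α β / (1 - 2 ^ (1 - α))) ^ (1 / (α - 1)) *
        baseB (n + 1) α β p ^ (-((n + 1 : ℕ) : ℤ)) * ε⁻¹ ^ (1 / (α - 1)) := by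
  have := qAB_pos hα hβ
  have : 0 < cP p := cP_pos
  have := one_sub_two_rpow_one_sub_pos hα
  have hb := one_sub_two_rpow_pos (hα.trans hβ)
  have hbase := baseB_zpow_neg (p := p) hα hβ (Nat.le_add_left 1 n)
  push_cast at hbase
  set u := 1 / (α - 1)
  set b := 1 - (2 : ℝ) ^ (-(1 / (β - 1)))
  set Q := (8 * cP p * qAB α β / (1 - 2 ^ (1 - α))) ^ u
  set Y := ((cP p * 2 ^ (α + 1) * qAB α β) ^ (n + 1))⁻¹ ^ u
  have hscale : truncScale n α β p ε ^ u = Q * (n + 1) ^ u * Y * ε⁻¹ ^ u := by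
    rw [truncScale_eq hα hβ hε, Real.mul_rpow (by positivity) (by positivity),
      Real.mul_rpow (by positivity) (by positivity), Real.mul_rpow (by positivity) (by positivity)]
  have hdim : ((n : ℝ) + 1) ^ 3 * (n + 1) ^ u ≤ (n + 1) ^ (2 * α * u) :=
    pow_three_mul_rpow_le hα hα₂ (by simp)
  have hbpow : b⁻¹ ^ n ≤ (b ^ (n + 1))⁻¹ := by
    rw [← inv_pow]
    exact pow_le_pow_right₀ ((one_le_inv₀ hb).2 (sub_le_self 1 (by positivity))) n.le_succ
  push_cast
  rw [hscale, hbase]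
  calc ((n : ℝ) + 1) ^ 3 * (Q * (n + 1) ^ u * Y * ε⁻¹ ^ u) * b⁻¹ ^ n
      = (Q * Y * ε⁻¹ ^ u) * ((((n : ℝ) + 1) ^ 3 * (n + 1) ^ u) * b⁻¹ ^ n) := by ring
    _ ≤ (Q * Y * ε⁻¹ ^ u) * ((n + 1) ^ (2 * α * u) * (b ^ (n + 1))⁻¹) := by gcongr
    _ = _ := by ring

theorem size_bound_le {J R : ℕ} {C M : ℝ} (hα : 1 < α) (hα₂ : α ≤ 2) (hβ : α < β) (hε : 0 < ε)
    (hC : 0 ≤ C) (hM : 1 ≤ M) (hJ : (2 : ℝ) ^ J ≤ 2 * (n + 1))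
    (hJR : (J : ℝ) * (R + 1) ≤ 2 * C * ((n + 1) * M)) :
    ((n + 1) * (2 * 2 ^ truncLevel n α β p ε * ((1 - (2 : ℝ) ^ (-(1 / (β - 1))))⁻¹) ^ n)) *
        (2 ^ J * 9) * (3 + 19 * (J * (R + 1))) ≤
      36 * (3 + 38 * C) * (8 * cP p * qAB α β / (1 - 2 ^ (1 - α))) ^ (1 / (α - 1)) *
        baseB (n + 1) α β p ^ (-((n + 1 : ℕ) : ℤ)) * ε⁻¹ ^ (1 / (α - 1)) * M := by
  have := one_sub_two_rpow_pos (hα.trans hβ)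
  have hX := truncScale_pos (n := n) (p := p) hα hβ hε
  have hlinear : 3 + 19 * ((J : ℝ) * (R + 1)) ≤ (3 + 38 * C) * (n + 1) * M := by
    have : 1 ≤ ((n : ℝ) + 1) * M := one_le_mul_of_one_le_of_one_le (by simp) hM
    linarith
  rw [two_rpow_truncLevel hα hβ hε]
  set u := 1 / (α - 1)
  set X := truncScale n α β p ε
  set b := 1 - (2 : ℝ) ^ (-(1 / (β - 1)))
  calc _ ≤ ((n + 1) * (2 * X ^ u * b⁻¹ ^ n)) * ((2 * (n + 1)) * 9) *
        ((3 + 38 * C) * (n + 1) * M) := by gcongr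
    _ = 36 * (3 + 38 * C) * (((n : ℝ) + 1) ^ 3 * X ^ u * b⁻¹ ^ n) * M := by ring
    _ ≤ 36 * (3 + 38 * C) * ((8 * cP p * qAB α β / (1 - 2 ^ (1 - α))) ^ u *
        baseB (n + 1) α β p ^ (-((n + 1 : ℕ) : ℤ)) * ε⁻¹ ^ u) * M := by
        gcongr ?_ * _
        exact mul_le_mul_of_nonneg_left (pow_three_mul_truncScale_rpow_le hα hα₂ hβ hε)
          (by positivity)
    _ = _ := by ring

end Truncation

theorem exists_approximating_architecture {α β ε : ℝ} {p : ℝ≥0∞} {d : ℕ} (hα : 1 < α) (hα₂ : α ≤ 2)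
    (hβ : α < β) (hp : 1 ≤ p) (hd : 2 ≤ d) (hε : 0 < ε) (hε0 : ε < eps0 d α β p) :
    ∃ (S : NetShape d) (A : NeuralNet S), A.IsArchitecture ∧
      (∀ f ∈ holderBall d α, ∃ Φ : NeuralNet S, Φ.HasArchitecture A ∧
        MemSobolevZero p (fun x => f x - Φ.output x) ∧
        sobolevNorm p (fun x => f x - Φ.output x) ≤ ENNReal.ofReal ε) ∧
      (A.depth : ℝ) ≤ (2 * accuracyConst α + 2) * Real.logb 2 d * max 1 (Real.logb 2 ε⁻¹) ∧
      (A.size : ℝ) ≤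
        36 * (3 + 38 * accuracyConst α) *
          (8 * cP p * qAB α β / (1 - 2 ^ (1 - α))) ^ (1 / (α - 1)) *
          baseB d α β p ^ (-(d : ℤ)) * ε⁻¹ ^ (1 / (α - 1)) * max 1 (Real.logb 2 ε⁻¹) := by
  obtain ⟨n, rfl⟩ : ∃ n, d = n + 1 := ⟨d - 1, by lia⟩
  obtain ⟨R, hR, hRM, hRε⟩ := exists_accuracy hα n.succ_pos hε hε0
  obtain ⟨J, hJ, hJ2, hJlog⟩ := exists_two_pow_between hd
  obtain ⟨S, A, hA, hdepth, hsize, hreal⟩ :=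
    exists_architecture_sum_approxLevel J R (sparseLevels (n + 1) β (truncLevel n α β p ε))
  push_cast at hJ2 hRε
  have hC := accuracyConst_pos hα
  set M := max 1 (Real.logb 2 ε⁻¹)
  have hM : 1 ≤ M := le_max_left _ _
  have hlogd := one_le_logb_two_natCast hd
  have hJR : (J : ℝ) * (R + 1) ≤
      2 * accuracyConst α * (Real.logb 2 ((n + 1 : ℕ) : ℝ) * M) := by
    calc (J : ℝ) * (R + 1) ≤ (2 * Real.logb 2 ((n + 1 : ℕ) : ℝ)) * (accuracyConst α * M) := by
          gcongr
      _ = _ := by ring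
  refine ⟨S, A, hA, fun f hf => ?_, ?_, ?_⟩
  · obtain ⟨Φ, hΦ, hout⟩ := hreal f
    refine ⟨Φ, hΦ, ?_⟩
    simp only [hout]
    exact ⟨memSobolevZero_sub_sum_approxLevel n.succ_pos hα hJ hR hf _ p,
      sobolevNorm_sub_sum_approxLevel_truncLevel_le hα hβ hp hε hJ hJ2 hR hRε hf⟩
  · have : 1 ≤ Real.logb 2 ((n + 1 : ℕ) : ℝ) * M := one_le_mul_of_one_le_of_one_le hlogd hM
    rw [hdepth]
    push_cast at hJR this ⊢
    linarith
  · have hlog_le : Real.logb 2 ((n + 1 : ℕ) : ℝ) * M ≤ (n + 1) * M := by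
      gcongr
      exact_mod_cast logb_two_natCast_le n.succ_pos
    refine le_trans ?_ (size_bound_le hα hα₂ hβ hε hC.le hM hJ2 (hJR.trans (by gcongr)))
    calc (A.size : ℝ) ≤ _ := Nat.cast_le.2 hsize
      _ ≤ _ := by
        push_cast
        gcongr
        exact sum_prod_two_pow_sparseLevels_le (hα.trans hβ) _

/-! ### The base `B` in high dimension -/

theorem one_le_cP {p : ℝ≥0∞} : 1 ≤ cP p := by
  rw [cP]
  split_ifs
  · exact le_rfl
  · exact Real.one_le_rpow (by linarith [p.toReal_nonneg]) (by positivity)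

theorem sqrt_three_le_cP {p : ℝ≥0∞} (hp : 1 ≤ p) (hp2 : p ≤ 2) : √3 ≤ cP p := by
  have htop : p ≠ ⊤ := ne_top_of_le_ne_top ENNReal.ofNat_ne_top hp2
  have h1 : 1 ≤ p.toReal := by simpa using ENNReal.toReal_mono htop hp
  have h2 : p.toReal ≤ 2 := by simpa using ENNReal.toReal_mono ENNReal.ofNat_ne_top hp2
  have hbernoulli : (3 : ℝ) ^ (p.toReal / 2) ≤ p.toReal + 1 := by
    have := rpow_one_add_le_one_add_mul_self (s := (2 : ℝ)) (by norm_num)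
      (p := p.toReal / 2) (by linarith) (by linarith)
    norm_num at this
    linarith
  calc √3 = (3 ^ (p.toReal / 2)) ^ (1 / p.toReal) := by
        rw [Real.sqrt_eq_rpow, ← Real.rpow_mul zero_le_three]
        congr 1
        field_simp
    _ ≤ (p.toReal + 1) ^ (1 / p.toReal) :=
        Real.rpow_le_rpow (by positivity) hbernoulli (by positivity)
    _ = cP p := by rw [cP, if_neg htop]

theorem condAlpha_of_le_two {α : ℝ} (hα : 1 < α) (hα₂ : α ≤ 2) {p : ℝ≥0∞} (hp : 1 ≤ p)
    (hp2 : p ≤ 2) : CondAlpha α p := by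
  have hexp : 1 / 2 ≤ 1 / α := one_div_le_one_div_of_le (by linarith) hα₂
  have htwo : (1.41 : ℝ) ≤ 2 ^ (1 / α) :=
    calc (1.41 : ℝ) ≤ √2 := Real.le_sqrt_of_sq_le (by norm_num)
      _ = 2 ^ (1 / 2 : ℝ) := Real.sqrt_eq_rpow 2
      _ ≤ 2 ^ (1 / α) := Real.rpow_le_rpow_of_exponent_le one_le_two hexp
  have hcP : (1.73 : ℝ) ≤ cP p :=
    (Real.le_sqrt_of_sq_le (by norm_num)).trans (sqrt_three_le_cP hp hp2)
  have hroot : (1.25 : ℝ) ≤ cP p ^ (1 / α) :=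
    calc (1.25 : ℝ) ≤ √1.73 := Real.le_sqrt_of_sq_le (by norm_num)
      _ = 1.73 ^ (1 / 2 : ℝ) := Real.sqrt_eq_rpow _
      _ ≤ cP p ^ (1 / 2 : ℝ) := Real.rpow_le_rpow (by norm_num) hcP (by norm_num)
      _ ≤ cP p ^ (1 / α) := Real.rpow_le_rpow_of_exponent_le one_le_cP hexp
  have hinv : cP p ^ (-(1 / α)) ≤ 0.8 := by
    rw [Real.rpow_neg (by linarith), inv_le_comm₀ (by linarith) (by norm_num)]
    exact le_trans (by norm_num) hroot
  rw [CondAlpha]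
  linarith

/-- The number `1 - 2^λ` for the `λ` of the condition on `β`. -/
def lambdaGap (α : ℝ) (p : ℝ≥0∞) : ℝ := cP p ^ (-(1 / α)) * 2 ^ (-1 - 1 / α)

section LambdaGap

variable {α β : ℝ} {p : ℝ≥0∞}

theorem lambdaGap_pos : 0 < lambdaGap α p := by
  have : 0 < cP p := cP_pos
  unfold lambdaGap
  positivity

theorem lambdaGap_lt_half (hα : 0 < α) : lambdaGap α p < 1 / 2 := by
  have hα0 : 0 < 1 / α := one_div_pos.2 hα
  have hcP : cP p ^ (-(1 / α)) ≤ 1 :=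
    Real.rpow_le_one_of_one_le_of_nonpos one_le_cP (neg_nonpos.2 hα0.le)
  calc lambdaGap α p ≤ 1 * (2 : ℝ) ^ (-1 - 1 / α) := by unfold lambdaGap; gcongr
    _ < 2 ^ (-1 : ℝ) := by
        rw [one_mul]
        exact Real.rpow_lt_rpow_of_exponent_lt one_lt_two (by linarith)
    _ = 1 / 2 := by rw [Real.rpow_neg_one, one_div]

theorem lambdaGap_rpow_mul (hα : 0 < α) : lambdaGap α p ^ α * (cP p * 2 ^ (α + 1)) = 1 := by
  have hc : 0 < cP p := cP_pos
  have hcexp : -(1 / α) * α = -1 := by field_simp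
  have htwoexp : (-1 - 1 / α) * α = -(α + 1) := by field_simp; ring
  rw [lambdaGap, Real.mul_rpow (by positivity) (by positivity), ← Real.rpow_mul hc.le,
    ← Real.rpow_mul zero_le_two, hcexp, htwoexp, Real.rpow_neg_one, Real.rpow_neg zero_le_two]
  field_simp

theorem two_rpow_ellAP (hα : 0 < α) : (2 : ℝ) ^ ellAP α p = 1 - lambdaGap α p :=
  Real.rpow_logb two_pos one_lt_two.ne'
    (show 0 < 1 - lambdaGap α p by linarith [lambdaGap_lt_half (p := p) hα])

theorem ellAP_neg (hα : 0 < α) : ellAP α p < 0 := by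
  have := lambdaGap_lt_half (p := p) hα
  have := lambdaGap_pos (α := α) (p := p)
  exact Real.logb_neg one_lt_two (by change 0 < 1 - lambdaGap α p; linarith)
    (by change 1 - lambdaGap α p < 1; linarith)

theorem neg_one_lt_ellAP (hα : 0 < α) : -1 < ellAP α p := by
  have := lambdaGap_lt_half (p := p) hα
  rw [← Real.rpow_lt_rpow_left_iff one_lt_two, two_rpow_ellAP hα, Real.rpow_neg_one]
  linarith

theorem CondBeta.lambdaGap_lt_one_sub_two_rpow (h : CondBeta α β p) (hα : 0 < α) (hβ : 1 < β) :
    lambdaGap α p < 1 - (2 : ℝ) ^ (-(1 / (β - 1))) := by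
  have hneg := ellAP_neg (p := p) hα
  have hexp : -(1 / (β - 1)) < ellAP α p := by
    have : (β - 1) * ellAP α p > -(1 / ellAP α p) * ellAP α p :=
      mul_lt_mul_of_neg_right (by linarith [h.2]) hneg
    rw [neg_mul, one_div_mul_cancel hneg.ne] at this
    rw [← neg_div, div_lt_iff₀ (sub_pos.2 hβ)]
    linarith
  have := Real.rpow_lt_rpow_of_exponent_lt one_lt_two hexp
  rw [two_rpow_ellAP hα] at this
  linarith

theorem CondBeta.lambdaGap_lt_qAB (h : CondBeta α β p) (hα : 0 < α) (hβ : 1 < β) :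
    lambdaGap α p < qAB α β := by
  have hexp : -((β - α) / (β - 1)) < ellAP α p := by
    have hleft := h.1
    rw [div_lt_iff₀ (by linarith [neg_one_lt_ellAP (p := p) hα])] at hleft
    rw [← neg_div, div_lt_iff₀ (sub_pos.2 hβ)]
    linarith
  have := Real.rpow_lt_rpow_of_exponent_lt one_lt_two hexp
  rw [two_rpow_ellAP hα] at this
  rw [qAB]
  linarith

theorem one_lt_limit_baseB (hα : 1 < α) (hβ : α < β) (h : CondBeta α β p) :
    1 < (1 - (2 : ℝ) ^ (-(1 / (β - 1)))) *
      (cP p * 2 ^ (α + 1) * qAB α β) ^ (1 / (α - 1)) := by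
  have hα0 : 0 < α := by linarith
  have hα1 : 0 < α - 1 := sub_pos.2 hα
  have hc : 0 < cP p := cP_pos
  have ht : 0 < lambdaGap α p := lambdaGap_pos
  have hb := h.lambdaGap_lt_one_sub_two_rpow hα0 (hα.trans hβ)
  have hq := h.lambdaGap_lt_qAB hα0 (hα.trans hβ)
  set t := lambdaGap α p
  set b := 1 - (2 : ℝ) ^ (-(1 / (β - 1)))
  have hb0 : 0 < b := ht.trans hb
  have hq0 : 0 < qAB α β := ht.trans hq
  have hpow : 1 < b ^ (α - 1) * (cP p * 2 ^ (α + 1) * qAB α β) :=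
    calc (1 : ℝ) = t ^ α * (cP p * 2 ^ (α + 1)) := (lambdaGap_rpow_mul hα0).symm
      _ = t ^ (α - 1) * (cP p * 2 ^ (α + 1) * t) := by
          rw [← sub_add_cancel α 1, Real.rpow_add_one ht.ne', sub_add_cancel]
          ring
      _ < b ^ (α - 1) * (cP p * 2 ^ (α + 1) * qAB α β) := by
          gcongr
  have := Real.one_lt_rpow hpow (one_div_pos.2 hα1)
  rwa [Real.mul_rpow (by positivity) (by positivity), ← Real.rpow_mul hb0.le,
    mul_one_div_cancel hα1.ne', Real.rpow_one] at this

end LambdaGap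

theorem tendsto_baseB {α β : ℝ} (hα : 1 ≤ α) (p : ℝ≥0∞) :
    Filter.Tendsto (fun d : ℕ => baseB d α β p) Filter.atTop
      (nhds ((1 - (2 : ℝ) ^ (-(1 / (β - 1)))) *
        (cP p * 2 ^ (α + 1) * qAB α β) ^ (1 / (α - 1)))) := by
  have hroot : Filter.Tendsto (fun d : ℕ => (d : ℝ) ^ (2 * α / d)) Filter.atTop (nhds 1) := by
    have := (tendsto_rpow_div_mul_add (2 * α) 1 0 zero_ne_one).comp tendsto_natCast_atTop_atTop
    simpa [Function.comp_def] using this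
  have hquot := (tendsto_const_nhds (x := cP p * 2 ^ (α + 1) * qAB α β)).div hroot one_ne_zero
  rw [div_one] at hquot
  exact (hquot.rpow_const (Or.inr (one_div_nonneg.2 (sub_nonneg.2 hα)))).const_mul _

theorem exists_one_lt_le_baseB {α β : ℝ} (hα : 1 < α) (hβ : α < β) {p : ℝ≥0∞}
    (h : CondBeta α β p) :
    ∃ (d₀ : ℕ) (B₀ : ℝ), 1 < B₀ ∧ ∀ d : ℕ, d₀ ≤ d → B₀ ≤ baseB d α β p := by
  obtain ⟨B₀, hB₀, hlim⟩ := exists_between (one_lt_limit_baseB hα hβ h)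
  obtain ⟨d₀, hd₀⟩ := Filter.eventually_atTop.1
    ((tendsto_baseB hα.le p).eventually (lt_mem_nhds hlim))
  exact ⟨d₀, B₀, hB₀, fun d hd => (hd₀ d hd).le⟩

end ReLUApprox

end

open ReLUApprox in
theorem theorem4p3 (α : ℝ) (hα₁ : 1 < α) (hα₂ : α ≤ 2) :
    ∃ K₂ : ℝ, 0 < K₂ ∧ ∀ (β : ℝ) (p : ENNReal), α < β → 1 ≤ p →
      (∃ K₃ : ℝ, 0 < K₃ ∧ ∀ d : ℕ, 2 ≤ d → ∀ ε : ℝ, 0 < ε → ε < eps0 d α β p →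
        ∃ (S : NetShape d) (A : NeuralNet S), A.IsArchitecture ∧
          (∀ f ∈ holderBall d α, ∃ Φ : NeuralNet S, Φ.HasArchitecture A ∧
            MemSobolevZero p (fun x => f x - Φ.output x) ∧
            sobolevNorm p (fun x => f x - Φ.output x) ≤ ENNReal.ofReal ε) ∧
          (A.depth : ℝ) ≤ K₂ * Real.logb 2 d * max 1 (Real.logb 2 ε⁻¹) ∧
          (A.size : ℝ) ≤
            K₃ * baseB d α β p ^ (-(d : ℤ)) * ε⁻¹ ^ (1 / (α - 1)) * max 1 (Real.logb 2 ε⁻¹)) ∧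
      (CondAlpha α p → CondBeta α β p →
        ∃ (d₀ : ℕ) (B₀ : ℝ), 1 < B₀ ∧ ∀ d : ℕ, d₀ ≤ d → B₀ ≤ baseB d α β p) ∧
      (p ≤ 2 → CondAlpha α p) := by
  have hC := accuracyConst_pos hα₁
  have hγ := one_sub_two_rpow_one_sub_pos hα₁
  refine ⟨2 * accuracyConst α + 2, by positivity, fun β p hβ hp => ⟨?_, ?_, ?_⟩⟩
  · have hq := qAB_pos hα₁ hβ
    have hc : 0 < cP p := cP_pos
    exact ⟨36 * (3 + 38 * accuracyConst α) *
        (8 * cP p * qAB α β / (1 - 2 ^ (1 - α))) ^ (1 / (α - 1)), by positivity,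
      fun d hd ε hε hε0 => exists_approximating_architecture hα₁ hα₂ hβ hp hd hε hε0⟩
  · exact fun _ hcond => exists_one_lt_le_baseB hα₁ hβ hcond
  · exact condAlpha_of_le_two hα₁ hα₂ hp
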